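/- **Setting.** Let $L(x)=\sum_i L_ix^i$ and $R(x)=\sum_j R_jx^j$ be polynomials with nonnegative coefficients, $L_0=R_0=0$, $L(1)=R(1)=1$, and put $\lambda(x)=\sum_i\lambda_ix^{i-1}=L'(x)/L'(1)$, $\rho(x)=\sum_j\rho_jx^{j-1}=R'(x)/R'(1)$. At blocklength $n$ the $(\lambda,\rho)$-irregular ensemble has $nL_i$ variable nodes of degree $i$ and $mR_j$ check nodes of degree $j$, $m=nL'(1)/R'(1)$; a node of degree $d$ has $d$ ordered sockets, and the variable-node sockets are matched with the check-node sockets by a uniformly random bijection. All limits $n\to\infty$ are over those $n$ for which all $nL_i$ and $mR_j$ are integers, and we assume that there is such an $n\ge1$. Let $\epsilon\in[0,1]$ and $t\ge0$. The channel erases every variable node independently with probability $\epsilon$, and $t$ iterations of belief propagation (BP) are run. The distance of two nodes is the least number of check nodes on a path between them, ends excluded. The depth-$t$ neighborhood graph of a variable node $v_0$ has root $v_0$ and consists of the variable nodes at distance $\le t$ and the check nodes at distance $\le t-1$ from $v_0$, their sockets, and all edges between them. Two neighborhood graphs are identified if there is an isomorphism between them that preserves the root and the order of its sockets and preserves the socket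 order of every other node up to a cyclic shift. Let $\mathcal T_t$ be the set of classes of cycle-free depth-$t$ neighborhood graphs, $\mathbb P_n(G)$ the probability that the depth-$t$ neighborhood graph of a uniformly random variable node belongs to the class $G$, $\mathrm P_b(\epsilon,G)$ the probability that the root of $G$ is erased after $t$ BP iterations on $G$, and $\mathrm P_b(n,\epsilon,t)$ the bit error probability, i.e. the average over the ensemble and over all variable nodes of the probability of being erased after $t$ iterations. The tree ensemble gives $G\in\mathcal T_t$ with root $v_0$ the probability $L_{|v_0|}\prod_{v\ne v_0}\lambda_{|v|}\prod_c\rho_{|c|}$, where $|\cdot|$ is the degree and $v$, $c$ run over the variable and check nodes of $G$; $\mathbb E_t$ is its expectation. Let $K$ be the number of edges of $G$, $V_i$ the number of its variable nodes of degree $i$ (root included), $C_j$ the number of its check nodes of degree $j$, and $P=\mathrm P_b(\epsilon,G)$. Density evolution is $P_\epsilon(0)=1$, $Q_\epsilon(t)=\epsilon\lambda(P_\epsilon(t-1))$ and $P_\epsilon(t)=1-\rho(1-Q_\epsilon(t))$ for $t\ge1$. Augmented density evolution has auxiliary variables $y_k$, $z_l$: with $\mathfrak L(x)=\sum_iL_iy_ix^i$,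 $\mathcal L(x)=\sum_i\lambda_iy_ix^{i-1}$, $\mathcal P(x)=\sum_j\rho_jz_jx^{j-1}$, put $f(0)=F(0)=1$ and, for $t\ge1$, $$g(t)=\mathcal L(f(t-1)),\quad f(t)=\mathcal P(g(t)),\quad G(t)=\mathcal L(f(t-1))-\epsilon\mathcal L(F(t-1)),\quad F(t)=\mathcal P(g(t))-\mathcal P(G(t)).$$ For $h\in\{f,g,F,G\}$ and $n=1,2$ let $h^{(n)}(t)$ be the $n$-th derivative at $x=1$ of $h(t)$ with all $y_k=z_l=x$, and let $h_v^{(n)}(t,i)$ and $h_c^{(n)}(t,j)$ be the $n$-th partial derivatives of $h(t)$ in $y_i$ and in $z_j$ at the point where all $y_k=z_l=1$. **Theorem.** The limit $\mathrm P_b(\infty,\epsilon,t)=\lim_{n\to\infty}\mathrm P_b(n,\epsilon,t)$ exists and equals $\epsilon L(P_\epsilon(t))$. The contribution of cycle-free neighborhood graphs to the coefficient of $1/n$, $$\beta(\epsilon,t)=\lim_{n\to\infty}n\Bigl(\sum_{G\in\mathcal T_t}\mathbb P_n(G)\mathrm P_b(\epsilon,G)-\mathrm P_b(\infty,\epsilon,t)\Bigr),$$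 exists and, with sums over the $i$ with $L_i\ne0$ and the $j$ with $R_j\ne0$, $$\beta(\epsilon,t)=\frac1{2L'(1)}\Bigl[\mathbb E_t[K(K-1)P]-\sum_i\frac i{\lambda_i}\mathbb E_t[V_i(V_i-1)P]-\sum_j\frac j{\rho_j}\mathbb E_t[C_j(C_j-1)P]\Bigr].$$ The tree ensemble is finitely supported, and $\mathbb E_t\bigl[\prod_ky_k^{V_k}\prod_lz_l^{C_l}P\bigr]=\epsilon\,\mathfrak L(F(t))$. Moreover, for all $i,j$, $$\begin{aligned} \mathbb E_t[K(K-1)P]&=\epsilon L''(P_\epsilon(t))F^{(1)}(t)^2+\epsilon L'(P_\epsilon(t))F^{(2)}(t),\\ \mathbb E_t[V_i(V_i-1)P]&=\epsilon L''(P_\epsilon(t))F_v^{(1)}(t,i)^2+\epsilon L'(P_\epsilon(t))F_v^{(2)}(t,i)+2\epsilon L_i\,i\,P_\epsilon(t)^{i-1}F_v^{(1)}(t,i),\\ \mathbb E_t[C_j(C_j-1)P]&=\epsilon L''(P_\epsilon(t))F_c^{(1)}(t,j)^2+\epsilon L'(P_\epsilon(t))F_c^{(2)}(t,j). \end{aligned}$$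 All first and second derivatives of $f$ and $F$ vanish at $t=0$. For $t\ge1$, writing $P'=P_\epsilon(t-1)$ and $q=1-Q_\epsilon(t)$, and with $f,F$ on the right-hand sides of the formulas for $g,G$ taken at $t-1$ and everything else at $t$: $$\begin{aligned} f^{(1)}&=1+\rho'(1)g^{(1)},\qquad g^{(1)}=1+\lambda'(1)f^{(1)},\\ F^{(1)}&=f^{(1)}-\rho(q)-\rho'(q)G^{(1)},\qquad G^{(1)}=g^{(1)}-\epsilon\lambda(P')-\epsilon\lambda'(P')F^{(1)},\\ f^{(2)}&=2\rho'(1)g^{(1)}+\rho''(1)(g^{(1)})^2+\rho'(1)g^{(2)},\\ g^{(2)}&=2\lambda'(1)f^{(1)}+\lambda''(1)(f^{(1)})^2+\lambda'(1)f^{(2)},\\ F^{(2)}&=f^{(2)}-2\rho'(q)G^{(1)}-\rho''(q)(G^{(1)})^2-\rho'(q)G^{(2)},\\ G^{(2)}&=g^{(2)}-2\epsilon\lambda'(P')F^{(1)}-\epsilon\lambda''(P')(F^{(1)})^2-\epsilon\lambda'(P')F^{(2)}; \end{aligned}$$ $$\begin{aligned} f_v^{(1)}&=\rho'(1)g_v^{(1)},\qquad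 g_v^{(1)}=\lambda'(1)f_v^{(1)}+\lambda_i,\\ F_v^{(1)}&=f_v^{(1)}-\rho'(q)G_v^{(1)},\qquad G_v^{(1)}=g_v^{(1)}-\epsilon\lambda'(P')F_v^{(1)}-\epsilon\lambda_iP'^{\,i-1},\\ f_v^{(2)}&=\rho''(1)(g_v^{(1)})^2+\rho'(1)g_v^{(2)},\\ g_v^{(2)}&=\lambda''(1)(f_v^{(1)})^2+\lambda'(1)f_v^{(2)}+2\lambda_i(i-1)f_v^{(1)},\\ F_v^{(2)}&=f_v^{(2)}-\rho''(q)(G_v^{(1)})^2-\rho'(q)G_v^{(2)},\\ G_v^{(2)}&=g_v^{(2)}-\epsilon\lambda''(P')(F_v^{(1)})^2-\epsilon\lambda'(P')F_v^{(2)}-2\epsilon\lambda_i(i-1)P'^{\,i-2}F_v^{(1)}; \end{aligned}$$ $$\begin{aligned} f_c^{(1)}&=\rho'(1)g_c^{(1)}+\rho_j,\qquad g_c^{(1)}=\lambda'(1)f_c^{(1)},\\ F_c^{(1)}&=f_c^{(1)}-\rho'(q)G_c^{(1)}-\rho_jq^{j-1},\qquad G_c^{(1)}=g_c^{(1)}-\epsilon\lambda'(P')F_c^{(1)},\\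 f_c^{(2)}&=\rho''(1)(g_c^{(1)})^2+\rho'(1)g_c^{(2)}+2\rho_j(j-1)g_c^{(1)},\\ g_c^{(2)}&=\lambda''(1)(f_c^{(1)})^2+\lambda'(1)f_c^{(2)},\\ F_c^{(2)}&=f_c^{(2)}-\rho''(q)(G_c^{(1)})^2-\rho'(q)G_c^{(2)}-2\rho_j(j-1)q^{j-2}G_c^{(1)},\\ G_c^{(2)}&=g_c^{(2)}-\epsilon\lambda''(P')(F_c^{(1)})^2-\epsilon\lambda'(P')F_c^{(2)}. \end{aligned}$$ (Here $i$ and $j$ are fixed; a term with the factor $i-1=0$ or $j-1=0$ is $0$.) -/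

import Mathlib

open Polynomial Filter Topology

noncomputable section

namespace LDPC

/-! ### Tanner graphs with sockets -/

/-- A bipartite graph with variable nodes `V`, check nodes `C` and sockets. The sockets of a
variable node `v` are the pairs `(v, i)` with `i < degV v`, those of a check node `c` are the pairs
`(c, j)` with `j < degC c`. `Edge v i c j` says that the sockets `(v, i)` and `(c, j)` are connected.
A socket is connected to at most one edge. -/
structure SocketGraph (V C : Type) where
  degV : V → ℕ
  degC : C → ℕ
  Edge : V → ℕ → C → ℕ → Prop
  lt_degV : ∀ {v i c j}, Edge v i c j → i < degV v
  lt_degC : ∀ {v i c j}, Edge v i c j → j < degC c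
  unique_right : ∀ {v i c j c' j'}, Edge v i c j → Edge v i c' j' → c = c' ∧ j = j'
  unique_left : ∀ {v i v' i' c j}, Edge v i c j → Edge v' i' c j → v = v' ∧ i = i'

namespace SocketGraph

variable {V C : Type}

/-- A Tanner graph: every node has a socket, and every socket is connected. -/
def IsTanner (G : SocketGraph V C) : Prop :=
  (∀ v, 0 < G.degV v) ∧ (∀ c, 0 < G.degC c) ∧
  (∀ v i, i < G.degV v → ∃ c j, G.Edge v i c j) ∧
  (∀ c j, j < G.degC c → ∃ v i, G.Edge v i c j)

/-- The variable node `v` and the check node `c` are joined by an edge. -/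
def Adj (G : SocketGraph V C) (v : V) (c : C) : Prop := ∃ i j, G.Edge v i c j

/-- `nearV v₀ t`: the variable nodes that are joined to `v₀` by a path that passes through at most
`t` check nodes, i.e. those at distance at most `t` from `v₀`. -/
def nearV (G : SocketGraph V C) (v₀ : V) : ℕ → Set V
  | 0 => {v₀}
  | t + 1 => nearV G v₀ t ∪ {v | ∃ w ∈ nearV G v₀ t, ∃ c, G.Adj w c ∧ G.Adj v c}

/-- `nearC v₀ t`: the check nodes at distance at most `t - 1` from `v₀` (none if `t = 0`), where the
end `c` of a path is not counted. -/
def nearC (G : SocketGraph V C) (v₀ : V) (t : ℕ) : Set C :=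
  {c | ∃ r < t, ∃ w ∈ G.nearV v₀ r, G.Adj w c}

/-! ### Belief propagation on the erasure channel -/

/-- Given the messages `msg v i` out of the variable-node sockets (true: erased), the message that
the check node `c` sends through its socket `j` is erased iff one of the messages that it receives
through its other sockets is erased. -/
def checkErased (G : SocketGraph V C) (msg : V → ℕ → Prop) (c : C) (j : ℕ) : Prop :=
  ∃ v i j', j' ≠ j ∧ G.Edge v i c j' ∧ msg v i

/-- The message which the variable node `v` sends through its socket `i` after `r` rounds is erased,
where `S` is the set of the variable nodes that the channel erases. -/
def varErased (G : SocketGraph V C) (S : Set V) : ℕ → V → ℕ → Prop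
  | 0 => fun v _ => v ∈ S
  | r + 1 => fun v i => v ∈ S ∧
      ∀ i' c j, i' ≠ i → G.Edge v i' c j → G.checkErased (varErased G S r) c j

/-- The bit `v` is still erased after `t` iterations of belief propagation. -/
def bitErased (G : SocketGraph V C) (S : Set V) : ℕ → V → Prop
  | 0 => fun v => v ∈ S
  | r + 1 => fun v => v ∈ S ∧
      ∀ i c j, G.Edge v i c j → G.checkErased (G.varErased S r) c j

open Classical in
/-- The probability that the bit `v` is erased after `t` iterations when every variable node is
erased by the channel independently with probability `ε`. -/
def erasureProb [Fintype V] (G : SocketGraph V C) (ε : ℝ) (t : ℕ) (v : V) : ℝ :=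
  ∑ S : Finset V, if G.bitErased (↑S) t v
    then ε ^ S.card * (1 - ε) ^ (Fintype.card V - S.card) else 0

end SocketGraph

/-! ### Neighborhood graphs -/

/-- A finite socket graph with a root variable node. -/
structure RootedGraph : Type 1 where
  V : Type
  C : Type
  instV : Fintype V
  instC : Fintype C
  graph : SocketGraph V C
  root : V

attribute [instance] RootedGraph.instV RootedGraph.instC

/-- The neighborhood graph of depth `t` of `v₀`: the variable nodes at distance at most `t`, the
check nodes at distance at most `t - 1`, all their sockets, and all edges between these. -/
def SocketGraph.nbhd {V C : Type} [Fintype V] [Fintype C] (G : SocketGraph V C) (v₀ : V) (t : ℕ) :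
    RootedGraph where
  V := {v // v ∈ G.nearV v₀ t}
  C := {c // c ∈ G.nearC v₀ t}
  instV := Fintype.ofFinite _
  instC := Fintype.ofFinite _
  graph :=
    { degV := fun v => G.degV v.1
      degC := fun c => G.degC c.1
      Edge := fun v i c j => G.Edge v.1 i c.1 j
      lt_degV := fun h => G.lt_degV h
      lt_degC := fun h => G.lt_degC h
      unique_right := fun h h' =>
        ⟨Subtype.ext (G.unique_right h h').1, (G.unique_right h h').2⟩
      unique_left := fun h h' =>
        ⟨Subtype.ext (G.unique_left h h').1, (G.unique_left h h').2⟩ }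
  root := ⟨v₀, by
    induction t with
    | zero => exact rfl
    | succ t ih => exact Or.inl ih⟩

namespace RootedGraph

/-- The number `K` of edges. -/
def numEdges (G : RootedGraph) : ℕ :=
  {e : G.V × ℕ × G.C × ℕ | G.graph.Edge e.1 e.2.1 e.2.2.1 e.2.2.2}.ncard

/-- The number `V_i` of variable nodes of degree `i` (the root included). -/
def numV (G : RootedGraph) (i : ℕ) : ℕ := {v : G.V | G.graph.degV v = i}.ncard

/-- The number `C_j` of check nodes of degree `j`. -/
def numC (G : RootedGraph) (j : ℕ) : ℕ := {c : G.C | G.graph.degC c = j}.ncard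

/-- A neighborhood graph (which is connected) has `k - w` independent cycles, where `k` is the
number of its edges, with multiplicity, and `w` the number of its nodes other than the root. It is
cycle-free iff `k = w`. -/
def CycleFree (G : RootedGraph) : Prop :=
  G.numEdges + 1 = Fintype.card G.V + Fintype.card G.C

/-- The erasure probability of the root after `t` iterations of belief propagation. -/
def rootErasure (G : RootedGraph) (ε : ℝ) (t : ℕ) : ℝ := G.graph.erasureProb ε t G.root

/-- Two rooted graphs are equivalent iff there is a bijection between their nodes and sockets which
respects the edges and the roots, which fixes the positions of the sockets of the root, and which
permutes cyclically the positions of the sockets of every other node. -/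
def Equivalent (G H : RootedGraph) : Prop :=
  ∃ (φ : G.V ≃ H.V) (ψ : G.C ≃ H.C) (k : G.V → ℕ) (l : G.C → ℕ),
    φ G.root = H.root ∧ k G.root = 0 ∧
    (∀ v, H.graph.degV (φ v) = G.graph.degV v) ∧ (∀ c, H.graph.degC (ψ c) = G.graph.degC c) ∧
    ∀ v c i j, i < G.graph.degV v → j < G.graph.degC c →
      (G.graph.Edge v i c j ↔
        H.graph.Edge (φ v) ((i + k v) % G.graph.degV v) (ψ c) ((j + l c) % G.graph.degC c))

lemma shift_inv (d k i : ℕ) (hi : i < d) : ((i + (d - k % d) % d) % d + k) % d = i := by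
  have hd : 0 < d := by omega
  have h2 := Nat.mod_lt k hd
  rw [Nat.add_mod, Nat.mod_mod, ← Nat.add_mod, Nat.add_mod (_ + _) k, ← Nat.add_mod]
  have h3 : (i + (d - k % d) % d + k) % d = (i + (d - k % d) + k % d) % d := by
    simp [Nat.add_mod]
  rw [h3]
  have h4 : i + (d - k % d) + k % d = i + d := by omega
  rw [h4, Nat.add_mod_right, Nat.mod_eq_of_lt hi]

instance setoid : Setoid RootedGraph where
  r := Equivalent
  iseqv :=
    { refl := fun G => ⟨Equiv.refl _, Equiv.refl _, fun _ => 0, fun _ => 0, rfl, rfl,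
        fun _ => rfl, fun _ => rfl, fun v c i j hi hj => by
          simp [Nat.mod_eq_of_lt hi, Nat.mod_eq_of_lt hj]⟩
      symm := by
        rintro G H ⟨φ, ψ, k, l, hr, hk, hV, hC, hE⟩
        have hV' : ∀ w, G.graph.degV (φ.symm w) = H.graph.degV w := fun w => by
          rw [← hV, φ.apply_symm_apply]
        have hC' : ∀ w, G.graph.degC (ψ.symm w) = H.graph.degC w := fun w => by
          rw [← hC, ψ.apply_symm_apply]
        refine ⟨φ.symm, ψ.symm,
          fun w => (H.graph.degV w - k (φ.symm w) % H.graph.degV w) % H.graph.degV w,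
          fun w => (H.graph.degC w - l (ψ.symm w) % H.graph.degC w) % H.graph.degC w,
          by rw [← hr, φ.symm_apply_apply], ?_, hV', hC', ?_⟩
        · simp [← hr, hk]
        · intro v c i j hi hj
          have hdi : 0 < H.graph.degV v := by omega
          have hdj : 0 < H.graph.degC c := by omega
          have := hE (φ.symm v) (ψ.symm c)
            ((i + (H.graph.degV v - k (φ.symm v) % H.graph.degV v) % H.graph.degV v)
              % H.graph.degV v)
            ((j + (H.graph.degC c - l (ψ.symm c) % H.graph.degC c) % H.graph.degC c)
              % H.graph.degC c)
            (by rw [hV']; exact Nat.mod_lt _ hdi) (by rw [hC']; exact Nat.mod_lt _ hdj)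
          rw [hV', hC', shift_inv _ _ _ hi, shift_inv _ _ _ hj, φ.apply_symm_apply,
            ψ.apply_symm_apply] at this
          exact this.symm
      trans := by
        rintro G H I ⟨φ, ψ, k, l, hr, hk, hV, hC, hE⟩ ⟨φ', ψ', k', l', hr', hk', hV', hC', hE'⟩
        refine ⟨φ.trans φ', ψ.trans ψ', fun v => k v + k' (φ v), fun c => l c + l' (ψ c),
          by simp [hr, hr'], by simp [hk, hr, hk'], fun v => by simp [hV, hV'],
          fun c => by simp [hC, hC'], fun v c i j hi hj => ?_⟩
        have hdi : 0 < G.graph.degV v := by omega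
        have hdj : 0 < G.graph.degC c := by omega
        rw [hE v c i j hi hj, hE' _ _ _ _ (by rw [hV]; exact Nat.mod_lt _ hdi)
          (by rw [hC]; exact Nat.mod_lt _ hdj), hV, hC]
        simp [Nat.add_assoc] }

end RootedGraph

/-- Equivalence classes of rooted graphs. -/
abbrev GraphClass : Type 1 := Quotient RootedGraph.setoid

/-- The set of (the classes of) all cycle-free neighborhood graphs of depth `t`. -/
def cycleFreeClasses (t : ℕ) : Set GraphClass :=
  {q | ∃ (V C : Type) (_ : Fintype V) (_ : Fintype C) (T : SocketGraph V C) (v₀ : V),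
    T.IsTanner ∧ (T.nbhd v₀ t).CycleFree ∧ q = ⟦T.nbhd v₀ t⟧}

/-! ### Irregular ensembles -/

/-- Degree distribution polynomial from the node perspective: `p.coeff i` is the fraction of the
nodes that have degree `i`, and every node has degree at least one. -/
structure IsDegreeDistribution (p : ℝ[X]) : Prop where
  nonneg : ∀ i, 0 ≤ p.coeff i
  coeff_zero : p.coeff 0 = 0
  sum_eq_one : p.eval 1 = 1

/-- The value at `x` of the `k`-th derivative of `p`. -/
def evalD (k : ℕ) (p : ℝ[X]) (x : ℝ) : ℝ := (derivative^[k] p).eval x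

/-- The degree distribution polynomial from the edge perspective, `p'(x) / p'(1)`. -/
def edgePoly (p : ℝ[X]) : ℝ[X] := Polynomial.C (evalD 1 p 1)⁻¹ * derivative p

/-- The fraction of the edges that are incident to a node of degree `i`; it is the coefficient of
`x ^ (i - 1)` in `edgePoly p` for `i ≥ 1`. -/
def edgeFrac (p : ℝ[X]) (i : ℕ) : ℝ := i * p.coeff i / evalD 1 p 1

/-- The number of check nodes at blocklength `n`. -/
def numChecks (L R : ℝ[X]) (n : ℕ) : ℝ := n * evalD 1 L 1 / evalD 1 R 1

/-- There are Tanner graphs with `n` variable nodes and degree distributions `L`, `R`: the numbers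
of nodes of each degree are integers. -/
def Admissible (L R : ℝ[X]) (n : ℕ) : Prop :=
  (∀ i, ∃ a : ℕ, n * L.coeff i = a) ∧ (∀ j, ∃ b : ℕ, numChecks L R n * R.coeff j = b)

/-- The filter `n → ∞` along the admissible blocklengths. -/
def blocklengths (L R : ℝ[X]) : Filter ℕ := atTop ⊓ 𝓟 {n | Admissible L R n}

/-- The variable nodes at blocklength `n`: there are `n * L_i` of degree `i`. -/
abbrev VNode (L : ℝ[X]) (n : ℕ) : Type := (i : {i // i ∈ L.support}) × Fin ⌊n * L.coeff i⌋₊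

/-- The check nodes at blocklength `n`: there are `m * R_j` of degree `j`, where `m` is the number
of check nodes. -/
abbrev CNode (L R : ℝ[X]) (n : ℕ) : Type :=
  (j : {j // j ∈ R.support}) × Fin ⌊numChecks L R n * R.coeff j⌋₊

/-- The variable-node sockets at blocklength `n`. -/
abbrev VSocket (L : ℝ[X]) (n : ℕ) : Type := (v : VNode L n) × Fin v.1.1

/-- The check-node sockets at blocklength `n`. -/
abbrev CSocket (L R : ℝ[X]) (n : ℕ) : Type := (c : CNode L R n) × Fin c.1.1

/-- The sample space of the ensemble: the ways to connect the sockets. -/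
abbrev Wiring (L R : ℝ[X]) (n : ℕ) : Type := VSocket L n ≃ CSocket L R n

/-- The Tanner graph in the ensemble that is given by a wiring. -/
def tanner {L R : ℝ[X]} {n : ℕ} (π : Wiring L R n) : SocketGraph (VNode L n) (CNode L R n) where
  degV := fun v => v.1.1
  degC := fun c => c.1.1
  Edge := fun v i c j => ∃ (hi : i < v.1.1) (hj : j < c.1.1), π ⟨v, ⟨i, hi⟩⟩ = ⟨c, ⟨j, hj⟩⟩
  lt_degV := fun h => h.1
  lt_degC := fun h => h.2.1
  unique_right := by
    rintro v i c j c' j' ⟨hi, hj, h⟩ ⟨_, hj', h'⟩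
    have e := h.symm.trans h'
    obtain ⟨rfl, e⟩ := Sigma.mk.inj_iff.mp e
    exact ⟨rfl, by simpa using e⟩
  unique_left := by
    rintro v i v' i' c j ⟨hi, hj, h⟩ ⟨hi', _, h'⟩
    have e := π.injective (h.trans h'.symm)
    obtain ⟨rfl, e⟩ := Sigma.mk.inj_iff.mp e
    exact ⟨rfl, by simpa using e⟩

open Classical in
/-- The bit error probability of the ensemble at blocklength `n` after `t` iterations: the average
over all wirings and all variable nodes. -/
def bitErrorProb (L R : ℝ[X]) (ε : ℝ) (t n : ℕ) : ℝ :=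
  (∑ π : Wiring L R n, ∑ v : VNode L n, (tanner π).erasureProb ε t v) /
    (Fintype.card (Wiring L R n) * Fintype.card (VNode L n))

/-- The probability that the neighborhood graph of depth `t` of a uniformly chosen variable node of
a uniformly chosen Tanner graph at blocklength `n` belongs to the class `q`. -/
def nbhdProb (L R : ℝ[X]) (t n : ℕ) (q : GraphClass) : ℝ :=
  (Nat.card {x : Wiring L R n × VNode L n // (⟦(tanner x.1).nbhd x.2 t⟧ : GraphClass) = q} : ℝ) /
    (Nat.card (Wiring L R n) * Nat.card (VNode L n))

/-- The part of the bit error probability that is due to cycle-free neighborhood graphs. -/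
def cycleFreePart (L R : ℝ[X]) (ε : ℝ) (t n : ℕ) : ℝ :=
  ∑ᶠ q ∈ cycleFreeClasses t, nbhdProb L R t n q * q.out.rootErasure ε t

/-! ### The tree ensemble -/

open Classical in
/-- The probability of a tree in the tree ensemble from the node perspective. -/
def treeProb (L R : ℝ[X]) (G : RootedGraph) : ℝ :=
  L.coeff (G.graph.degV G.root) *
    (∏ v ∈ Finset.univ.erase G.root, edgeFrac L (G.graph.degV v)) *
    ∏ c, edgeFrac R (G.graph.degC c)

/-- Expectation on the tree ensemble of depth `t` from the node perspective. -/
def treeExp (L R : ℝ[X]) (t : ℕ) (X : RootedGraph → ℝ) : ℝ :=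
  ∑ᶠ q ∈ cycleFreeClasses t, treeProb L R q.out * X q.out

/-! ### Density evolution -/

/-- Erasure probability of the messages into variable nodes. -/
def densP (L R : ℝ[X]) (ε : ℝ) : ℕ → ℝ
  | 0 => 1
  | t + 1 => 1 - (edgePoly R).eval (1 - ε * (edgePoly L).eval (densP L R ε t))

/-- Erasure probability of the messages into check nodes, for `t ≥ 1`. -/
def densQ (L R : ℝ[X]) (ε : ℝ) (t : ℕ) : ℝ := ε * (edgePoly L).eval (densP L R ε (t - 1))

/-! ### Augmented density evolution

`y k` and `z l` are the auxiliary variables that mark the variable nodes of degree `k` and the check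
nodes of degree `l`. -/

/-- `∑ p_i y_i x ^ i`. -/
def augNode (p : ℝ[X]) (y : ℕ → ℝ) (x : ℝ) : ℝ := ∑ i ∈ p.support, p.coeff i * y i * x ^ i

/-- `∑ λ_i y_i x ^ (i - 1)`, where the `λ_i` are the edge fractions of `p`. -/
def augEdge (p : ℝ[X]) (y : ℕ → ℝ) (x : ℝ) : ℝ :=
  ∑ i ∈ p.support, edgeFrac p i * y i * x ^ (i - 1)

/-- Generating function of the degrees in the tree ensemble rooted at a check-node edge. -/
def augf (L R : ℝ[X]) (t : ℕ) (y z : ℕ → ℝ) : ℝ :=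
  match t with
  | 0 => 1
  | t + 1 => augEdge R z (augEdge L y (augf L R t y z))

/-- The companion of `augf` for variable-node edges, for `t ≥ 1`. -/
def augg (L R : ℝ[X]) (t : ℕ) (y z : ℕ → ℝ) : ℝ := augEdge L y (augf L R (t - 1) y z)

/-- The version of `augf` weighted by the erasure probability. -/
def augF (L R : ℝ[X]) (ε : ℝ) (t : ℕ) (y z : ℕ → ℝ) : ℝ :=
  match t with
  | 0 => 1
  | t + 1 => augEdge R z (augg L R (t + 1) y z) -
      augEdge R z (augEdge L y (augf L R t y z) - ε * augEdge L y (augF L R ε t y z))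

/-- The version of `augg` weighted by the probability of non-erasure, for `t ≥ 1`. -/
def augG (L R : ℝ[X]) (ε : ℝ) (t : ℕ) (y z : ℕ → ℝ) : ℝ :=
  augEdge L y (augf L R (t - 1) y z) - ε * augEdge L y (augF L R ε (t - 1) y z)

/-- The `n`-th derivative at `x = 1` of `h` with all auxiliary variables set to `x`. -/
def dAll (n : ℕ) (h : (ℕ → ℝ) → (ℕ → ℝ) → ℝ) : ℝ :=
  iteratedDeriv n (fun x : ℝ => h (fun _ => x) (fun _ => x)) 1

/-- The `n`-th partial derivative of `h` in `y i` where all auxiliary variables are `1`. -/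
def dV (n : ℕ) (h : (ℕ → ℝ) → (ℕ → ℝ) → ℝ) (i : ℕ) : ℝ :=
  iteratedDeriv n (fun x : ℝ => h (Function.update (fun _ => 1) i x) (fun _ => 1)) 1

/-- The `n`-th partial derivative of `h` in `z j` where all auxiliary variables are `1`. -/
def dC (n : ℕ) (h : (ℕ → ℝ) → (ℕ → ℝ) → ℝ) (j : ℕ) : ℝ :=
  iteratedDeriv n (fun x : ℝ => h (fun _ => 1) (Function.update (fun _ => 1) j x)) 1

end LDPC

end

open LDPC

/-!
Three ingredients make up the proof.

*Local structure.* A cycle-free neighborhood graph `G` occurs at blocklength `n` as often as it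
can be embedded into the ensemble: by `card_nbhd_eq` a wiring with a node whose neighborhood is
equivalent to `G` is an embedding of `G` (injections of the nodes of each degree, and cyclic
shifts of the sockets of all nodes but the root) together with a wiring that extends the image of
the `K` edges of `G`. Embeddings have no choice beyond the image of the root once the wiring is
given (`IsEmbedding.unique`), and their image is the whole neighborhood, since no inner socket is
left open (`IsEmbedding.equivalent`). Counting gives falling factorials of the numbers of nodes of
each degree over a falling factorial of the number of edges. As `G` is a tree, the powers of `n`
cancel, so that the probability is the tree probability of `G` times a function `samplingRatio` of
`1 / n` with value `1` and derivative `samplingCoeff` at `0` (`nbhdProb_eq`,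
`hasDerivAt_samplingRatio`). This is the source of the factorial moments of `K`, `V_i`, `C_j` in
`β`.

*The tree ensemble.* Plane trees of height `2 * t` with bounded degrees, a finite type, serve as
representatives. Different plane trees are inequivalent (`PlaneTree.eq_of_equivalent`), and
summing over them recursively yields augmented density evolution, both for the total mass and for
the mass weighted by the erasure probability of the root (`PlaneTree.sum_rootWeight`,
`PlaneTree.sum_rootWeight_mul_erased`); the erasure probability itself obeys a recursion, as
messages from different subtrees are independent (`PlaneTree.rootErasure_rooted`). That every
cycle-free class of positive probability is that of a plane tree needs no argument on graphs: the
plane trees have total probability `1`, whereas the probabilities of finitely many classes are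
limits of probabilities of disjoint events, so that no mass is left over (`mem_treeClasses_iff`).
Hence the tree ensemble is finitely supported and all limits in `n` may be taken term by term.
Neighborhoods with cycles have probability tending to `0`, which gives the limit of the bit error
probability (`tendsto_bitErrorProb`).

*Derivatives.* Setting all auxiliary variables to `x`, or a single one of them, perturbs the
polynomials of density evolution by `x - 1` times a fixed polynomial (`IsAugCurve`). The
recursions for the first and second derivatives and the formulas for the factorial moments are all
instances of the chain rule `HasJet.perturb` for such perturbed compositions.
-/

/-! ### Second-order jets -/

/-- `HasJet h a b c`: the function `h` is differentiable, it is twice differentiable at `1`, and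
its value and its first two derivatives at `1` are `a`, `b` and `c`. -/
def HasJet (h : ℝ → ℝ) (a b c : ℝ) : Prop :=
  h 1 = a ∧ ∃ h' : ℝ → ℝ, (∀ x, HasDerivAt h (h' x) x) ∧ h' 1 = b ∧ HasDerivAt h' c 1

namespace HasJet

variable {h k u : ℝ → ℝ} {a b c a' b' c' : ℝ}

lemma iteratedDeriv_one (H : HasJet h a b c) : iteratedDeriv 1 h 1 = b := by
  obtain ⟨-, h', h1, h2, -⟩ := H
  rw [_root_.iteratedDeriv_one, (h1 1).deriv, h2]

lemma iteratedDeriv_two (H : HasJet h a b c) : iteratedDeriv 2 h 1 = c := by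
  obtain ⟨-, h', h1, h2, h3⟩ := H
  rw [iteratedDeriv_succ, _root_.iteratedDeriv_one, show deriv h = h' from
    funext fun x => (h1 x).deriv, h3.deriv]

lemma const (a : ℝ) : HasJet (fun _ => a) a 0 0 :=
  ⟨rfl, fun _ => 0, fun x => hasDerivAt_const x a, rfl, hasDerivAt_const _ _⟩

lemma sub (H : HasJet h a b c) (K : HasJet k a' b' c') :
    HasJet (fun x => h x - k x) (a - a') (b - b') (c - c') := by
  obtain ⟨h0, h', h1, h2, h3⟩ := H
  obtain ⟨k0, k', k1, k2, k3⟩ := K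
  exact ⟨by simp only [h0, k0], fun x => h' x - k' x, fun x => (h1 x).sub (k1 x),
    by simp only [h2, k2],
    h3.sub k3⟩

lemma const_mul (e : ℝ) (H : HasJet h a b c) :
    HasJet (fun x => e * h x) (e * a) (e * b) (e * c) := by
  obtain ⟨h0, h', h1, h2, h3⟩ := H
  exact ⟨by simp only [h0], fun x => e * h' x, fun x => (h1 x).const_mul e, by simp only [h2],
    h3.const_mul e⟩

lemma sum {ι : Type*} (s : Finset ι) {h : ι → ℝ → ℝ} {a b c : ι → ℝ}
    (H : ∀ i ∈ s, HasJet (h i) (a i) (b i) (c i)) :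
    HasJet (fun x => ∑ i ∈ s, h i x) (∑ i ∈ s, a i) (∑ i ∈ s, b i) (∑ i ∈ s, c i) := by
  classical
  induction s using Finset.induction_on with
  | empty => simpa using const 0
  | insert i s hi ih =>
    obtain ⟨h0, h', h1, h2, h3⟩ := H i (Finset.mem_insert_self _ _)
    obtain ⟨k0, k', k1, k2, k3⟩ := ih fun j hj => H j (Finset.mem_insert_of_mem hj)
    simp only [Finset.sum_insert hi]
    beta_reduce at k0
    exact ⟨by simp only [h0, k0], fun x => h' x + k' x, fun x => (h1 x).add (k1 x),
      by simp only [h2, k2], h3.add k3⟩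

lemma pow (n : ℕ) : HasJet (fun x => x ^ n) 1 n (n * (n - 1)) := by
  refine ⟨by simp, fun x => n * x ^ (n - 1), fun x => hasDerivAt_pow n x, by simp, ?_⟩
  refine ((hasDerivAt_pow (n - 1) (1 : ℝ)).const_mul (n : ℝ)).congr_deriv ?_
  rcases n with _ | n <;> simp

/-- Composition with a polynomial `p` that is perturbed to first order by the polynomial `e`. -/
lemma perturb (H : HasJet u a b c) (p e : ℝ[X]) :
    HasJet (fun x => p.eval (u x) + (x - 1) * e.eval (u x)) (p.eval a)
      (evalD 1 p a * b + e.eval a)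
      (evalD 2 p a * b ^ 2 + evalD 1 p a * c + 2 * evalD 1 e a * b) := by
  obtain ⟨u0, u', u1, u2, u3⟩ := H
  have key (q : ℝ[X]) (x : ℝ) :
      HasDerivAt (fun x => q.eval (u x)) ((derivative q).eval (u x) * u' x) x :=
    (q.hasDerivAt (u x)).comp x (u1 x)
  have lin : HasDerivAt (fun x : ℝ => x - 1) 1 1 := (hasDerivAt_id _).sub_const _
  refine ⟨by simp [u0], fun x => (derivative p).eval (u x) * u' x +
    (1 * e.eval (u x) + (x - 1) * ((derivative e).eval (u x) * u' x)), fun x =>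
      (key p x).add (((hasDerivAt_id _).sub_const _).mul (key e x)), by simp [u0, u2, evalD], ?_⟩
  refine ((((key (derivative p) 1).mul u3).add (((key e 1).const_mul 1).add
    (lin.mul ((key (derivative e) 1).mul u3)))).congr_deriv ?_)
  simp only [u0, u2, evalD, Pi.mul_apply, Function.iterate_succ,
    Function.iterate_zero, Function.comp, id]
  ring

lemma congr_of_eventuallyEq (H : HasJet h a b c) (hk : h =ᶠ[𝓝 1] k) :
    iteratedDeriv 2 k 1 = c := by
  rw [← hk.iteratedDeriv_eq, H.iteratedDeriv_two]

end HasJet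

/-! ### Derivatives of augmented density evolution -/

lemma edgeFrac_eq_coeff (p : ℝ[X]) (n : ℕ) : edgeFrac p (n + 1) = (edgePoly p).coeff n := by
  simp [edgeFrac, edgePoly, coeff_derivative]
  ring

lemma edgeFrac_zero (p : ℝ[X]) : edgeFrac p 0 = 0 := by simp [edgeFrac]

lemma augEdge_eq_sum_range (p : ℝ[X]) (y : ℕ → ℝ) (x : ℝ) {B : ℕ} (hB : p.natDegree ≤ B) :
    augEdge p y x = ∑ n ∈ Finset.range B, edgeFrac p (n + 1) * y (n + 1) * x ^ n := by
  have h : augEdge p y x = ∑ i ∈ Finset.range (B + 1), edgeFrac p i * y i * x ^ (i - 1) := by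
    refine Finset.sum_subset (fun i hi => ?_) (fun i _ hi => ?_)
    · exact Finset.mem_range_succ_iff.2 ((le_natDegree_of_mem_supp i hi).trans hB)
    · simp [edgeFrac, notMem_support_iff.1 hi]
  rw [h, Finset.sum_range_succ']
  simp [edgeFrac_zero]

lemma augNode_eq_sum_range (p : ℝ[X]) (y : ℕ → ℝ) (x : ℝ) {B : ℕ} (hB : p.natDegree < B) :
    augNode p y x = ∑ i ∈ Finset.range B, p.coeff i * y i * x ^ i := by
  refine Finset.sum_subset (fun i hi => ?_) (fun i _ hi => ?_)
  · exact Finset.mem_range.2 ((le_natDegree_of_mem_supp i hi).trans_lt hB)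
  · simp [notMem_support_iff.1 hi]

lemma eval_edgePoly (p : ℝ[X]) (x : ℝ) : (edgePoly p).eval x = augEdge p (fun _ => 1) x := by
  have h : (edgePoly p).natDegree < p.natDegree + 1 := by
    refine Nat.lt_succ_of_le ((natDegree_C_mul_le _ _).trans ?_)
    exact (natDegree_derivative_le p).trans (Nat.sub_le _ _)
  rw [augEdge_eq_sum_range p _ x (Nat.le_succ _), eval_eq_sum_range' h]
  simp [edgeFrac_eq_coeff]

lemma eval_eq_augNode (p : ℝ[X]) (x : ℝ) : p.eval x = augNode p (fun _ => 1) x := by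
  rw [augNode, eval_eq_sum, Polynomial.sum]; simp

lemma augEdge_const (p : ℝ[X]) (y x : ℝ) :
    augEdge p (fun _ => y) x = (edgePoly p).eval x + (y - 1) * (edgePoly p).eval x := by
  rw [eval_edgePoly]
  simp only [augEdge, Finset.mul_sum, ← Finset.sum_add_distrib]
  exact Finset.sum_congr rfl fun i _ => by ring

lemma augEdge_update (p : ℝ[X]) (i : ℕ) (y x : ℝ) :
    augEdge p (Function.update (fun _ => 1) i y) x =
      (edgePoly p).eval x + (y - 1) * (Polynomial.C (edgeFrac p i) * X ^ (i - 1)).eval x := by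
  have h : ∀ k, edgeFrac p k * Function.update (fun _ => (1 : ℝ)) i y k * x ^ (k - 1) =
      edgeFrac p k * 1 * x ^ (k - 1) +
        if k = i then (y - 1) * (edgeFrac p i * x ^ (i - 1)) else 0 := by
    intro k
    rcases eq_or_ne k i with rfl | hk
    · simp; ring
    · simp [hk]
  simp only [augEdge, h, Finset.sum_add_distrib, Finset.sum_ite_eq']
  rw [eval_edgePoly, augEdge]
  congr 1
  split_ifs with hi
  · simp
  · simp [edgeFrac, notMem_support_iff.1 hi]

lemma augNode_const (p : ℝ[X]) (y x : ℝ) : augNode p (fun _ => y) x = y * p.eval x := by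
  rw [eval_eq_augNode]
  simp only [augNode, Finset.mul_sum]
  exact Finset.sum_congr rfl fun i _ => by ring

lemma augNode_update (p : ℝ[X]) (i : ℕ) (y x : ℝ) :
    augNode p (Function.update (fun _ => 1) i y) x =
      p.eval x + (y - 1) * (Polynomial.C (p.coeff i) * X ^ i).eval x := by
  have h : ∀ k, p.coeff k * Function.update (fun _ => (1 : ℝ)) i y k * x ^ k =
      p.coeff k * 1 * x ^ k +
        if k = i then (y - 1) * (p.coeff i * x ^ i) else 0 := by
    intro k
    rcases eq_or_ne k i with rfl | hk
    · simp; ring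
    · simp [hk]
  simp only [augNode, h, Finset.sum_add_distrib, Finset.sum_ite_eq']
  rw [eval_eq_augNode, augNode]
  congr 1
  split_ifs with hi
  · simp
  · simp [notMem_support_iff.1 hi]

lemma evalD_C_mul_X_pow (r : ℝ) (n : ℕ) (x : ℝ) :
    evalD 1 (Polynomial.C r * X ^ n) x = r * n * x ^ (n - 1) := by
  simp [evalD, derivative_X_pow]; ring

lemma evalD_zero_poly (k : ℕ) (x : ℝ) : evalD k 0 x = 0 := by simp [evalD]

lemma evalD_one_one (p : ℝ[X]) : evalD 1 p 1 = ∑ i ∈ p.support, i * p.coeff i := by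
  simp [evalD, derivative_eval, Polynomial.sum, mul_comm]

namespace LDPC.IsDegreeDistribution

variable {p : ℝ[X]} (hp : IsDegreeDistribution p)

include hp

lemma sum_coeff : ∑ i ∈ p.support, p.coeff i = 1 := by
  have := hp.sum_eq_one
  rwa [eval_eq_sum, Polynomial.sum, Finset.sum_congr rfl fun i _ => by rw [one_pow, mul_one]]
    at this

lemma pos_of_mem_support {i : ℕ} (hi : i ∈ p.support) : 0 < i :=
  Nat.pos_of_ne_zero fun h => mem_support_iff.1 hi (h ▸ hp.coeff_zero)

lemma coeff_pos {i : ℕ} (hi : i ∈ p.support) : 0 < p.coeff i :=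
  (hp.nonneg i).lt_of_ne' (mem_support_iff.1 hi)

/-- The average degree is at least one. -/
lemma evalD_one_pos : 0 < evalD 1 p 1 := by
  refine lt_of_lt_of_le one_pos ?_
  rw [evalD_one_one, ← hp.sum_coeff]
  refine Finset.sum_le_sum fun i hi => le_mul_of_one_le_left (hp.nonneg i) ?_
  exact_mod_cast hp.pos_of_mem_support hi

lemma eval_edgePoly_one : (edgePoly p).eval 1 = 1 := by
  simpa [edgePoly, evalD] using inv_mul_cancel₀ hp.evalD_one_pos.ne'

end LDPC.IsDegreeDistribution

section Recursions

variable {L R : ℝ[X]}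

lemma augf_one (hL : IsDegreeDistribution L) (hR : IsDegreeDistribution R) (t : ℕ) :
    augf L R t (fun _ => 1) (fun _ => 1) = 1 := by
  induction t with
  | zero => rfl
  | succ t ih =>
    rw [augf, ih, ← eval_edgePoly, ← eval_edgePoly, hL.eval_edgePoly_one, hR.eval_edgePoly_one]

lemma augF_one (hL : IsDegreeDistribution L) (hR : IsDegreeDistribution R) (ε : ℝ) (t : ℕ) :
    augF L R ε t (fun _ => 1) (fun _ => 1) = densP L R ε t := by
  induction t with
  | zero => rfl
  | succ t ih =>
    simp only [augF, augg, Nat.add_sub_cancel, ih, augf_one hL hR, ← eval_edgePoly,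
      hL.eval_edgePoly_one, hR.eval_edgePoly_one, densP]

/-- A curve `x ↦ (y x, z x)` through the point where all auxiliary variables are `1`, along which
the polynomials of augmented density evolution are perturbed by multiples of `eL` and `eR`. -/
structure IsAugCurve (L R : ℝ[X]) (y z : ℝ → ℕ → ℝ) (eL eR : ℝ[X]) : Prop where
  left : ∀ x u, augEdge L (y x) u = (edgePoly L).eval u + (x - 1) * eL.eval u
  right : ∀ x u, augEdge R (z x) u = (edgePoly R).eval u + (x - 1) * eR.eval u

variable {y z : ℝ → ℕ → ℝ} {eL eR : ℝ[X]}

/-- The `n`-th derivative at `1` of `h` along the curve `(y, z)`. The derivatives `dAll`,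
`dV` and `dC` are taken along the curves of `isAugCurve_all`, `isAugCurve_var` and
`isAugCurve_check`. -/
noncomputable def curveDeriv (y z : ℝ → ℕ → ℝ) (n : ℕ) (h : (ℕ → ℝ) → (ℕ → ℝ) → ℝ) : ℝ :=
  iteratedDeriv n (fun x => h (y x) (z x)) 1

/-- `h` is differentiable along the curve `(y, z)`, twice so at `1`, with value `a` there. -/
def CurveJet (y z : ℝ → ℕ → ℝ) (h : (ℕ → ℝ) → (ℕ → ℝ) → ℝ) (a : ℝ) : Prop :=
  HasJet (fun x => h (y x) (z x)) a (curveDeriv y z 1 h) (curveDeriv y z 2 h)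

lemma HasJet.curveJet {h : (ℕ → ℝ) → (ℕ → ℝ) → ℝ} {a b c : ℝ}
    (H : HasJet (fun x => h (y x) (z x)) a b c) :
    CurveJet y z h a ∧ curveDeriv y z 1 h = b ∧ curveDeriv y z 2 h = c := by
  have h1 : curveDeriv y z 1 h = b := H.iteratedDeriv_one
  have h2 : curveDeriv y z 2 h = c := H.iteratedDeriv_two
  exact ⟨by rw [CurveJet, h1, h2]; exact H, h1, h2⟩

lemma curveJet_augg (hL : IsDegreeDistribution L) (hc : IsAugCurve L R y z eL eR)
    {s : ℕ} (hf : CurveJet y z (augf L R s) 1) :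
    CurveJet y z (augg L R (s + 1)) 1 ∧
    curveDeriv y z 1 (augg L R (s + 1)) =
      evalD 1 (edgePoly L) 1 * curveDeriv y z 1 (augf L R s) + eL.eval 1 ∧
    curveDeriv y z 2 (augg L R (s + 1)) =
      evalD 2 (edgePoly L) 1 * curveDeriv y z 1 (augf L R s) ^ 2
        + evalD 1 (edgePoly L) 1 * curveDeriv y z 2 (augf L R s)
        + 2 * evalD 1 eL 1 * curveDeriv y z 1 (augf L R s) := by
  have := HasJet.perturb hf (edgePoly L) eL
  simp only [← hc.left, hL.eval_edgePoly_one] at this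
  exact this.curveJet

lemma curveJet_augf_succ (hR : IsDegreeDistribution R) (hc : IsAugCurve L R y z eL eR)
    {s : ℕ} (hg : CurveJet y z (augg L R (s + 1)) 1) :
    CurveJet y z (augf L R (s + 1)) 1 ∧
    curveDeriv y z 1 (augf L R (s + 1)) =
      evalD 1 (edgePoly R) 1 * curveDeriv y z 1 (augg L R (s + 1)) + eR.eval 1 ∧
    curveDeriv y z 2 (augf L R (s + 1)) =
      evalD 2 (edgePoly R) 1 * curveDeriv y z 1 (augg L R (s + 1)) ^ 2
        + evalD 1 (edgePoly R) 1 * curveDeriv y z 2 (augg L R (s + 1))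
        + 2 * evalD 1 eR 1 * curveDeriv y z 1 (augg L R (s + 1)) := by
  have := HasJet.perturb hg (edgePoly R) eR
  simp only [← hc.right, hR.eval_edgePoly_one] at this
  exact this.curveJet

lemma curveJet_augf (hL : IsDegreeDistribution L) (hR : IsDegreeDistribution R)
    (hc : IsAugCurve L R y z eL eR) (s : ℕ) : CurveJet y z (augf L R s) 1 := by
  induction s with
  | zero => exact (HasJet.curveJet (h := augf L R 0) (HasJet.const 1)).1
  | succ s ih => exact (curveJet_augf_succ hR hc (curveJet_augg hL hc ih).1).1

lemma curveJet_augG (hL : IsDegreeDistribution L) (hR : IsDegreeDistribution R)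
    (hc : IsAugCurve L R y z eL eR) {ε : ℝ} {s : ℕ}
    (hF : CurveJet y z (augF L R ε s) (densP L R ε s)) :
    CurveJet y z (augG L R ε (s + 1)) (1 - densQ L R ε (s + 1)) ∧
    curveDeriv y z 1 (augG L R ε (s + 1)) = curveDeriv y z 1 (augg L R (s + 1))
      - ε * (evalD 1 (edgePoly L) (densP L R ε s) * curveDeriv y z 1 (augF L R ε s)
        + eL.eval (densP L R ε s)) ∧
    curveDeriv y z 2 (augG L R ε (s + 1)) = curveDeriv y z 2 (augg L R (s + 1))
      - ε * (evalD 2 (edgePoly L) (densP L R ε s) * curveDeriv y z 1 (augF L R ε s) ^ 2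
        + evalD 1 (edgePoly L) (densP L R ε s) * curveDeriv y z 2 (augF L R ε s)
        + 2 * evalD 1 eL (densP L R ε s) * curveDeriv y z 1 (augF L R ε s)) := by
  have hg := (curveJet_augg hL hc (curveJet_augf hL hR hc s)).1
  have := HasJet.sub hg ((HasJet.perturb hF (edgePoly L) eL).const_mul ε)
  simp only [← hc.left] at this
  exact this.curveJet

lemma curveJet_augF_succ (hL : IsDegreeDistribution L) (hR : IsDegreeDistribution R)
    (hc : IsAugCurve L R y z eL eR) {ε : ℝ} {s : ℕ}
    (hG : CurveJet y z (augG L R ε (s + 1)) (1 - densQ L R ε (s + 1))) :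
    CurveJet y z (augF L R ε (s + 1)) (densP L R ε (s + 1)) ∧
    curveDeriv y z 1 (augF L R ε (s + 1)) = curveDeriv y z 1 (augf L R (s + 1))
      - (evalD 1 (edgePoly R) (1 - densQ L R ε (s + 1)) * curveDeriv y z 1 (augG L R ε (s + 1))
        + eR.eval (1 - densQ L R ε (s + 1))) ∧
    curveDeriv y z 2 (augF L R ε (s + 1)) = curveDeriv y z 2 (augf L R (s + 1))
      - (evalD 2 (edgePoly R) (1 - densQ L R ε (s + 1)) * curveDeriv y z 1 (augG L R ε (s + 1)) ^ 2
        + evalD 1 (edgePoly R) (1 - densQ L R ε (s + 1)) * curveDeriv y z 2 (augG L R ε (s + 1))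
        + 2 * evalD 1 eR (1 - densQ L R ε (s + 1)) * curveDeriv y z 1 (augG L R ε (s + 1))) := by
  have := HasJet.sub (curveJet_augf hL hR hc (s + 1)) (HasJet.perturb hG (edgePoly R) eR)
  simp only [← hc.right] at this
  exact this.curveJet

lemma curveJet_augF (hL : IsDegreeDistribution L) (hR : IsDegreeDistribution R)
    (hc : IsAugCurve L R y z eL eR) (ε : ℝ) (s : ℕ) :
    CurveJet y z (augF L R ε s) (densP L R ε s) := by
  induction s with
  | zero => exact (HasJet.curveJet (h := augF L R ε 0) (HasJet.const 1)).1
  | succ s ih => exact (curveJet_augF_succ hL hR hc (curveJet_augG hL hR hc ih).1).1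

end Recursions

lemma isAugCurve_all (L R : ℝ[X]) :
    IsAugCurve L R (fun x _ => x) (fun x _ => x) (edgePoly L) (edgePoly R) :=
  ⟨fun x u => augEdge_const L x u, fun x u => augEdge_const R x u⟩

lemma isAugCurve_var (L R : ℝ[X]) (i : ℕ) :
    IsAugCurve L R (fun x => Function.update (fun _ => 1) i x) (fun _ _ => 1)
      (Polynomial.C (edgeFrac L i) * X ^ (i - 1)) 0 :=
  ⟨fun x u => augEdge_update L i x u, fun x u => by simp [eval_edgePoly]⟩

lemma isAugCurve_check (L R : ℝ[X]) (j : ℕ) :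
    IsAugCurve L R (fun _ _ => 1) (fun x => Function.update (fun _ => 1) j x) 0
      (Polynomial.C (edgeFrac R j) * X ^ (j - 1)) :=
  ⟨fun x u => by simp [eval_edgePoly], fun x u => augEdge_update R j x u⟩

/-- Truncated subtraction does no harm, since `edgeFrac p 0 = 0`. -/
lemma edgeFrac_mul_pred (p : ℝ[X]) (i : ℕ) :
    edgeFrac p i * ((i - 1 : ℕ) : ℝ) = edgeFrac p i * ((i : ℝ) - 1) := by
  rcases i with _ | i
  · simp [edgeFrac_zero]
  · simp

/-! ### Bernoulli sums -/

section BernoulliSum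

variable {α β : Type*} {ε : ℝ}

open Classical in
/-- The expectation of `f S`, where `S` is a random subset of `U` that contains every element of `U`
independently with probability `ε`. -/
noncomputable def bernoulliSum (ε : ℝ) (U : Finset α) (f : Set α → ℝ) : ℝ :=
  ∑ S ∈ U.powerset, f ↑S * (ε ^ S.card * (1 - ε) ^ (U.card - S.card))

lemma bernoulliSum_congr {U : Finset α} {f g : Set α → ℝ} (h : ∀ S ⊆ (U : Set α), f S = g S) :
    bernoulliSum ε U f = bernoulliSum ε U g :=
  Finset.sum_congr rfl fun S hS => by
    rw [h S (Finset.coe_subset.2 (Finset.mem_powerset.1 hS))]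

lemma bernoulliSum_const (U : Finset α) (a : ℝ) : bernoulliSum ε U (fun _ => a) = a := by
  rw [bernoulliSum, ← Finset.mul_sum, Finset.sum_pow_mul_eq_add_pow]
  simp

lemma bernoulliSum_empty (f : Set α → ℝ) : bernoulliSum ε ∅ f = f ∅ := by
  simp [bernoulliSum]

lemma bernoulliSum_mul_left (U : Finset α) (a : ℝ) (f : Set α → ℝ) :
    bernoulliSum ε U (fun S => a * f S) = a * bernoulliSum ε U f := by
  simp only [bernoulliSum, Finset.mul_sum, mul_assoc]

lemma bernoulliSum_sub (U : Finset α) (f g : Set α → ℝ) :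
    bernoulliSum ε U (fun S => f S - g S) = bernoulliSum ε U f - bernoulliSum ε U g := by
  simp only [bernoulliSum, ← Finset.sum_sub_distrib, sub_mul]

lemma bernoulliSum_one_sub (U : Finset α) (f : Set α → ℝ) :
    bernoulliSum ε U (fun S => 1 - f S) = 1 - bernoulliSum ε U f := by
  rw [bernoulliSum_sub, bernoulliSum_const]

lemma bernoulliSum_insert [DecidableEq α] {U : Finset α} {a : α} (ha : a ∉ U) (f : Set α → ℝ) :
    bernoulliSum ε (insert a U) f =
      ε * bernoulliSum ε U (fun S => f (insert a S)) + (1 - ε) * bernoulliSum ε U f := by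
  simp only [bernoulliSum]
  rw [Finset.sum_powerset_insert ha, Finset.mul_sum, Finset.mul_sum, add_comm]
  congr 1
  · refine Finset.sum_congr rfl fun S hS => ?_
    have : a ∉ S := fun h => ha (Finset.mem_powerset.1 hS h)
    rw [Finset.card_insert_of_notMem ha, Finset.card_insert_of_notMem this,
      Nat.add_sub_add_right, Finset.coe_insert]
    ring
  · refine Finset.sum_congr rfl fun S hS => ?_
    rw [Finset.card_insert_of_notMem ha,
      Nat.succ_sub (Finset.card_le_card (Finset.mem_powerset.1 hS)), pow_succ]
    ring

lemma bernoulliSum_union [DecidableEq α] {U W : Finset α} (h : Disjoint U W) (f : Set α → ℝ) :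
    bernoulliSum ε (U ∪ W) f =
      bernoulliSum ε U (fun S => bernoulliSum ε W (fun T => f (S ∪ T))) := by
  induction U using Finset.induction_on generalizing f with
  | empty => simp [bernoulliSum_empty]
  | insert a U ha ih =>
    rw [Finset.disjoint_insert_left] at h
    rw [Finset.insert_union, bernoulliSum_insert (by simp [ha, h.1]), bernoulliSum_insert ha,
      ih h.2, ih h.2]
    simp only [Set.insert_union]

lemma bernoulliSum_map (e : α ↪ β) (U : Finset α) (f : Set β → ℝ) :
    bernoulliSum ε (U.map e) f = bernoulliSum ε U (fun S => f (e '' S)) := by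
  classical
  induction U using Finset.induction_on generalizing f with
  | empty => simp [bernoulliSum_empty]
  | insert a U ha ih =>
    rw [Finset.map_insert, bernoulliSum_insert (by simpa using ha), bernoulliSum_insert ha, ih, ih]
    simp only [Set.image_insert_eq]

/-- Elements on which the random variable does not depend may be dropped. -/
lemma bernoulliSum_subset {U W : Finset α} (h : U ⊆ W) {f : Set α → ℝ}
    (hf : ∀ S, f (S ∩ U) = f S) : bernoulliSum ε W f = bernoulliSum ε U f := by
  classical
  rw [← Finset.union_sdiff_of_subset h, bernoulliSum_union Finset.disjoint_sdiff]
  refine bernoulliSum_congr fun S hS => ?_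
  rw [bernoulliSum_congr (g := fun _ => f S), bernoulliSum_const]
  intro T hT
  rw [← hf, ← hf S]
  congr 1
  ext x
  have := @hT x
  simp only [Finset.coe_sdiff, Set.mem_sdiff, Finset.mem_coe, Set.mem_inter_iff,
    Set.mem_union] at *
  tauto

/-- Independence: the expectation of a product over disjoint parts. -/
lemma bernoulliSum_biUnion_prod [DecidableEq α] {ι : Type*} (s : Finset ι) (U : ι → Finset α)
    (hU : (s : Set ι).PairwiseDisjoint U) (f : ι → Set α → ℝ)
    (hf : ∀ i ∈ s, ∀ S, f i (S ∩ U i) = f i S) :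
    bernoulliSum ε (s.biUnion U) (fun S => ∏ i ∈ s, f i S) =
      ∏ i ∈ s, bernoulliSum ε (U i) (f i) := by
  classical
  induction s using Finset.induction_on with
  | empty => simp [bernoulliSum_empty]
  | insert i s hi ih =>
    have hd : ∀ j ∈ s, Disjoint (U i) (U j) := fun j hj =>
      hU (by simp) (by simp [hj]) (fun h => hi (h ▸ hj))
    rw [Finset.biUnion_insert, Finset.prod_insert hi, bernoulliSum_union]
    · rw [← ih (hU.subset (by simp)) fun j hj => hf j (Finset.mem_insert_of_mem hj), mul_comm,
        ← bernoulliSum_mul_left]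
      refine bernoulliSum_congr fun S hS => ?_
      rw [mul_comm, ← bernoulliSum_mul_left]
      refine bernoulliSum_congr fun T hT => ?_
      rw [Finset.prod_insert hi]
      congr 1
      · rw [← hf i (Finset.mem_insert_self _ _), ← hf i (Finset.mem_insert_self _ _) S]
        congr 1
        ext x
        have h1 := @hT x
        simp only [Set.mem_inter_iff, Set.mem_union, Finset.mem_coe, Finset.mem_biUnion] at *
        refine ⟨fun ⟨h, h'⟩ => ⟨h.resolve_right fun h2 => ?_, h'⟩, fun ⟨h, h'⟩ => ⟨Or.inl h, h'⟩⟩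
        obtain ⟨j, hj, hx⟩ := h1 h2
        exact Finset.disjoint_left.1 (hd j hj) h' hx
      · refine Finset.prod_congr rfl fun j hj => ?_
        rw [← hf j (Finset.mem_insert_of_mem hj), ← hf j (Finset.mem_insert_of_mem hj) T]
        congr 1
        ext x
        have h1 := @hS x
        simp only [Set.mem_inter_iff, Set.mem_union, Finset.mem_coe] at *
        refine ⟨fun ⟨h, h'⟩ => ⟨h.resolve_left fun h2 => ?_, h'⟩, fun ⟨h, h'⟩ => ⟨Or.inr h, h'⟩⟩
        exact Finset.disjoint_left.1 (hd j hj) (h1 h2) h'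
    · rw [Finset.disjoint_biUnion_right]
      exact hd

lemma bernoulliSum_nonneg (h0 : 0 ≤ ε) (h1 : ε ≤ 1) (U : Finset α) {f : Set α → ℝ}
    (hf : ∀ S, 0 ≤ f S) : 0 ≤ bernoulliSum ε U f :=
  Finset.sum_nonneg fun S _ => mul_nonneg (hf S) (mul_nonneg (pow_nonneg h0 _)
    (pow_nonneg (sub_nonneg.2 h1) _))

end BernoulliSum

open Classical in
lemma LDPC.SocketGraph.erasureProb_eq_bernoulliSum {V C : Type} [Fintype V] (G : SocketGraph V C)
    (ε : ℝ) (t : ℕ) (v : V) :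
    G.erasureProb ε t v =
      bernoulliSum ε Finset.univ (fun S => if G.bitErased S t v then 1 else 0) := by
  simp [SocketGraph.erasureProb, bernoulliSum]

lemma LDPC.SocketGraph.erasureProb_mem_Icc {V C : Type} [Fintype V] (G : SocketGraph V C)
    {ε : ℝ} (h0 : 0 ≤ ε) (h1 : ε ≤ 1) (t : ℕ) (v : V) :
    0 ≤ G.erasureProb ε t v ∧ G.erasureProb ε t v ≤ 1 := by
  classical
  rw [SocketGraph.erasureProb_eq_bernoulliSum]
  constructor
  · exact bernoulliSum_nonneg h0 h1 _ fun S => by split_ifs <;> simp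
  · have := bernoulliSum_nonneg h0 h1 Finset.univ
      (f := fun S => 1 - if G.bitErased S t v then 1 else 0) fun S => by split_ifs <;> simp
    rwa [bernoulliSum_one_sub, sub_nonneg] at this

/-! ### Cyclic shifts -/

lemma add_mod_inj {d k i i' : ℕ} (hi : i < d) (hi' : i' < d) (h : (i + k) % d = (i' + k) % d) :
    i = i' := by
  have : i ≡ i' [MOD d] := Nat.ModEq.add_right_cancel' k h
  rwa [Nat.ModEq, Nat.mod_eq_of_lt hi, Nat.mod_eq_of_lt hi'] at this

lemma exists_add_mod_eq {d i : ℕ} (k : ℕ) (hi : i < d) : ∃ i' < d, (i' + k) % d = i :=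
  ⟨_, Nat.mod_lt _ (by omega), RootedGraph.shift_inv d k i hi⟩

/-! ### Belief propagation depends on the neighborhood only -/

/-- A map of socket graphs that respects the edges up to cyclic shifts of the sockets and that is
bijective on the edges at `v` and at the check nodes next to `v` whenever `v ∈ N (r + 1)`, the
neighbors of these check nodes being in `N r`. So `r` rounds of belief propagation at a node of
`N r` see the same graph on both sides. -/
structure LocalIso {V C V' C' : Type} (G : SocketGraph V C) (H : SocketGraph V' C')
    (φ : V → V') (ψ : C → C') (k : V → ℕ) (l : C → ℕ) (N : ℕ → Set V) : Prop where
  map_edge : ∀ {v i c j}, G.Edge v i c j →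
    H.Edge (φ v) ((i + k v) % G.degV v) (ψ c) ((j + l c) % G.degC c)
  lift_var : ∀ {r v i' c' j'}, v ∈ N (r + 1) → H.Edge (φ v) i' c' j' → ∃ i c j, G.Edge v i c j ∧
    (i + k v) % G.degV v = i' ∧ ψ c = c' ∧ (j + l c) % G.degC c = j'
  lift_check : ∀ {r v i c j w' i' j'}, v ∈ N (r + 1) → G.Edge v i c j → H.Edge w' i' (ψ c) j' →
    ∃ w ∈ N r, ∃ i₂ j₂, G.Edge w i₂ c j₂ ∧ φ w = w' ∧ (i₂ + k w) % G.degV w = i' ∧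
      (j₂ + l c) % G.degC c = j'

namespace LocalIso

variable {V C V' C' : Type} {G : SocketGraph V C} {H : SocketGraph V' C'} {φ : V → V'} {ψ : C → C'}
  {k : V → ℕ} {l : C → ℕ} {N : ℕ → Set V}

lemma checkErased_iff (h : LocalIso G H φ ψ k l N) {r : ℕ} {m : V → ℕ → Prop} {m' : V' → ℕ → Prop}
    (hm : ∀ w ∈ N r, ∀ i < G.degV w, (m w i ↔ m' (φ w) ((i + k w) % G.degV w)))
    {v : V} (hv : v ∈ N (r + 1)) {i : ℕ} {c : C} {j : ℕ} (e : G.Edge v i c j) :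
    G.checkErased m c j ↔ H.checkErased m' (ψ c) ((j + l c) % G.degC c) := by
  constructor
  · rintro ⟨w, i₂, j₂, hj, e₂, hw⟩
    have e' := h.map_edge e₂
    obtain ⟨w₁, hw₁, i₃, j₃, e₃, h₁, h₂, h₃⟩ := h.lift_check hv e e'
    obtain rfl := add_mod_inj (G.lt_degC e₃) (G.lt_degC e₂) h₃
    obtain ⟨rfl, rfl⟩ := G.unique_left e₃ e₂
    exact ⟨_, _, _, fun hh => hj (add_mod_inj (G.lt_degC e₂) (G.lt_degC e) hh), e',
      (hm _ hw₁ _ (G.lt_degV e₂)).1 hw⟩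
  · rintro ⟨w', i', j', hj, e', hw'⟩
    obtain ⟨w, hw, i₂, j₂, e₂, rfl, rfl, rfl⟩ := h.lift_check hv e e'
    exact ⟨w, i₂, j₂, fun hh => hj (by rw [hh]), e₂, (hm w hw i₂ (G.lt_degV e₂)).2 hw'⟩

lemma varErased_iff (h : LocalIso G H φ ψ k l N) (S : Set V') (r : ℕ) :
    ∀ v ∈ N r, ∀ i < G.degV v,
      (G.varErased (φ ⁻¹' S) r v i ↔ H.varErased S r (φ v) ((i + k v) % G.degV v)) := by
  induction r with
  | zero => intro v _ i _; rfl
  | succ r ih =>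
    intro v hv i hi
    simp only [SocketGraph.varErased]
    refine and_congr Iff.rfl ⟨fun H' i' c' j' hi' e' => ?_, fun H' i₂ c j hi₂ e => ?_⟩
    · obtain ⟨i₂, c, j, e, rfl, rfl, rfl⟩ := h.lift_var hv e'
      exact (h.checkErased_iff ih hv e).1 (H' i₂ c j (fun hh => hi' (by rw [hh])) e)
    · exact (h.checkErased_iff ih hv e).2 (H' _ _ _
        (fun hh => hi₂ (add_mod_inj (G.lt_degV e) hi hh)) (h.map_edge e))

lemma bitErased_iff (h : LocalIso G H φ ψ k l N) (S : Set V') {t : ℕ} {v : V} (hv : v ∈ N t) :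
    G.bitErased (φ ⁻¹' S) t v ↔ H.bitErased S t (φ v) := by
  cases t with
  | zero => rfl
  | succ r =>
    simp only [SocketGraph.bitErased]
    refine and_congr Iff.rfl ⟨fun H' i' c' j' e' => ?_, fun H' i c j e => ?_⟩
    · obtain ⟨i, c, j, e, rfl, rfl, rfl⟩ := h.lift_var hv e'
      exact (h.checkErased_iff (h.varErased_iff S r) hv e).1 (H' i c j e)
    · exact (h.checkErased_iff (h.varErased_iff S r) hv e).2 (H' _ _ _ (h.map_edge e))

lemma erasureProb_eq [Fintype V] [Fintype V'] (h : LocalIso G H φ ψ k l N)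
    (hφ : Function.Injective φ) (ε : ℝ) {t : ℕ} {v : V} (hv : v ∈ N t) :
    G.erasureProb ε t v = H.erasureProb ε t (φ v) := by
  classical
  rw [SocketGraph.erasureProb_eq_bernoulliSum, SocketGraph.erasureProb_eq_bernoulliSum,
    bernoulliSum_subset (Finset.subset_univ (Finset.univ.map ⟨φ, hφ⟩)), bernoulliSum_map]
  · refine bernoulliSum_congr fun S _ => ?_
    simp only [← h.bitErased_iff _ hv, Function.Embedding.coeFn_mk, Set.preimage_image_eq S hφ]
  · intro S
    simp only [← h.bitErased_iff _ hv]
    have : φ ⁻¹' (S ∩ ((Finset.univ.map ⟨φ, hφ⟩ : Finset V') : Set V')) = φ ⁻¹' S := by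
      ext x; simp
    rw [this]

end LocalIso

namespace LDPC.SocketGraph

variable {V C : Type} (G : SocketGraph V C)

lemma nearV_mono (v₀ : V) : Monotone (G.nearV v₀) :=
  monotone_nat_of_le_succ fun _ => Set.subset_union_left

lemma mem_nearC_of_edge {v₀ v : V} {c : C} {i j r t : ℕ} (hv : v ∈ G.nearV v₀ r) (hr : r < t)
    (e : G.Edge v i c j) : c ∈ G.nearC v₀ t :=
  ⟨r, hr, v, hv, i, j, e⟩

lemma mem_nearV_succ {v₀ v w : V} {c : C} {i j i' j' r : ℕ} (hv : v ∈ G.nearV v₀ r)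
    (e : G.Edge v i c j) (e' : G.Edge w i' c j') : w ∈ G.nearV v₀ (r + 1) :=
  Or.inr ⟨v, hv, c, ⟨i, j, e⟩, i', j', e'⟩

variable [Fintype V] [Fintype C]

/-- The inclusion of a neighborhood graph. -/
lemma localIso_nbhd (v₀ : V) (t : ℕ) :
    LocalIso (G.nbhd v₀ t).graph G Subtype.val Subtype.val (fun _ => 0) (fun _ => 0)
      (fun r => {v | r ≤ t ∧ v.1 ∈ G.nearV v₀ (t - r)}) where
  map_edge {v i c j} e := by
    rw [add_zero, add_zero, Nat.mod_eq_of_lt ((G.nbhd v₀ t).graph.lt_degV e),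
      Nat.mod_eq_of_lt ((G.nbhd v₀ t).graph.lt_degC e)]
    exact e
  lift_var {r v i' c' j'} hv e := by
    refine ⟨i', ⟨c', G.mem_nearC_of_edge hv.2 (by have := hv.1; omega) e⟩, j', e, ?_, rfl, ?_⟩
    · exact Nat.mod_eq_of_lt (G.lt_degV e)
    · exact Nat.mod_eq_of_lt (G.lt_degC e)
  lift_check {r v i c j w' i' j'} hv e e' := by
    have hw : w' ∈ G.nearV v₀ (t - r) := by
      have := G.mem_nearV_succ hv.2 e e'
      rwa [show t - (r + 1) + 1 = t - r by have := hv.1; omega] at this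
    refine ⟨⟨w', G.nearV_mono v₀ (Nat.sub_le _ _) hw⟩, ⟨by have := hv.1; omega, hw⟩, i', j', e',
      rfl, ?_, ?_⟩
    · exact Nat.mod_eq_of_lt (G.lt_degV e')
    · exact Nat.mod_eq_of_lt (G.lt_degC e')

lemma rootErasure_nbhd (v₀ : V) (ε : ℝ) (t : ℕ) :
    (G.nbhd v₀ t).rootErasure ε t = G.erasureProb ε t v₀ :=
  (G.localIso_nbhd v₀ t).erasureProb_eq Subtype.val_injective ε
    ⟨le_rfl, by rw [Nat.sub_self]; exact rfl⟩

end LDPC.SocketGraph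

/-! ### Invariance under equivalence -/

namespace LDPC.RootedGraph

variable {G H : RootedGraph}

lemma rootErasure_eq (h : Equivalent G H) (ε : ℝ) (t : ℕ) :
    G.rootErasure ε t = H.rootErasure ε t := by
  obtain ⟨φ, ψ, k, l, hr, hk, hV, hC, hE⟩ := h
  have h : LocalIso G.graph H.graph φ ψ k l (fun _ => Set.univ) :=
    { map_edge := fun e => (hE _ _ _ _ (G.graph.lt_degV e) (G.graph.lt_degC e)).1 e
      lift_var := by
        intro r v i' c' j' _ e
        obtain ⟨c, rfl⟩ := ψ.surjective c'
        obtain ⟨i, hi, rfl⟩ := exists_add_mod_eq (k v) ((hV v) ▸ H.graph.lt_degV e)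
        obtain ⟨j, hj, rfl⟩ := exists_add_mod_eq (l c) ((hC c) ▸ H.graph.lt_degC e)
        exact ⟨i, c, j, (hE _ _ _ _ hi hj).2 e, rfl, rfl, rfl⟩
      lift_check := by
        intro r v i c j w' i' j' _ _ e
        obtain ⟨w, rfl⟩ := φ.surjective w'
        obtain ⟨i, hi, rfl⟩ := exists_add_mod_eq (k w) ((hV w) ▸ H.graph.lt_degV e)
        obtain ⟨j, hj, rfl⟩ := exists_add_mod_eq (l c) ((hC c) ▸ H.graph.lt_degC e)
        exact ⟨w, trivial, i, j, (hE _ _ _ _ hi hj).2 e, rfl, rfl, rfl⟩ }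
  rw [rootErasure, h.erasureProb_eq φ.injective ε (Set.mem_univ _), hr]
  rfl

lemma prod_degV_eq (h : Equivalent G H) (y : ℕ → ℝ) :
    ∏ v, y (G.graph.degV v) = ∏ v, y (H.graph.degV v) := by
  obtain ⟨φ, ψ, k, l, hr, hk, hV, hC, hE⟩ := h
  exact Fintype.prod_equiv φ _ _ fun v => by rw [hV]

lemma prod_degC_eq (h : Equivalent G H) (z : ℕ → ℝ) :
    ∏ c, z (G.graph.degC c) = ∏ c, z (H.graph.degC c) := by
  obtain ⟨φ, ψ, k, l, hr, hk, hV, hC, hE⟩ := h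
  exact Fintype.prod_equiv ψ _ _ fun v => by rw [hC]

lemma treeProb_eq (h : Equivalent G H) (L R : ℝ[X]) : treeProb L R G = treeProb L R H := by
  classical
  have hz := prod_degC_eq h (edgeFrac R)
  obtain ⟨φ, ψ, k, l, hr, hk, hV, hC, hE⟩ := h
  rw [treeProb, treeProb, hz, ← hr, hV]
  congr 2
  refine Finset.prod_equiv φ (fun v => ?_) (fun v _ => by rw [hV])
  simp

lemma numV_eq (h : Equivalent G H) (i : ℕ) : G.numV i = H.numV i := by
  obtain ⟨φ, ψ, k, l, hr, hk, hV, hC, hE⟩ := h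
  rw [numV, numV, ← Set.ncard_image_of_injective _ φ.injective]
  congr 1
  ext w
  obtain ⟨v, rfl⟩ := φ.surjective w
  simp [hV]

lemma numC_eq (h : Equivalent G H) (j : ℕ) : G.numC j = H.numC j := by
  obtain ⟨φ, ψ, k, l, hr, hk, hV, hC, hE⟩ := h
  rw [numC, numC, ← Set.ncard_image_of_injective _ ψ.injective]
  congr 1
  ext w
  obtain ⟨v, rfl⟩ := ψ.surjective w
  simp [hC]

/-- The set of the edges of a graph. -/
def edgeSet (G : RootedGraph) : Set (G.V × ℕ × G.C × ℕ) :=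
  {e | G.graph.Edge e.1 e.2.1 e.2.2.1 e.2.2.2}

lemma edgeSet_finite (G : RootedGraph) : G.edgeSet.Finite := by
  refine Set.Finite.subset ((Set.finite_univ (α := G.V)).prod
    ((Set.finite_Iio (∑ v, G.graph.degV v)).prod ((Set.finite_univ (α := G.C)).prod
      (Set.finite_Iio (∑ c, G.graph.degC c))))) ?_
  rintro ⟨v, i, c, j⟩ e
  exact ⟨trivial, (G.graph.lt_degV e).trans_le (Finset.single_le_sum
    (f := fun v => G.graph.degV v) (fun _ _ => Nat.zero_le _) (Finset.mem_univ v)), trivial,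
    (G.graph.lt_degC e).trans_le (Finset.single_le_sum
    (f := fun v => G.graph.degC v) (fun _ _ => Nat.zero_le _) (Finset.mem_univ c))⟩

lemma numEdges_le (h : Equivalent G H) : G.numEdges ≤ H.numEdges := by
  obtain ⟨φ, ψ, k, l, hr, hk, hV, hC, hE⟩ := h
  refine Set.ncard_le_ncard_of_injOn (t := H.edgeSet) (fun e => (φ e.1,
    (e.2.1 + k e.1) % G.graph.degV e.1, ψ e.2.2.1, (e.2.2.2 + l e.2.2.1) % G.graph.degC e.2.2.1))
    ?_ ?_ H.edgeSet_finite
  · rintro ⟨v, i, c, j⟩ e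
    exact (hE v c i j (G.graph.lt_degV e) (G.graph.lt_degC e)).1 e
  · rintro ⟨v, i, c, j⟩ e ⟨v', i', c', j'⟩ e' hh
    simp only [Prod.mk.injEq, EmbeddingLike.apply_eq_iff_eq] at hh
    obtain ⟨rfl, h1, rfl, h2⟩ := hh
    obtain rfl := add_mod_inj (G.graph.lt_degV e) (G.graph.lt_degV e') h1
    obtain rfl := add_mod_inj (G.graph.lt_degC e) (G.graph.lt_degC e') h2
    rfl

lemma numEdges_eq (h : Equivalent G H) : G.numEdges = H.numEdges :=
  (numEdges_le h).antisymm (numEdges_le (setoid.symm h))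

lemma cycleFree_iff (h : Equivalent G H) : G.CycleFree ↔ H.CycleFree := by
  rw [CycleFree, CycleFree, numEdges_eq h]
  obtain ⟨φ, ψ, -⟩ := h
  rw [Fintype.card_congr φ, Fintype.card_congr ψ]

end LDPC.RootedGraph

/-! ### Plane trees -/

/-- Plane trees of height `h` all of whose nodes have less than `B` children. The nodes at depth `h`
carry a number of children, but these children do not belong to the tree. -/
def PlaneTree (B : ℕ) : ℕ → Type
  | 0 => Fin B
  | h + 1 => (n : Fin B) × (Fin n → PlaneTree B h)

namespace PlaneTree

variable {B : ℕ}

instance instFintype : ∀ h, Fintype (PlaneTree B h)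
  | 0 => inferInstanceAs (Fintype (Fin B))
  | h + 1 =>
    have := instFintype h
    inferInstanceAs (Fintype ((n : Fin B) × (Fin n → PlaneTree B h)))

/-- The address of a node is the list of the choices of a child on the path from the root. This is
the finset of all addresses. -/
def nodes : ∀ {h : ℕ}, PlaneTree B h → Finset (List ℕ)
  | 0, _ => {[]}
  | _ + 1, ⟨_, ch⟩ => insert [] (Finset.univ.biUnion fun k =>
      (nodes (ch k)).map ⟨List.cons (k : ℕ), List.cons_injective⟩)

/-- The number of children of the node at the address `a` (zero if there is no such node). -/
def kids : ∀ {h : ℕ}, PlaneTree B h → List ℕ → ℕ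
  | 0, n, [] => Fin.val n
  | 0, _, _ :: _ => 0
  | _ + 1, ⟨n, _⟩, [] => n
  | _ + 1, ⟨n, ch⟩, k :: a => if hk : k < n then kids (ch ⟨k, hk⟩) a else 0

variable {h : ℕ}

lemma nil_mem_nodes (τ : PlaneTree B h) : [] ∈ nodes τ := by
  cases h with
  | zero => exact Finset.mem_singleton_self _
  | succ h => exact Finset.mem_insert_self _ _

lemma mem_nodes_zero {n : PlaneTree B 0} {a : List ℕ} : a ∈ nodes n ↔ a = [] :=
  Finset.mem_singleton

lemma cons_mem_nodes {n : Fin B} {ch : Fin n → PlaneTree B h} {k : ℕ} {a : List ℕ} :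
    k :: a ∈ nodes (h := h + 1) ⟨n, ch⟩ ↔ ∃ hk : k < n, a ∈ nodes (ch ⟨k, hk⟩) := by
  simp only [nodes, Finset.mem_insert, reduceCtorEq, false_or, Finset.mem_biUnion,
    Finset.mem_univ, true_and, Finset.mem_map, Function.Embedding.coeFn_mk, List.cons.injEq]
  constructor
  · rintro ⟨k', a', ha', rfl, rfl⟩
    exact ⟨k'.2, ha'⟩
  · rintro ⟨hk, ha⟩
    exact ⟨⟨k, hk⟩, a, ha, rfl, rfl⟩

lemma kids_cons {n : Fin B} {ch : Fin n → PlaneTree B h} {k : ℕ} (hk : k < n) (a : List ℕ) :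
    kids (h := h + 1) ⟨n, ch⟩ (k :: a) = kids (ch ⟨k, hk⟩) a := by
  simp [kids, hk]

lemma length_le_of_mem_nodes {τ : PlaneTree B h} {a : List ℕ} (ha : a ∈ nodes τ) :
    a.length ≤ h := by
  induction h generalizing a with
  | zero => rw [mem_nodes_zero.1 ha]; simp
  | succ h ih =>
    obtain ⟨n, ch⟩ := τ
    rcases a with _ | ⟨k, a⟩
    · simp
    · obtain ⟨hk, ha⟩ := cons_mem_nodes.1 ha
      simpa using ih ha

lemma concat_mem_nodes {τ : PlaneTree B h} {a : List ℕ} {k : ℕ} :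
    a ++ [k] ∈ nodes τ ↔ a ∈ nodes τ ∧ k < kids τ a ∧ a.length < h := by
  induction h generalizing a with
  | zero => simp [mem_nodes_zero]
  | succ h ih =>
    obtain ⟨n, ch⟩ := τ
    rcases a with _ | ⟨k', a⟩
    · rw [List.nil_append, cons_mem_nodes]
      simp only [nil_mem_nodes, exists_prop, and_true, kids, List.length_nil, Nat.succ_pos]
      exact ⟨fun h => ⟨nil_mem_nodes _, h⟩, fun h => h.2⟩
    · rw [List.cons_append, cons_mem_nodes, cons_mem_nodes]
      constructor
      · rintro ⟨hk, ha⟩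
        obtain ⟨h1, h2, h3⟩ := ih.1 ha
        exact ⟨⟨hk, h1⟩, by rwa [kids_cons hk], by simpa using h3⟩
      · rintro ⟨⟨hk, h1⟩, h2, h3⟩
        exact ⟨hk, ih.2 ⟨h1, by rwa [kids_cons hk] at h2, by simpa using h3⟩⟩

lemma ext_of_kids {τ τ' : PlaneTree B h}
    (H : ∀ a ∈ nodes τ, a ∈ nodes τ' ∧ kids τ a = kids τ' a) : τ = τ' := by
  induction h with
  | zero => exact Fin.ext (H [] (nil_mem_nodes _)).2
  | succ h ih =>
    obtain ⟨n, ch⟩ := τ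
    obtain ⟨n', ch'⟩ := τ'
    obtain rfl : n = n' := Fin.ext (H [] (nil_mem_nodes _)).2
    congr
    funext k
    refine ih fun a ha => ?_
    obtain ⟨h1, h2⟩ := H (k :: a) (cons_mem_nodes.2 ⟨k.2, ha⟩)
    obtain ⟨hk, h3⟩ := cons_mem_nodes.1 h1
    exact ⟨h3, by rwa [kids_cons k.2, kids_cons k.2] at h2⟩

/-- The tree of height `h + 1` that arises from a tree of height `h` when the children of the nodes
at depth `h` are added, all of them leaves. -/
def extend : ∀ {h : ℕ}, PlaneTree B h → PlaneTree B (h + 1)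
  | 0, n => ⟨n, fun _ => (⟨0, Nat.pos_of_ne_zero fun hB => by subst hB; exact Fin.elim0 n⟩ : Fin B)⟩
  | _ + 1, ⟨n, ch⟩ => ⟨n, fun k => extend (ch k)⟩

lemma mem_nodes_extend {τ : PlaneTree B h} {a : List ℕ} :
    a ∈ nodes τ ↔ a ∈ nodes (extend τ) ∧ a.length ≤ h := by
  induction h generalizing a with
  | zero =>
    rw [mem_nodes_zero]
    constructor
    · rintro rfl
      exact ⟨nil_mem_nodes _, le_rfl⟩
    · rintro ⟨-, h⟩
      simpa using h
  | succ h ih =>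
    obtain ⟨n, ch⟩ := τ
    rcases a with _ | ⟨k, a⟩
    · exact iff_of_true (nil_mem_nodes _) ⟨nil_mem_nodes _, Nat.zero_le _⟩
    · rw [cons_mem_nodes, extend, cons_mem_nodes]
      simp [ih]

lemma kids_extend {τ : PlaneTree B h} {a : List ℕ} (ha : a.length ≤ h) :
    kids (extend τ) a = kids τ a := by
  induction h generalizing a with
  | zero =>
    obtain rfl : a = [] := by simpa using ha
    rfl
  | succ h ih =>
    obtain ⟨n, ch⟩ := τ
    rcases a with _ | ⟨k, a⟩
    · rfl
    · simp only [extend, kids]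
      split_ifs
      · exact ih (by simpa using ha)
      · rfl

lemma kids_extend_eq_zero {τ : PlaneTree B h} {a : List ℕ} (ha : a.length = h + 1) :
    kids (extend τ) a = 0 := by
  induction h generalizing a with
  | zero =>
    obtain ⟨k, rfl⟩ : ∃ k, a = [k] := List.length_eq_one_iff.1 ha
    simp [extend, kids]
  | succ h ih =>
    obtain ⟨n, ch⟩ := τ
    rcases a with _ | ⟨k, a⟩
    · simp at ha
    · simp only [extend, kids]
      split_ifs
      · exact ih (by simpa using ha)
      · rfl

/-! ### The socket graph of a plane tree -/

/-- The number of sockets of the node `a` of a tree that lead to its parent; these come first. -/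
def parentSockets (a : List ℕ) : ℕ := if a = [] then 0 else 1

@[simp] lemma parentSockets_nil : parentSockets [] = 0 := rfl

@[simp] lemma parentSockets_concat (a : List ℕ) (k : ℕ) : parentSockets (a ++ [k]) = 1 := by
  simp [parentSockets]

/-- The nodes of a plane tree at even depth. -/
abbrev VarNode (τ : PlaneTree B h) : Type := {a // a ∈ (nodes τ).filter (Even ·.length)}

/-- The nodes of a plane tree at odd depth. -/
abbrev CheckNode (τ : PlaneTree B h) : Type := {a // a ∈ (nodes τ).filter (¬ Even ·.length)}

lemma VarNode.mem {τ : PlaneTree B h} (v : VarNode τ) : v.1 ∈ nodes τ :=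
  (Finset.mem_filter.1 v.2).1

lemma VarNode.even {τ : PlaneTree B h} (v : VarNode τ) : Even v.1.length :=
  (Finset.mem_filter.1 v.2).2

lemma CheckNode.mem {τ : PlaneTree B h} (c : CheckNode τ) : c.1 ∈ nodes τ :=
  (Finset.mem_filter.1 c.2).1

lemma CheckNode.odd {τ : PlaneTree B h} (c : CheckNode τ) : ¬ Even c.1.length :=
  (Finset.mem_filter.1 c.2).2

lemma CheckNode.ne_nil {τ : PlaneTree B h} (c : CheckNode τ) : c.1 ≠ [] := fun hc =>
  c.odd (by simp [hc])

/-- The edges of the socket graph of a tree: the `k`-th child of a node is attached to the `k`-th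
of its sockets that do not lead to its parent. -/
def TreeEdge (v : List ℕ) (i : ℕ) (c : List ℕ) (j : ℕ) : Prop :=
  (∃ k, c = v ++ [k] ∧ i = k + parentSockets v ∧ j = 0) ∨ ∃ k, v = c ++ [k] ∧ j = k + 1 ∧ i = 0

/-- A plane tree as a socket graph. -/
def graph (τ : PlaneTree B h) : SocketGraph (VarNode τ) (CheckNode τ) where
  degV v := kids τ v.1 + parentSockets v.1
  degC c := kids τ c.1 + 1
  Edge v i c j := TreeEdge v.1 i c.1 j
  lt_degV {v i c j} := by
    rintro (⟨k, hc, rfl, rfl⟩ | ⟨k, hv, rfl, rfl⟩)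
    · have := (concat_mem_nodes.1 (hc ▸ c.mem)).2.1
      omega
    · simp [hv]
  lt_degC {v i c j} := by
    rintro (⟨k, hc, rfl, rfl⟩ | ⟨k, hv, rfl, rfl⟩)
    · omega
    · have := (concat_mem_nodes.1 (hv ▸ v.mem)).2.1
      omega
  unique_right {v i c j c' j'} := by
    rintro (⟨k, hc, rfl, rfl⟩ | ⟨k, hv, rfl, rfl⟩) (⟨k', hc', hi, rfl⟩ | ⟨k', hv', rfl, hi⟩)
    · obtain rfl : k = k' := by omega
      exact ⟨Subtype.ext (hc.trans hc'.symm), rfl⟩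
    · simp [hv'] at hi
    · simp [hv] at hi
    · obtain ⟨h1, h2⟩ := List.append_inj' (hv.symm.trans hv') rfl
      exact ⟨Subtype.ext h1, by simpa using h2⟩
  unique_left {v i v' i' c j} := by
    rintro (⟨k, hc, rfl, rfl⟩ | ⟨k, hv, rfl, rfl⟩) (⟨k', hc', rfl, hj⟩ | ⟨k', hv', hj, rfl⟩)
    · obtain ⟨h1, h2⟩ := List.append_inj' (hc.symm.trans hc') rfl
      obtain rfl : k = k' := by simpa using h2
      exact ⟨Subtype.ext h1, by rw [h1]⟩
    · omega
    · omega
    · obtain rfl : k = k' := by omega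
      exact ⟨Subtype.ext (hv.trans hv'.symm), rfl⟩

/-- The root of a plane tree. -/
def treeRoot (τ : PlaneTree B h) : VarNode τ := ⟨[], by simp [nil_mem_nodes]⟩

/-- A plane tree as a rooted graph. -/
def rooted (τ : PlaneTree B h) : RootedGraph where
  V := VarNode τ
  C := CheckNode τ
  instV := inferInstance
  instC := inferInstance
  graph := τ.graph
  root := τ.treeRoot

lemma exists_parent {a : List ℕ} (ha : a ≠ []) : ∃ b k, a = b ++ [k] := by
  obtain h | ⟨b, k, h⟩ := List.eq_nil_or_concat' a
  · exact absurd h ha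
  · exact ⟨b, k, h⟩

lemma even_length_concat {a : List ℕ} {k : ℕ} : Even (a ++ [k]).length ↔ ¬ Even a.length := by
  rw [List.length_append, List.length_singleton, Nat.even_add_one]

/-- A node other than the root has exactly one edge to its parent. -/
lemma exists_edge_parentV {τ : PlaneTree B h} (v : VarNode τ) (hv : v.1 ≠ []) :
    ∃ (c : CheckNode τ) (k : ℕ), v.1 = c.1 ++ [k] ∧ TreeEdge v.1 0 c.1 (k + 1) := by
  obtain ⟨b, k, hb⟩ := exists_parent hv
  have h1 := v.mem
  have h2 := v.even
  rw [hb] at h1 h2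
  exact ⟨⟨b, Finset.mem_filter.2 ⟨(concat_mem_nodes.1 h1).1, even_length_concat.1 h2⟩⟩, k, hb,
    Or.inr ⟨k, hb, rfl, rfl⟩⟩

lemma exists_edge_parentC {τ : PlaneTree B h} (c : CheckNode τ) :
    ∃ (v : VarNode τ) (k : ℕ), c.1 = v.1 ++ [k] ∧ TreeEdge v.1 (k + parentSockets v.1) c.1 0 := by
  obtain ⟨b, k, hb⟩ := exists_parent c.ne_nil
  have h1 := c.mem
  have h2 := c.odd
  rw [hb] at h1 h2
  exact ⟨⟨b, Finset.mem_filter.2 ⟨(concat_mem_nodes.1 h1).1,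
    not_not.1 fun h => h2 (even_length_concat.2 h)⟩⟩, k, hb, Or.inl ⟨k, hb, rfl, rfl⟩⟩

lemma TreeEdge.length {v c : List ℕ} {i j : ℕ} (e : TreeEdge v i c j) :
    c.length = v.length + 1 ∨ v.length = c.length + 1 := by
  rcases e with ⟨k, rfl, -⟩ | ⟨k, rfl, -⟩ <;> simp

/-- Every edge of a tree is determined by that one of its ends which is further from the root, and
every node other than the root is such an end. -/
lemma cycleFree_rooted (τ : PlaneTree B h) : τ.rooted.CycleFree := by
  classical
  have hcard : τ.rooted.numEdges = ((nodes τ).erase []).card := by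
    rw [← Set.ncard_coe_finset]
    refine Set.ncard_congr (fun e _ => if e.1.1.length < e.2.2.1.1.length then e.2.2.1.1 else e.1.1)
      ?_ ?_ ?_
    · rintro ⟨v, i, c, j⟩ e
      dsimp only
      split_ifs with hl
      · exact Finset.mem_coe.2 (Finset.mem_erase.2 ⟨c.ne_nil, c.mem⟩)
      · refine Finset.mem_coe.2 (Finset.mem_erase.2 ⟨?_, v.mem⟩)
        rintro hv
        have := TreeEdge.length e
        simp [hv] at this hl
        simp [hl] at this
    · rintro ⟨v, i, c, j⟩ ⟨v', i', c', j'⟩ e e' hh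
      change TreeEdge v.1 i c.1 j at e
      change TreeEdge v'.1 i' c'.1 j' at e'
      dsimp only at hh
      have hne : ∀ (v : VarNode τ) (c : CheckNode τ), v.1 ≠ c.1 := fun v c h => c.odd (h ▸ v.even)
      rcases e with ⟨k, hc, hi, hj⟩ | ⟨k, hc, hi, hj⟩ <;>
      rcases e' with ⟨k', hc', hi', hj'⟩ | ⟨k', hc', hi', hj'⟩
      · simp only [hc, hc', List.length_append, List.length_singleton, Nat.lt_succ_self,
          if_true] at hh
        rw [← hc, ← hc'] at hh
        have e : τ.graph.Edge v i c j := Or.inl ⟨k, hc, hi, hj⟩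
        have e' : τ.graph.Edge v' i' c j := Or.inl ⟨k', hh.trans hc', hi', hj⟩
        obtain ⟨rfl, rfl⟩ := τ.graph.unique_left e e'
        rw [Subtype.ext hh, hj, hj']
      · have h1 : v.1.length < c.1.length := by rw [hc]; simp
        have h2 : ¬ v'.1.length < c'.1.length := by rw [hc']; simp
        rw [if_pos h1, if_neg h2] at hh
        exact absurd hh.symm (hne _ _)
      · have h1 : ¬ v.1.length < c.1.length := by rw [hc]; simp
        have h2 : v'.1.length < c'.1.length := by rw [hc']; simp
        rw [if_neg h1, if_pos h2] at hh
        exact absurd hh (hne _ _)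
      · have h1 : ¬ v.1.length < c.1.length := by rw [hc]; simp
        have h2 : ¬ v'.1.length < c'.1.length := by rw [hc']; simp
        rw [if_neg h1, if_neg h2] at hh
        have e : τ.graph.Edge v i c j := Or.inr ⟨k, hc, hi, hj⟩
        have e' : τ.graph.Edge v i c' j' := Or.inr ⟨k', hh.trans hc', hi', hj⟩
        obtain ⟨rfl, rfl⟩ := τ.graph.unique_right e e'
        rw [Subtype.ext hh, hj, hj']
    · intro a ha
      obtain ⟨ha0, ha⟩ := Finset.mem_erase.1 (Finset.mem_coe.1 ha)
      by_cases he : Even a.length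
      · obtain ⟨c, k, h1, h2⟩ := exists_edge_parentV
          (⟨a, Finset.mem_filter.2 ⟨ha, he⟩⟩ : VarNode τ) ha0
        refine ⟨(⟨a, Finset.mem_filter.2 ⟨ha, he⟩⟩, 0, c, k + 1), h2, ?_⟩
        dsimp only at h1 ⊢
        rw [if_neg]
        rw [h1]; simp
      · obtain ⟨v, k, h1, h2⟩ := exists_edge_parentC
          (⟨a, Finset.mem_filter.2 ⟨ha, he⟩⟩ : CheckNode τ)
        refine ⟨(v, k + parentSockets v.1, ⟨a, Finset.mem_filter.2 ⟨ha, he⟩⟩, 0), h2, ?_⟩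
        dsimp only at h1 ⊢
        rw [if_pos]
        rw [h1]; simp
  rw [RootedGraph.CycleFree, hcard, Finset.card_erase_add_one (nil_mem_nodes τ)]
  change _ = Fintype.card (VarNode τ) + Fintype.card (CheckNode τ)
  rw [Fintype.card_coe, Fintype.card_coe, Finset.card_filter_add_card_filter_not]

/-- After the children of the deepest variable nodes have been added, as check nodes of degree
one, every socket is connected. -/
lemma isTanner_graph_extend {t : ℕ} (τ : PlaneTree B (2 * t)) (h0 : 0 < kids τ []) :
    (extend τ).graph.IsTanner := by
  refine ⟨fun v => ?_, fun c => Nat.succ_pos _, fun v i hi => ?_, fun c j hj => ?_⟩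
  · change 0 < kids _ v.1 + parentSockets v.1
    rcases eq_or_ne v.1 [] with hv | hv
    · rw [hv, kids_extend (by simp)]
      simpa
    · simp [parentSockets, hv]
  · change i < kids _ v.1 + parentSockets v.1 at hi
    rcases lt_or_ge i (parentSockets v.1) with h1 | h1
    · have hv : v.1 ≠ [] := by rintro hv; simp [hv] at h1
      obtain rfl : i = 0 := by simpa [parentSockets, hv] using h1
      obtain ⟨c, k, -, h2⟩ := exists_edge_parentV v hv
      exact ⟨c, k + 1, h2⟩
    · obtain ⟨k, rfl⟩ := Nat.exists_eq_add_of_le' h1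
      refine ⟨⟨v.1 ++ [k], Finset.mem_filter.2 ⟨concat_mem_nodes.2 ⟨v.mem, by omega, ?_⟩, ?_⟩⟩, 0,
        Or.inl ⟨k, rfl, rfl, rfl⟩⟩
      · have h2 := length_le_of_mem_nodes v.mem
        have h3 := v.even
        refine h2.lt_of_ne fun h4 => ?_
        rw [h4] at h3
        simp at h3
      · rw [even_length_concat, not_not]
        exact v.even
  · rcases j with _ | k
    · obtain ⟨v, k, -, h2⟩ := exists_edge_parentC c
      exact ⟨v, _, h2⟩
    · change k + 1 < kids _ c.1 + 1 at hj
      refine ⟨⟨c.1 ++ [k], Finset.mem_filter.2 ⟨concat_mem_nodes.2 ⟨c.mem, by omega, ?_⟩, ?_⟩⟩, 0,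
        Or.inr ⟨k, rfl, rfl, rfl⟩⟩
      · refine (length_le_of_mem_nodes c.mem).lt_of_ne fun h4 => ?_
        rw [kids_extend_eq_zero h4] at hj
        omega
      · rw [even_length_concat]
        exact c.odd

lemma mem_nearV_graph (τ : PlaneTree B h) (v : VarNode τ) (r : ℕ) :
    v ∈ τ.graph.nearV τ.rooted.root r ↔ v.1.length ≤ 2 * r := by
  induction r generalizing v with
  | zero =>
    refine Subtype.ext_iff.trans ?_
    change v.1 = [] ↔ _
    simp
  | succ r ih =>
    constructor
    · rintro (hv | ⟨w, hw, c, ⟨i, j, e⟩, i', j', e'⟩)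
      · have := (ih v).1 hv
        omega
      · have h1 := (ih w).1 hw
        have h2 := TreeEdge.length e
        have h3 := TreeEdge.length e'
        omega
    · intro hv
      by_cases hv' : v.1.length ≤ 2 * r
      · exact Or.inl ((ih v).2 hv')
      · obtain ⟨c, k, h1, e⟩ := exists_edge_parentV v (by rintro hv0; simp [hv0] at hv')
        obtain ⟨w, k', h2, e'⟩ := exists_edge_parentC c
        refine Or.inr ⟨w, (ih w).2 ?_, c, ⟨_, _, e'⟩, _, _, e⟩
        rw [h1, h2] at hv
        simp at hv
        omega

lemma mem_nearC_graph (τ : PlaneTree B h) (c : CheckNode τ) (t : ℕ) :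
    c ∈ τ.graph.nearC τ.rooted.root t ↔ c.1.length ≤ 2 * t := by
  constructor
  · rintro ⟨r, hr, w, hw, i, j, e⟩
    have h1 := (mem_nearV_graph τ w r).1 hw
    have h2 := TreeEdge.length e
    omega
  · intro hc
    obtain ⟨w, k', h2, e'⟩ := exists_edge_parentC c
    have h3 := congrArg List.length h2
    obtain ⟨r, hr⟩ := w.even
    simp at h3
    exact ⟨r, by omega, w, (mem_nearV_graph τ w r).2 (by omega), _, _, e'⟩

/-- A tree of height `2 * t` is a neighborhood graph: the neighborhood of the root in the same tree
with pendant check nodes attached to the leaves. -/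
lemma rooted_equiv_nbhd {t : ℕ} (τ : PlaneTree B (2 * t)) :
    RootedGraph.Equivalent τ.rooted ((extend τ).graph.nbhd (extend τ).rooted.root t) := by
  refine ⟨
    { toFun := fun v => ⟨⟨v.1, Finset.mem_filter.2 ⟨(mem_nodes_extend.1 v.mem).1, v.even⟩⟩,
        (mem_nearV_graph _ _ _).2 (length_le_of_mem_nodes v.mem)⟩
      invFun := fun v => ⟨v.1.1, Finset.mem_filter.2 ⟨mem_nodes_extend.2
        ⟨v.1.mem, (mem_nearV_graph _ _ _).1 v.2⟩, v.1.even⟩⟩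
      left_inv := fun v => rfl
      right_inv := fun v => rfl },
    { toFun := fun v => ⟨⟨v.1, Finset.mem_filter.2 ⟨(mem_nodes_extend.1 v.mem).1, v.odd⟩⟩,
        (mem_nearC_graph _ _ _).2 (length_le_of_mem_nodes v.mem)⟩
      invFun := fun v => ⟨v.1.1, Finset.mem_filter.2 ⟨mem_nodes_extend.2
        ⟨v.1.mem, (mem_nearC_graph _ _ _).1 v.2⟩, v.1.odd⟩⟩
      left_inv := fun v => rfl
      right_inv := fun v => rfl }, fun _ => 0, fun _ => 0, rfl, rfl, fun v => ?_, fun c => ?_,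
    fun v c i j hi hj => ?_⟩
  · exact congrArg (· + parentSockets v.1) (kids_extend (length_le_of_mem_nodes v.mem))
  · exact congrArg (· + 1) (kids_extend (length_le_of_mem_nodes c.mem))
  · rw [add_zero, add_zero, Nat.mod_eq_of_lt hi, Nat.mod_eq_of_lt hj]
    rfl

lemma rooted_mem_cycleFreeClasses {t : ℕ} (τ : PlaneTree B (2 * t)) (h0 : 0 < kids τ []) :
    (⟦τ.rooted⟧ : GraphClass) ∈ cycleFreeClasses t :=
  ⟨_, _, inferInstance, inferInstance, (extend τ).graph, (extend τ).rooted.root,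
    isTanner_graph_extend τ h0,
    (RootedGraph.cycleFree_iff (rooted_equiv_nbhd τ)).1 (cycleFree_rooted τ),
    Quotient.sound (rooted_equiv_nbhd τ)⟩

/-- A map between two trees that respects the root and, up to cyclic shifts of the sockets, the
edges preserves all addresses and shifts no socket: in every node other than the root the socket
`0` is the one that leads to the parent. -/
lemma address_eq {τ τ' : PlaneTree B h} (φ : VarNode τ → VarNode τ')
    (ψ : CheckNode τ → CheckNode τ')
    (k : VarNode τ → ℕ) (l : CheckNode τ → ℕ) (hr : (φ τ.treeRoot).1 = [])
    (hk : k τ.treeRoot = 0)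
    (hE : ∀ v c i j, τ.graph.Edge v i c j → τ'.graph.Edge (φ v) ((i + k v) % τ.graph.degV v) (ψ c)
      ((j + l c) % τ.graph.degC c)) (a : List ℕ) :
    (∀ v : VarNode τ, v.1 = a → (φ v).1 = a ∧ k v % τ.graph.degV v = 0) ∧
    (∀ c : CheckNode τ, c.1 = a → (ψ c).1 = a ∧ l c % τ.graph.degC c = 0) := by
  induction a using List.reverseRecOn with
  | nil =>
    refine ⟨fun v hv => ?_, fun c hc => absurd hc c.ne_nil⟩
    obtain rfl : v = τ.treeRoot := Subtype.ext hv
    rw [hk, Nat.zero_mod]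
    exact ⟨hr, rfl⟩
  | append_singleton b x ih =>
    constructor
    · intro v hv
      obtain ⟨c, x', h1, e⟩ := exists_edge_parentV v (by simp [hv])
      obtain ⟨h2, h3⟩ := List.append_inj' (hv.symm.trans h1) rfl
      obtain rfl : x = x' := by simpa using h3
      replace e : τ.graph.Edge v 0 c (x + 1) := e
      obtain ⟨h4, h5⟩ := ih.2 c h2.symm
      have h6 := hE _ _ _ _ e
      rw [zero_add, Nat.add_mod _ (l c), h5, add_zero, Nat.mod_mod,
        Nat.mod_eq_of_lt (τ.graph.lt_degC e)] at h6
      rcases h6 with ⟨y, -, -, h7⟩ | ⟨y, h7, h8, h9⟩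
      · omega
      · refine ⟨?_, h9⟩
        rw [h7, h4, Nat.add_right_cancel h8]
    · intro c hc
      obtain ⟨v, x', h1, e⟩ := exists_edge_parentC c
      obtain ⟨h2, h3⟩ := List.append_inj' (hc.symm.trans h1) rfl
      obtain rfl : x = x' := by simpa using h3
      replace e : τ.graph.Edge v (x + parentSockets v.1) c 0 := e
      obtain ⟨h4, h5⟩ := ih.1 v h2.symm
      have h6 := hE _ _ _ _ e
      rw [zero_add, Nat.add_mod _ (k v), h5, add_zero, Nat.mod_mod,
        Nat.mod_eq_of_lt (τ.graph.lt_degV e)] at h6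
      rcases h6 with ⟨y, h7, h8, h9⟩ | ⟨y, h7, -, h9⟩
      · refine ⟨?_, h9⟩
        rw [h4, ← h2] at h8
        rw [h7, h4, Nat.add_right_cancel h8]
      · rw [← h2, ← h4, h7] at h9
        simp at h9

/-- Equivalent trees are equal. -/
lemma eq_of_equivalent {τ τ' : PlaneTree B h} (H : RootedGraph.Equivalent τ.rooted τ'.rooted) :
    τ = τ' := by
  obtain ⟨φ, ψ, k, l, hr, hk, hV, hC, hE⟩ := H
  have key := address_eq (τ := τ) (τ' := τ') φ ψ k l (congrArg Subtype.val hr) hk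
    fun v c i j e => (hE v c i j (τ.graph.lt_degV e) (τ.graph.lt_degC e)).1 e
  refine ext_of_kids fun a ha => ?_
  by_cases he : Even a.length
  · let v : VarNode τ := ⟨a, Finset.mem_filter.2 ⟨ha, he⟩⟩
    have h1 := ((key a).1 v rfl).1
    have h2 : kids τ' (φ v).1 + parentSockets (φ v).1 = kids τ a + parentSockets a := hV v
    have h3 := VarNode.mem (φ v)
    rw [h1] at h2 h3
    exact ⟨h3, (Nat.add_right_cancel h2).symm⟩
  · let c : CheckNode τ := ⟨a, Finset.mem_filter.2 ⟨ha, he⟩⟩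
    have h1 := ((key a).2 c rfl).1
    have h2 : kids τ' (ψ c).1 + 1 = kids τ a + 1 := hC c
    have h3 := CheckNode.mem (ψ c)
    rw [h1] at h2 h3
    exact ⟨h3, (Nat.add_right_cancel h2).symm⟩

end PlaneTree

/-! ### Belief propagation on plane trees -/

namespace PlaneTree

variable {B h : ℕ}

/-- The message that the root of the tree passes on towards a parent is erased, where the variable
nodes are those at even height, and those in `S` are erased by the channel. -/
def Erased : ∀ {h : ℕ}, PlaneTree B h → Set (List ℕ) → Prop
  | 0, _, S => [] ∈ S
  | h + 1, ⟨n, ch⟩, S =>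
    if Even (h + 1) then [] ∈ S ∧ ∀ k : Fin n, Erased (ch k) (List.cons (k : ℕ) ⁻¹' S)
    else ∃ k : Fin n, Erased (ch k) (List.cons (k : ℕ) ⁻¹' S)

/-- The probability that the message which the root of the tree passes on is not erased. -/
noncomputable def unerased (ε : ℝ) : ∀ {h : ℕ}, PlaneTree B h → ℝ
  | 0, _ => 1 - ε
  | h + 1, ⟨n, ch⟩ =>
    if Even (h + 1) then 1 - ε * ∏ k : Fin n, (1 - unerased ε (ch k))
    else ∏ k : Fin n, unerased ε (ch k)

lemma erased_congr {τ : PlaneTree B h} {S S' : Set (List ℕ)}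
    (H : ∀ a ∈ nodes τ, Even (a.length + h) → (a ∈ S ↔ a ∈ S')) : Erased τ S ↔ Erased τ S' := by
  induction h generalizing S S' with
  | zero => exact H [] (nil_mem_nodes _) (by simp)
  | succ h ih =>
    obtain ⟨n, ch⟩ := τ
    have h1 : ∀ k : Fin n, Erased (ch k) (List.cons (k : ℕ) ⁻¹' S) ↔
        Erased (ch k) (List.cons (k : ℕ) ⁻¹' S') := fun k => ih fun a ha he =>
      H (k :: a) (cons_mem_nodes.2 ⟨k.2, ha⟩) (by
        rw [List.length_cons, show a.length + 1 + (h + 1) = a.length + h + 2 by ring]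
        exact he.add even_two)
    simp only [Erased, h1]
    split_ifs with he
    · rw [H [] (nil_mem_nodes _) (by simpa using he)]
    · rfl

open Classical in
/-- The messages of different children depend on disjoint sets of variable nodes and are therefore
independent. -/
lemma bernoulliSum_erased (ε : ℝ) (τ : PlaneTree B h) :
    bernoulliSum ε (nodes τ) (fun S => if Erased τ S then 0 else 1) = unerased ε τ := by
  induction h with
  | zero =>
    change bernoulliSum ε {[]} (fun S => if [] ∈ S then 0 else 1) = 1 - ε
    rw [← insert_empty_eq, bernoulliSum_insert (Finset.notMem_empty _)]
    simp [bernoulliSum_empty]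
  | succ h ih =>
    obtain ⟨n, ch⟩ := τ
    set U : Fin n → Finset (List ℕ) := fun k =>
      (nodes (ch k)).map ⟨List.cons (k : ℕ), List.cons_injective⟩ with hU
    have hnil : [] ∉ Finset.univ.biUnion U := by simp [hU]
    have hdisj : ((Finset.univ : Finset (Fin n)) : Set (Fin n)).PairwiseDisjoint U := by
      intro k _ k' _ hk
      refine Finset.disjoint_left.2 fun a ha ha' => hk ?_
      simp only [hU, Finset.mem_map, Function.Embedding.coeFn_mk] at ha ha'
      obtain ⟨b, -, rfl⟩ := ha
      obtain ⟨b', -, h'⟩ := ha'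
      exact Fin.ext (List.cons.inj h').1.symm
    have hloc : ∀ (k : Fin n) (S : Set (List ℕ)), Erased (ch k) (List.cons (k : ℕ) ⁻¹' (S ∩ U k)) ↔
        Erased (ch k) (List.cons (k : ℕ) ⁻¹' S) := fun k S => erased_congr fun a ha _ => by
      simp [hU, ha]
    have hk : ∀ k, bernoulliSum ε (U k)
        (fun S => if Erased (ch k) (List.cons (k : ℕ) ⁻¹' S) then 0 else 1) =
          unerased ε (ch k) := fun k => by
      rw [hU, bernoulliSum_map, ← ih]
      refine bernoulliSum_congr fun S _ => ?_
      simp only [Function.Embedding.coeFn_mk, Set.preimage_image_eq S List.cons_injective]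
    have hins : ∀ (k : ℕ) (S : Set (List ℕ)),
        List.cons k ⁻¹' (insert [] S) = List.cons k ⁻¹' S := fun k S => by ext; simp
    change bernoulliSum ε (insert [] (Finset.univ.biUnion U)) _ = _
    rw [bernoulliSum_insert hnil]
    simp only [Erased, unerased]
    split_ifs with he
    · have h1 : bernoulliSum ε (Finset.univ.biUnion U) (fun S => if [] ∈ S ∧ ∀ k : Fin n,
          Erased (ch k) (List.cons (k : ℕ) ⁻¹' S) then (0 : ℝ) else 1) = 1 := by
        rw [bernoulliSum_congr (g := fun _ => 1), bernoulliSum_const]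
        intro S hS
        rw [if_neg fun h' => hnil (hS h'.1)]
      have h2 : bernoulliSum ε (Finset.univ.biUnion U) (fun S => if [] ∈ insert [] S ∧ ∀ k : Fin n,
          Erased (ch k) (List.cons (k : ℕ) ⁻¹' (insert [] S)) then (0 : ℝ) else 1) =
            1 - ∏ k, (1 - unerased ε (ch k)) := by
        have hk' : ∀ k, 1 - unerased ε (ch k) = bernoulliSum ε (U k)
            (fun S => if Erased (ch k) (List.cons (k : ℕ) ⁻¹' S) then 1 else 0) := fun k => by
          rw [← hk, ← bernoulliSum_one_sub]
          exact bernoulliSum_congr fun S _ => by split_ifs <;> simp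
        simp only [hk']
        rw [← bernoulliSum_biUnion_prod _ _ hdisj, ← bernoulliSum_one_sub]
        · refine bernoulliSum_congr fun S _ => ?_
          simp only [Finset.prod_ite_zero, hins]
          simp only [Set.mem_insert_iff, true_or, true_and, Finset.mem_univ, true_imp_iff,
            Finset.prod_const_one]
          split_ifs <;> simp
        · intro k _ S
          simp only [hloc]
      rw [h1, h2]
      ring
    · have h1 : bernoulliSum ε (Finset.univ.biUnion U) (fun S => if ∃ k : Fin n,
          Erased (ch k) (List.cons (k : ℕ) ⁻¹' S) then (0 : ℝ) else 1) =
            ∏ k, unerased ε (ch k) := by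
        simp only [← hk]
        rw [← bernoulliSum_biUnion_prod _ _ hdisj]
        · refine bernoulliSum_congr fun S _ => ?_
          have : ∀ k : Fin n, (if Erased (ch k) (List.cons (k : ℕ) ⁻¹' S) then (0 : ℝ) else 1) =
              if ¬ Erased (ch k) (List.cons (k : ℕ) ⁻¹' S) then 1 else 0 := fun k => by
            split_ifs <;> simp
          simp only [this, Finset.prod_ite_zero]
          simp only [Finset.mem_univ, true_imp_iff, Finset.prod_const_one]
          split_ifs with h1 h2 h2 <;> simp_all
        · intro k _ S
          simp only [hloc]
      simp only [hins, h1]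
      ring

section Messages

variable {τ : PlaneTree B h} (S : Set (VarNode τ))

lemma edge_concat {a : VarNode τ} {k : ℕ} (hk : a.1 ++ [k] ∈ nodes τ) :
    ∃ c : CheckNode τ, c.1 = a.1 ++ [k] ∧ τ.graph.Edge a (k + parentSockets a.1) c 0 :=
  ⟨⟨a.1 ++ [k], Finset.mem_filter.2 ⟨hk, by rw [even_length_concat, not_not]; exact a.even⟩⟩, rfl,
    Or.inl ⟨k, rfl, rfl, rfl⟩⟩

lemma edge_concat_check {c : CheckNode τ} {k : ℕ} (hk : c.1 ++ [k] ∈ nodes τ) :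
    ∃ v : VarNode τ, v.1 = c.1 ++ [k] ∧ τ.graph.Edge v 0 c (k + 1) :=
  ⟨⟨c.1 ++ [k], Finset.mem_filter.2 ⟨hk, by rw [even_length_concat]; exact c.odd⟩⟩, rfl,
    Or.inr ⟨k, rfl, rfl, rfl⟩⟩

/-- The messages of the children determine the message of a check node. -/
lemma checkErased_graph_iff {r : ℕ}
    (ih : ∀ (σ : PlaneTree B (2 * r)) (v : VarNode τ), v.1 ≠ [] →
      (∀ b, v.1 ++ b ∈ nodes τ ↔ b ∈ nodes σ) →
      (τ.graph.varErased S r v 0 ↔ Erased σ ((v.1 ++ ·) ⁻¹' (Subtype.val '' S))))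
    (σ : PlaneTree B (2 * r + 1)) (c : CheckNode τ)
    (hc : ∀ b, c.1 ++ b ∈ nodes τ ↔ b ∈ nodes σ) :
    τ.graph.checkErased (τ.graph.varErased S r) c 0 ↔
      Erased σ ((c.1 ++ ·) ⁻¹' (Subtype.val '' S)) := by
  obtain ⟨m, ch⟩ := σ
  have hodd : ¬ Even (2 * r + 1) := by simp
  simp only [Erased, if_neg hodd]
  have key : ∀ (k : Fin m) (v : VarNode τ), v.1 = c.1 ++ [(k : ℕ)] →
      (τ.graph.varErased S r v 0 ↔
        Erased (ch k) (List.cons (k : ℕ) ⁻¹' ((c.1 ++ ·) ⁻¹' (Subtype.val '' S)))) := by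
    intro k v hv
    rw [ih (ch k) v (by simp [hv]) fun b => ?_, hv]
    · simp only [Set.preimage_preimage, List.append_assoc, List.singleton_append]
    · rw [hv, List.append_assoc, List.singleton_append, hc, cons_mem_nodes]
      exact ⟨fun ⟨_, h'⟩ => h', fun h' => ⟨k.2, h'⟩⟩
  constructor
  · rintro ⟨v, i, j, hj, ⟨k, -, -, h3⟩ | ⟨k, h1, h2, rfl⟩, he⟩
    · exact absurd h3 hj
    · have hk : k < m := (cons_mem_nodes.1 ((hc [k]).1 (h1 ▸ v.mem))).1
      exact ⟨⟨k, hk⟩, (key ⟨k, hk⟩ v h1).1 he⟩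
  · rintro ⟨k, hk⟩
    obtain ⟨v, hv, e⟩ := edge_concat_check (c := c) (k := k)
      ((hc _).2 (cons_mem_nodes.2 ⟨k.2, nil_mem_nodes _⟩))
    exact ⟨v, 0, k + 1, by omega, e, (key k v hv).2 hk⟩

/-- The messages of the children of a variable node that belong to a subtree of even height. -/
lemma forall_checkErased_iff {r : ℕ}
    (ih : ∀ (σ : PlaneTree B (2 * r)) (v : VarNode τ), v.1 ≠ [] →
      (∀ b, v.1 ++ b ∈ nodes τ ↔ b ∈ nodes σ) →
      (τ.graph.varErased S r v 0 ↔ Erased σ ((v.1 ++ ·) ⁻¹' (Subtype.val '' S))))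
    (σ : PlaneTree B (2 * (r + 1))) (v : VarNode τ)
    (hv : ∀ b, v.1 ++ b ∈ nodes τ ↔ b ∈ nodes σ) :
    (v ∈ S ∧ ∀ i c j, parentSockets v.1 ≤ i → τ.graph.Edge v i c j →
      τ.graph.checkErased (τ.graph.varErased S r) c j) ↔
      Erased σ ((v.1 ++ ·) ⁻¹' (Subtype.val '' S)) := by
  obtain ⟨n, ch⟩ : (n : Fin B) × (Fin n → PlaneTree B (2 * r + 1)) := σ
  change _ ↔ Erased (h := 2 * r + 1 + 1) ⟨n, ch⟩ _
  replace hv : ∀ b, v.1 ++ b ∈ nodes τ ↔ b ∈ nodes (h := 2 * r + 1 + 1) ⟨n, ch⟩ := hv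
  have heven : Even (2 * r + 1 + 1) := ⟨r + 1, by ring⟩
  simp only [Erased, if_pos heven]
  refine and_congr (by simp) ?_
  have key : ∀ (k : Fin n) (c : CheckNode τ), c.1 = v.1 ++ [(k : ℕ)] →
      (τ.graph.checkErased (τ.graph.varErased S r) c 0 ↔
        Erased (ch k) (List.cons (k : ℕ) ⁻¹' ((v.1 ++ ·) ⁻¹' (Subtype.val '' S)))) := by
    intro k c hc
    rw [checkErased_graph_iff S ih (ch k) c fun b => ?_, hc]
    · simp only [Set.preimage_preimage, List.append_assoc, List.singleton_append]
    · rw [hc, List.append_assoc, List.singleton_append, hv, cons_mem_nodes]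
      exact ⟨fun ⟨_, h'⟩ => h', fun h' => ⟨k.2, h'⟩⟩
  constructor
  · intro H k
    obtain ⟨c, hc, e⟩ := edge_concat (a := v) (k := k)
      ((hv _).2 (cons_mem_nodes.2 ⟨k.2, nil_mem_nodes _⟩))
    exact (key k c hc).1 (H _ c 0 (Nat.le_add_left _ _) e)
  · rintro H i c j hi (⟨k, h1, rfl, rfl⟩ | ⟨k, h1, -, rfl⟩)
    · have hk : k < n := (cons_mem_nodes.1 ((hv [k]).1 (h1 ▸ c.mem))).1
      exact (key ⟨k, hk⟩ c h1).2 (H ⟨k, hk⟩)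
    · simp [h1] at hi

lemma varErased_graph_iff (r : ℕ) : ∀ (σ : PlaneTree B (2 * r)) (v : VarNode τ), v.1 ≠ [] →
    (∀ b, v.1 ++ b ∈ nodes τ ↔ b ∈ nodes σ) →
    (τ.graph.varErased S r v 0 ↔ Erased σ ((v.1 ++ ·) ⁻¹' (Subtype.val '' S))) := by
  induction r with
  | zero =>
    intro σ v _ _
    change v ∈ S ↔ v.1 ++ [] ∈ Subtype.val '' S
    simp
  | succ r ih =>
    intro σ v hv0 hv
    rw [← forall_checkErased_iff S ih σ v hv]
    simp only [SocketGraph.varErased, parentSockets, if_neg hv0]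
    refine and_congr Iff.rfl ⟨fun H i c j hi => H i c j (by omega), fun H i c j hi =>
      H i c j (by omega)⟩

end Messages

lemma bitErased_graph_iff {t : ℕ} (τ : PlaneTree B (2 * t)) (S : Set (VarNode τ)) :
    τ.graph.bitErased S t τ.treeRoot ↔ Erased τ (Subtype.val '' S) := by
  cases t with
  | zero =>
    change τ.treeRoot ∈ S ↔ τ.treeRoot.1 ∈ Subtype.val '' S
    simp
  | succ r =>
    have := forall_checkErased_iff S (varErased_graph_iff S r) τ τ.treeRoot fun b => Iff.rfl
    simp only [treeRoot, parentSockets_nil, Nat.zero_le, true_imp_iff] at this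
    exact this

lemma rootErasure_rooted {t : ℕ} (τ : PlaneTree B (2 * t)) (ε : ℝ) :
    τ.rooted.rootErasure ε t = 1 - unerased ε τ := by
  classical
  have h1 : τ.rooted.rootErasure ε t = bernoulliSum ε (Finset.univ : Finset (VarNode τ))
      (fun S => if τ.graph.bitErased S t τ.treeRoot then 1 else 0) :=
    SocketGraph.erasureProb_eq_bernoulliSum τ.graph ε t τ.treeRoot
  have h2 : (Finset.univ : Finset (VarNode τ)).map (Function.Embedding.subtype _) =
      (nodes τ).filter (Even ·.length) := Finset.attach_map_val
  have h3 (f : Set (List ℕ) → ℝ) : bernoulliSum ε ((nodes τ).filter (Even ·.length)) f =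
      bernoulliSum ε (Finset.univ : Finset (VarNode τ)) (fun S => f (Subtype.val '' S)) := by
    have := bernoulliSum_map (ε := ε) (Function.Embedding.subtype _)
      (Finset.univ : Finset (VarNode τ)) f
    rwa [h2] at this
  rw [h1, ← bernoulliSum_erased, ← bernoulliSum_one_sub]
  refine Eq.trans ?_ (bernoulliSum_subset (Finset.filter_subset (Even ·.length) (nodes τ)) ?_).symm
  · rw [h3]
    refine bernoulliSum_congr fun S _ => ?_
    rw [bitErased_graph_iff]
    split_ifs <;> simp
  · intro S
    have : Erased τ (S ∩ ((nodes τ).filter (Even ·.length) : Finset (List ℕ))) ↔ Erased τ S :=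
      erased_congr fun a ha he => by
        rw [Nat.even_add] at he
        simp [ha, he.2 (even_two_mul t)]
    simp only [this]

/-! ### Generating functions of plane trees -/

/-- The product over the nodes of a tree of weights `F d n`, where `d` is the depth of the node and
`n` the number of its children. -/
noncomputable def weight : ∀ {h : ℕ}, (ℕ → ℕ → ℝ) → PlaneTree B h → ℝ
  | 0, F, n => F 0 (Fin.val n)
  | _ + 1, F, ⟨n, ch⟩ => F 0 n * ∏ k : Fin n, weight (fun d => F (d + 1)) (ch k)

lemma prod_nodes (F : ℕ → ℕ → ℝ) (τ : PlaneTree B h) :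
    ∏ a ∈ nodes τ, F a.length (kids τ a) = weight F τ := by
  induction h generalizing F with
  | zero => exact Finset.prod_singleton _ _
  | succ h ih =>
    obtain ⟨n, ch⟩ := τ
    simp only [nodes, weight]
    rw [Finset.prod_insert (by simp), Finset.prod_biUnion]
    · congr 1
      refine Finset.prod_congr rfl fun k _ => ?_
      rw [Finset.prod_map, ← ih]
      refine Finset.prod_congr rfl fun a _ => ?_
      simp only [Function.Embedding.coeFn_mk, List.length_cons, kids_cons k.2]
    · intro k _ k' _ hk
      refine Finset.disjoint_left.2 fun a ha ha' => hk ?_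
      simp only [Finset.mem_map, Function.Embedding.coeFn_mk] at ha ha'
      obtain ⟨b, -, rfl⟩ := ha
      obtain ⟨b', -, h'⟩ := ha'
      exact Fin.ext (List.cons.inj h').1.symm

lemma sum_succ {F : ℕ → ℝ} {p : PlaneTree B h → ℝ} :
    ∑ τ : PlaneTree B (h + 1), F τ.1 * ∏ k, p (τ.2 k) =
      ∑ n ∈ Finset.range B, F n * (∑ σ : PlaneTree B h, p σ) ^ n := by
  rw [← Fin.sum_univ_eq_sum_range (fun n => F n * (∑ σ : PlaneTree B h, p σ) ^ n)]
  refine (Fintype.sum_sigma _).trans (Finset.sum_congr rfl fun n _ => ?_)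
  rw [Fintype.sum_pow, Finset.mul_sum]

variable (L R : ℝ[X]) (y z : ℕ → ℝ)

/-- The weight of a node with `n` children that is not the root. The variable nodes are at the
depths `d` such that `d + s` is even. -/
noncomputable def edgeWeight (s d n : ℕ) : ℝ :=
  if Even (d + s) then edgeFrac L (n + 1) * y (n + 1) else edgeFrac R (n + 1) * z (n + 1)

/-- The weight of a node in a tree whose root is a variable node. -/
noncomputable def rootWeight : ℕ → ℕ → ℝ
  | 0, n => L.coeff n * y n
  | d + 1, n => edgeWeight L R y z 1 d n

lemma edgeWeight_succ (s : ℕ) :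
    (fun d => edgeWeight L R y z s (d + 1)) = edgeWeight L R y z (s + 1) := by
  funext d n
  simp only [edgeWeight, show d + 1 + s = d + (s + 1) by ring]

variable {L R}

/-- The generating functions of trees with a variable node or a check node as their root. -/
lemma sum_weight (hL : L.natDegree ≤ B) (hR : R.natDegree ≤ B) (t : ℕ) :
    ∑ τ : PlaneTree B (2 * t), weight (edgeWeight L R y z 0) τ = augg L R (t + 1) y z ∧
    ∑ τ : PlaneTree B (2 * t + 1), weight (edgeWeight L R y z 1) τ = augf L R (t + 1) y z := by
  have step : ∀ t, ∑ τ : PlaneTree B (2 * t), weight (edgeWeight L R y z 0) τ =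
        augg L R (t + 1) y z →
      ∑ τ : PlaneTree B (2 * t + 1), weight (edgeWeight L R y z 1) τ = augf L R (t + 1) y z := by
    intro t ih
    refine (sum_succ (F := edgeWeight L R y z 1 0)
      (p := weight fun d => edgeWeight L R y z 1 (d + 1))).trans ?_
    have h2 : edgeWeight L R y z (1 + 1) = edgeWeight L R y z 0 := by
      funext d n
      simp [edgeWeight, Nat.even_add]
    rw [edgeWeight_succ, h2, ih, augf, augEdge_eq_sum_range R _ _ hR]
    simp [edgeWeight, augg]
  suffices h : ∑ τ : PlaneTree B (2 * t), weight (edgeWeight L R y z 0) τ =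
    augg L R (t + 1) y z from ⟨h, step t h⟩
  induction t with
  | zero =>
    rw [augg, augEdge_eq_sum_range L _ _ hL, ← Fin.sum_univ_eq_sum_range
      (fun n => edgeFrac L (n + 1) * y (n + 1) * augf L R (0 + 1 - 1) y z ^ n)]
    refine Fintype.sum_congr _ _ fun n : Fin B => ?_
    simp [weight, edgeWeight, augf]
  | succ t ih =>
    refine (sum_succ (h := 2 * t + 1) (F := edgeWeight L R y z 0 0)
      (p := weight fun d => edgeWeight L R y z 0 (d + 1))).trans ?_
    rw [edgeWeight_succ, step t ih, augg, augEdge_eq_sum_range L _ _ hL]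
    simp [edgeWeight]

/-- The generating functions weighted by the probability that the message of the root is not
erased. -/
lemma sum_weight_mul_unerased (hL : L.natDegree ≤ B) (hR : R.natDegree ≤ B) (ε : ℝ) (t : ℕ) :
    ∑ τ : PlaneTree B (2 * t), weight (edgeWeight L R y z 0) τ * unerased ε τ =
      augG L R ε (t + 1) y z ∧
    ∑ τ : PlaneTree B (2 * t + 1), weight (edgeWeight L R y z 1) τ * (1 - unerased ε τ) =
      augF L R ε (t + 1) y z := by
  have step : ∀ t, ∑ τ : PlaneTree B (2 * t), weight (edgeWeight L R y z 0) τ * unerased ε τ =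
        augG L R ε (t + 1) y z →
      ∑ τ : PlaneTree B (2 * t + 1), weight (edgeWeight L R y z 1) τ * (1 - unerased ε τ) =
        augF L R ε (t + 1) y z := by
    intro t ih
    have hodd : ¬ Even (2 * t + 1) := by simp
    have h2 : edgeWeight L R y z (1 + 1) = edgeWeight L R y z 0 := by
      funext d n
      simp [edgeWeight, Nat.even_add]
    simp only [mul_sub, mul_one, Finset.sum_sub_distrib]
    rw [(sum_weight y z hL hR t).2, augF, augf, augg, Nat.add_sub_cancel]
    congr 1
    trans ∑ τ : PlaneTree B (2 * t + 1), edgeWeight L R y z 1 0 τ.1 *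
      ∏ k, (weight (edgeWeight L R y z 0) (τ.2 k) * unerased ε (τ.2 k))
    · refine Finset.sum_congr rfl fun ⟨n, ch⟩ _ => ?_
      simp only [weight, unerased, if_neg hodd, edgeWeight_succ, h2, Finset.prod_mul_distrib,
        mul_assoc]
    · rw [sum_succ (F := edgeWeight L R y z 1 0)
        (p := fun σ => weight (edgeWeight L R y z 0) σ * unerased ε σ), ih,
        augEdge_eq_sum_range R _ _ hR]
      simp [edgeWeight, augG]
  suffices h : ∑ τ : PlaneTree B (2 * t), weight (edgeWeight L R y z 0) τ * unerased ε τ =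
    augG L R ε (t + 1) y z from ⟨h, step t h⟩
  induction t with
  | zero =>
    rw [augG, augEdge_eq_sum_range L _ _ hL, augEdge_eq_sum_range L _ _ hL, Finset.mul_sum,
      ← Finset.sum_sub_distrib, ← Fin.sum_univ_eq_sum_range (fun n => edgeFrac L (n + 1)
      * y (n + 1) * augf L R (0 + 1 - 1) y z ^ n - ε * (edgeFrac L (n + 1)
      * y (n + 1) * augF L R ε (0 + 1 - 1) y z ^ n))]
    refine Fintype.sum_congr _ _ fun n : Fin B => ?_
    simp [weight, edgeWeight, augf, augF, unerased]
    ring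
  | succ t ih =>
    have heven : Even (2 * t + 1 + 1) := ⟨t + 1, by ring⟩
    have hW : ∑ τ : PlaneTree B (2 * t + 1 + 1), weight (edgeWeight L R y z 0) τ =
      augg L R (t + 1 + 1) y z := (sum_weight y z hL hR (t + 1)).1
    change ∑ τ : PlaneTree B (2 * t + 1 + 1), weight (edgeWeight L R y z 0) τ * unerased ε τ = _
    trans ∑ τ : PlaneTree B (2 * t + 1 + 1), (weight (edgeWeight L R y z 0) τ -
      ε * (edgeWeight L R y z 0 0 τ.1 *
      ∏ k, (weight (edgeWeight L R y z 1) (τ.2 k) * (1 - unerased ε (τ.2 k)))))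
    · refine Fintype.sum_congr _ _ fun ⟨n, ch⟩ => ?_
      simp only [weight, unerased, edgeWeight_succ, Finset.prod_mul_distrib, if_pos heven]
      ring
    · rw [Finset.sum_sub_distrib, hW, ← Finset.mul_sum]
      have := sum_succ (B := B) (h := 2 * t + 1) (F := edgeWeight L R y z 0 0)
        (p := fun σ => weight (edgeWeight L R y z 1) σ * (1 - unerased ε σ))
      rw [step t ih] at this
      refine (congrArg (fun x => _ - ε * x) this).trans ?_
      rw [augG, augg, Nat.add_sub_cancel, augEdge_eq_sum_range L y (augF L R ε (t + 1) y z) hL]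
      simp [edgeWeight]

end PlaneTree

/-! ### Plane trees in the tree ensemble -/

lemma treeProb_def (L R : ℝ[X]) (G : RootedGraph) [DecidableEq G.V] :
    treeProb L R G = L.coeff (G.graph.degV G.root) *
      (∏ v ∈ Finset.univ.erase G.root, edgeFrac L (G.graph.degV v)) *
      ∏ c, edgeFrac R (G.graph.degC c) := by
  rw [treeProb]
  convert rfl

namespace PlaneTree

variable {B : ℕ} {L R : ℝ[X]} (y z : ℕ → ℝ)

lemma rootWeight_succ : (fun d => rootWeight L R y z (d + 1)) = edgeWeight L R y z 1 := rfl

lemma sum_rootWeight (hL : L.natDegree < B) (hR : R.natDegree < B) (t : ℕ) :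
    ∑ τ : PlaneTree B (2 * t), weight (rootWeight L R y z) τ = augNode L y (augf L R t y z) := by
  cases t with
  | zero =>
    rw [augNode_eq_sum_range L _ _ hL, ← Fin.sum_univ_eq_sum_range (fun i => L.coeff i * y i *
      augf L R 0 y z ^ i)]
    refine Fintype.sum_congr _ _ fun n : Fin B => ?_
    simp [weight, rootWeight, augf]
  | succ t =>
    refine (sum_succ (h := 2 * t + 1) (F := rootWeight L R y z 0)
      (p := weight fun d => rootWeight L R y z (d + 1))).trans ?_
    rw [rootWeight_succ, (sum_weight y z hL.le hR.le t).2, augNode_eq_sum_range L _ _ hL]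
    rfl

/-- The root of a tree is erased iff the channel erases it and so are all messages of its
children. -/
lemma sum_rootWeight_mul_erased (hL : L.natDegree < B) (hR : R.natDegree < B) (ε : ℝ) (t : ℕ) :
    ∑ τ : PlaneTree B (2 * t), weight (rootWeight L R y z) τ * (1 - unerased ε τ) =
      ε * augNode L y (augF L R ε t y z) := by
  cases t with
  | zero =>
    rw [augNode_eq_sum_range L _ _ hL, ← Fin.sum_univ_eq_sum_range (fun i => L.coeff i * y i *
      augF L R ε 0 y z ^ i), Finset.mul_sum]
    refine Fintype.sum_congr _ _ fun n : Fin B => ?_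
    simp [weight, rootWeight, augF, unerased]
    ring
  | succ t =>
    have heven : Even (2 * t + 1 + 1) := ⟨t + 1, by ring⟩
    change ∑ τ : PlaneTree B (2 * t + 1 + 1), weight (rootWeight L R y z) τ * (1 - unerased ε τ) = _
    trans ∑ τ : PlaneTree B (2 * t + 1 + 1), ε * (rootWeight L R y z 0 τ.1 *
      ∏ k, (weight (edgeWeight L R y z 1) (τ.2 k) * (1 - unerased ε (τ.2 k))))
    · refine Fintype.sum_congr _ _ fun ⟨n, ch⟩ => ?_
      simp only [weight, unerased, rootWeight_succ, Finset.prod_mul_distrib, if_pos heven]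
      ring
    · rw [← Finset.mul_sum]
      have := sum_succ (B := B) (h := 2 * t + 1) (F := rootWeight L R y z 0)
        (p := fun σ => weight (edgeWeight L R y z 1) σ * (1 - unerased ε σ))
      rw [(sum_weight_mul_unerased y z hL.le hR.le ε t).2] at this
      refine (congrArg (fun x => ε * x) this).trans ?_
      rw [augNode_eq_sum_range L y _ hL]
      rfl

/-- The weight of a tree is its probability in the tree ensemble times the monomial that records the
degrees of its nodes. -/
lemma treeProb_rooted_mul {h : ℕ} (τ : PlaneTree B h) :
    treeProb L R τ.rooted * ((∏ v, y (τ.rooted.graph.degV v)) *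
      ∏ c, z (τ.rooted.graph.degC c)) = weight (rootWeight L R y z) τ := by
  classical
  have hV : (∏ v : VarNode τ, if v.1 = [] then L.coeff (τ.graph.degV v) * y (τ.graph.degV v) else
      edgeFrac L (τ.graph.degV v) * y (τ.graph.degV v)) =
      (L.coeff (τ.graph.degV τ.treeRoot) * ∏ v ∈ Finset.univ.erase τ.treeRoot,
        edgeFrac L (τ.graph.degV v)) * ∏ v, y (τ.graph.degV v) := by
    rw [← Finset.mul_prod_erase Finset.univ _ (Finset.mem_univ τ.treeRoot),
      ← Finset.mul_prod_erase Finset.univ (fun v => y (τ.graph.degV v))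
        (Finset.mem_univ τ.treeRoot),
      if_pos (show τ.treeRoot.1 = [] from rfl)]
    have h0 (v : VarNode τ) (hv : v ∈ Finset.univ.erase τ.treeRoot) : ¬ v.1 = [] := fun hv' =>
      Finset.ne_of_mem_erase hv (Subtype.ext hv')
    rw [Finset.prod_congr rfl fun v hv => if_neg (h0 v hv), Finset.prod_mul_distrib]
    ring
  have hC : (∏ c : CheckNode τ, edgeFrac R (τ.graph.degC c) * z (τ.graph.degC c)) =
      (∏ c, edgeFrac R (τ.graph.degC c)) * ∏ c, z (τ.graph.degC c) := Finset.prod_mul_distrib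
  have hT : treeProb L R τ.rooted = L.coeff (τ.graph.degV τ.treeRoot) *
      (∏ v ∈ Finset.univ.erase τ.treeRoot, edgeFrac L (τ.graph.degV v)) *
      ∏ c, edgeFrac R (τ.graph.degC c) := by
    let inst : DecidableEq τ.rooted.V := inferInstanceAs (DecidableEq (VarNode τ))
    exact treeProb_def L R τ.rooted
  have hV' : (∏ v : VarNode τ, if v.1 = [] then L.coeff (τ.graph.degV v) * y (τ.graph.degV v) else
      edgeFrac L (τ.graph.degV v) * y (τ.graph.degV v)) =
      ∏ a ∈ (nodes τ).filter (Even ·.length), rootWeight L R y z a.length (kids τ a) := by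
    rw [← Finset.prod_coe_sort _ fun a => rootWeight L R y z a.length (kids τ a)]
    refine Fintype.prod_congr _ _ fun v => ?_
    have hd : τ.graph.degV v = kids τ v.1 + parentSockets v.1 := rfl
    rcases hv : v.1 with _ | ⟨k, a⟩
    · simp [hd, hv, rootWeight]
    · have he := v.even
      rw [hv, List.length_cons] at he
      simp [hd, hv, rootWeight, edgeWeight, he, parentSockets]
  have hC' : (∏ c : CheckNode τ, edgeFrac R (τ.graph.degC c) * z (τ.graph.degC c)) =
      ∏ a ∈ (nodes τ).filter (¬ Even ·.length), rootWeight L R y z a.length (kids τ a) := by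
    rw [← Finset.prod_coe_sort _ fun a => rootWeight L R y z a.length (kids τ a)]
    refine Fintype.prod_congr _ _ fun c => ?_
    have hd : τ.graph.degC c = kids τ c.1 + 1 := rfl
    rcases hc : c.1 with _ | ⟨k, a⟩
    · exact absurd hc c.ne_nil
    · have he := c.odd
      rw [hc, List.length_cons] at he
      simp only [hd, hc, List.length_cons, rootWeight, edgeWeight, if_neg he]
  rw [← prod_nodes, ← Finset.prod_filter_mul_prod_filter_not _ (fun a : List ℕ => Even a.length),
    ← hV', ← hC', hV, hC, hT]
  change _ * ((∏ v : VarNode τ, y (τ.graph.degV v)) * ∏ c : CheckNode τ, z (τ.graph.degC c)) = _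
  ring

lemma treeProb_rooted {h : ℕ} (τ : PlaneTree B h) :
    treeProb L R τ.rooted = weight (rootWeight L R (fun _ => 1) (fun _ => 1)) τ := by
  rw [← treeProb_rooted_mul]
  simp

lemma kids_nil_pos {h : ℕ} (hL : L.coeff 0 = 0) {τ : PlaneTree B h}
    (hτ : treeProb L R τ.rooted ≠ 0) : 0 < kids τ [] := by
  refine Nat.pos_of_ne_zero fun h0 => hτ ?_
  have : τ.rooted.graph.degV τ.rooted.root = kids τ [] + 0 := rfl
  rw [treeProb, this, h0, hL, zero_mul, zero_mul]

end PlaneTree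

/-! ### Embeddings of neighborhood graphs -/

/-- An embedding of a rooted graph into a socket graph: an injective map of the nodes that respects
the degrees and the edges and that moves the sockets of every node by a cyclic shift, which is
trivial at the root. -/
structure IsEmbedding {V C : Type} (G : RootedGraph) (H : SocketGraph V C)
    (φ : G.V → V) (ψ : G.C → C) (k : G.V → ℕ) (l : G.C → ℕ) : Prop where
  injective_V : Function.Injective φ
  injective_C : Function.Injective ψ
  degV : ∀ v, H.degV (φ v) = G.graph.degV v
  degC : ∀ c, H.degC (ψ c) = G.graph.degC c
  shift_root : k G.root = 0
  map_edge : ∀ {v i c j}, G.graph.Edge v i c j →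
    H.Edge (φ v) ((i + k v) % G.graph.degV v) (ψ c) ((j + l c) % G.graph.degC c)

namespace LDPC.SocketGraph

variable {V C V' C' : Type} {T : SocketGraph V C} {H : SocketGraph V' C'} {v₀ : V} {t : ℕ}

lemma mem_nearV_self (r : ℕ) : v₀ ∈ T.nearV v₀ r := T.nearV_mono v₀ (Nat.zero_le r) rfl

lemma mem_nearV_of_mem_nearC {c : C} {w : V} {i j : ℕ} (hc : c ∈ T.nearC v₀ t)
    (e : T.Edge w i c j) : w ∈ T.nearV v₀ t := by
  obtain ⟨r, hr, v, hv, i', j', e'⟩ := hc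
  exact T.nearV_mono v₀ hr (T.mem_nearV_succ hv e' e)

variable [Fintype V] [Fintype C]

/-- An embedding is onto the nodes near the image of the root: in a Tanner graph, all sockets of the
nodes at distance less than `t` from `v₀` are connected inside the neighborhood graph. -/
lemma _root_.IsEmbedding.mem_nearV {φ ψ k l} (h : IsEmbedding (T.nbhd v₀ t) H φ ψ k l)
    (hT : T.IsTanner) {r : ℕ} (hr : r ≤ t) (v' : V') :
    v' ∈ H.nearV (φ (T.nbhd v₀ t).root) r ↔
      ∃ v : (T.nbhd v₀ t).V, v.1 ∈ T.nearV v₀ r ∧ φ v = v' := by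
  induction r generalizing v' with
  | zero =>
    constructor
    · rintro rfl
      exact ⟨_, mem_nearV_self 0, rfl⟩
    · rintro ⟨v, hv, rfl⟩
      exact congrArg φ (Subtype.ext hv)
  | succ r ih =>
    replace ih := ih (by omega)
    constructor
    · rintro (hv' | ⟨w', hw', c', ⟨i', j', e⟩, i'', j'', e'⟩)
      · obtain ⟨v, hv, rfl⟩ := (ih v').1 hv'
        exact ⟨v, T.nearV_mono v₀ (Nat.le_succ r) hv, rfl⟩
      · obtain ⟨w, hw, rfl⟩ := (ih w').1 hw'
        have h1 := H.lt_degV e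
        rw [h.degV] at h1
        obtain ⟨i, hi, rfl⟩ := exists_add_mod_eq (k w) h1
        obtain ⟨c, j, e₁⟩ := hT.2.2.1 w.1 i hi
        have hc : c ∈ T.nearC v₀ t := T.mem_nearC_of_edge hw (by omega) e₁
        obtain ⟨rfl, rfl⟩ := H.unique_right e (h.map_edge (c := ⟨c, hc⟩) e₁)
        have h2 := (H.lt_degC e').trans_eq (h.degC ⟨c, hc⟩)
        obtain ⟨j₂, hj₂, rfl⟩ := exists_add_mod_eq (l ⟨c, hc⟩) h2
        obtain ⟨v, i₂, e₂⟩ := hT.2.2.2 c j₂ hj₂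
        have hv := T.mem_nearV_succ hw e₁ e₂
        have hv' := T.nearV_mono v₀ hr hv
        obtain ⟨rfl, rfl⟩ := H.unique_left e' (h.map_edge (v := ⟨v, hv'⟩) (c := ⟨c, hc⟩) e₂)
        exact ⟨⟨v, hv'⟩, hv, rfl⟩
    · rintro ⟨v, hv | ⟨w, hw, c, ⟨i, j, e⟩, i', j', e'⟩, rfl⟩
      · exact H.nearV_mono _ (Nat.le_succ r) ((ih _).2 ⟨v, hv, rfl⟩)
      · have hw' := T.nearV_mono v₀ (by omega : r ≤ t) hw
        have hc : c ∈ T.nearC v₀ t := T.mem_nearC_of_edge hw (by omega) e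
        exact H.mem_nearV_succ ((ih _).2 ⟨⟨w, hw'⟩, hw, rfl⟩)
          (h.map_edge (v := ⟨w, hw'⟩) (c := ⟨c, hc⟩) e) (h.map_edge (v := v) (c := ⟨c, hc⟩) e')

lemma _root_.IsEmbedding.mem_nearC {φ ψ k l} (h : IsEmbedding (T.nbhd v₀ t) H φ ψ k l)
    (hT : T.IsTanner) (c' : C') :
    c' ∈ H.nearC (φ (T.nbhd v₀ t).root) t ↔ ∃ c, ψ c = c' := by
  constructor
  · rintro ⟨r, hr, w', hw', i', j', e⟩
    obtain ⟨w, hw, rfl⟩ := (h.mem_nearV hT hr.le w').1 hw'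
    have h1 := H.lt_degV e
    rw [h.degV] at h1
    obtain ⟨i, hi, rfl⟩ := exists_add_mod_eq (k w) h1
    obtain ⟨c, j, e₁⟩ := hT.2.2.1 w.1 i hi
    have hc : c ∈ T.nearC v₀ t := T.mem_nearC_of_edge hw hr e₁
    obtain ⟨rfl, rfl⟩ := H.unique_right e (h.map_edge (c := ⟨c, hc⟩) e₁)
    exact ⟨_, rfl⟩
  · rintro ⟨⟨c, hc⟩, rfl⟩
    obtain ⟨r, hr, w, hw, i, j, e⟩ := id hc
    have hw' := T.nearV_mono v₀ hr.le hw
    exact H.mem_nearC_of_edge ((h.mem_nearV hT hr.le _).2 ⟨⟨w, hw'⟩, hw, rfl⟩) hr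
      (h.map_edge (v := ⟨w, hw'⟩) (c := ⟨c, hc⟩) e)

/-- The image of an embedded neighborhood graph is the neighborhood graph of the image of the root,
since no socket of the inner nodes is left open. -/
lemma _root_.IsEmbedding.equivalent [Fintype V'] [Fintype C'] {φ ψ k l}
    (h : IsEmbedding (T.nbhd v₀ t) H φ ψ k l) (hT : T.IsTanner) :
    RootedGraph.Equivalent (T.nbhd v₀ t) (H.nbhd (φ (T.nbhd v₀ t).root) t) := by
  have hV : ∀ v, φ v ∈ H.nearV (φ (T.nbhd v₀ t).root) t := fun v =>
    (h.mem_nearV hT le_rfl _).2 ⟨v, v.2, rfl⟩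
  have hC : ∀ c, ψ c ∈ H.nearC (φ (T.nbhd v₀ t).root) t := fun c => (h.mem_nearC hT _).2 ⟨c, rfl⟩
  refine ⟨Equiv.ofBijective (β := {v // v ∈ H.nearV (φ (T.nbhd v₀ t).root) t})
      (fun v => ⟨φ v, hV v⟩)
      ⟨fun v w hvw => h.injective_V (congrArg Subtype.val hvw), fun v' => ?_⟩,
    Equiv.ofBijective (β := {c // c ∈ H.nearC (φ (T.nbhd v₀ t).root) t})
      (fun c => ⟨ψ c, hC c⟩)
      ⟨fun v w hvw => h.injective_C (congrArg Subtype.val hvw), fun c' => ?_⟩,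
    k, l, rfl, h.shift_root, h.degV, h.degC, fun v c i j hi hj => ⟨fun e => h.map_edge e,
      fun e => ?_⟩⟩
  · obtain ⟨v, -, hv⟩ := (h.mem_nearV hT le_rfl _).1 v'.2
    exact ⟨v, Subtype.ext hv⟩
  · obtain ⟨c, hc⟩ := (h.mem_nearC hT _).1 c'.2
    exact ⟨c, Subtype.ext hc⟩
  · replace e : H.Edge (φ v) ((i + k v) % (T.nbhd v₀ t).graph.degV v) (ψ c)
      ((j + l c) % (T.nbhd v₀ t).graph.degC c) := e
    obtain ⟨w, i₂, e₂⟩ := hT.2.2.2 c.1 j hj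
    have hw := mem_nearV_of_mem_nearC c.2 e₂
    obtain ⟨h1, h2⟩ := H.unique_left e (h.map_edge (v := ⟨w, hw⟩) (c := c) e₂)
    obtain rfl := h.injective_V h1
    rwa [add_mod_inj hi (T.lt_degV e₂) h2]

/-- An embedding is determined by the image of the root: no socket is shifted there, and the
connections of the sockets determine the images and the shifts of the other nodes one by one. -/
lemma _root_.IsEmbedding.unique {φ φ' ψ ψ' k k' l l'}
    (h : IsEmbedding (T.nbhd v₀ t) H φ ψ k l) (h' : IsEmbedding (T.nbhd v₀ t) H φ' ψ' k' l')
    (hr : φ (T.nbhd v₀ t).root = φ' (T.nbhd v₀ t).root)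
    (hk : ∀ v, k v < (T.nbhd v₀ t).graph.degV v) (hk' : ∀ v, k' v < (T.nbhd v₀ t).graph.degV v)
    (hl : ∀ c, l c < (T.nbhd v₀ t).graph.degC c) (hl' : ∀ c, l' c < (T.nbhd v₀ t).graph.degC c) :
    φ = φ' ∧ ψ = ψ' ∧ k = k' ∧ l = l' := by
  have hC : ∀ (w : (T.nbhd v₀ t).V) i c j, (T.nbhd v₀ t).graph.Edge w i c j → φ w = φ' w →
      k w = k' w → ψ c = ψ' c ∧ l c = l' c := by
    intro w i c j e h1 h2
    have e₁ := h.map_edge e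
    rw [h1, h2] at e₁
    obtain ⟨h3, h4⟩ := H.unique_right e₁ (h'.map_edge e)
    rw [add_comm j, add_comm j] at h4
    exact ⟨h3, add_mod_inj (hl c) (hl' c) h4⟩
  have hV : ∀ r ≤ t, ∀ v : (T.nbhd v₀ t).V, v.1 ∈ T.nearV v₀ r → φ v = φ' v ∧ k v = k' v := by
    intro r
    induction r with
    | zero =>
      intro _ v hv
      obtain rfl : v = (T.nbhd v₀ t).root := Subtype.ext hv
      exact ⟨hr, h.shift_root.trans h'.shift_root.symm⟩
    | succ r ih =>
      rintro hrt v (hv | ⟨w, hw, c, ⟨i, j, e⟩, i', j', e'⟩)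
      · exact ih (by omega) v hv
      · have hw' := T.nearV_mono v₀ (by omega : r ≤ t) hw
        have hc : c ∈ T.nearC v₀ t := T.mem_nearC_of_edge hw (by omega) e
        obtain ⟨h1, h2⟩ := ih (by omega) ⟨w, hw'⟩ hw
        obtain ⟨h3, h4⟩ := hC ⟨w, hw'⟩ i ⟨c, hc⟩ j e h1 h2
        have e₁ := h.map_edge (v := v) (c := ⟨c, hc⟩) e'
        rw [h3, h4] at e₁
        obtain ⟨h5, h6⟩ := H.unique_left e₁ (h'.map_edge (v := v) (c := ⟨c, hc⟩) e')
        rw [add_comm i', add_comm i'] at h6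
        exact ⟨h5, add_mod_inj (hk v) (hk' v) h6⟩
  have hC' : ∀ c, ψ c = ψ' c ∧ l c = l' c := by
    rintro ⟨c, hc⟩
    obtain ⟨r, hr, w, hw, i, j, e⟩ := id hc
    have hw' := T.nearV_mono v₀ hr.le hw
    obtain ⟨h1, h2⟩ := hV r hr.le ⟨w, hw'⟩ hw
    exact hC ⟨w, hw'⟩ i ⟨c, hc⟩ j e h1 h2
  exact ⟨funext fun v => (hV t le_rfl v v.2).1, funext fun c => (hC' c).1,
    funext fun v => (hV t le_rfl v v.2).2, funext fun c => (hC' c).2⟩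

end LDPC.SocketGraph

/-- An equivalence with a neighborhood graph is an embedding, whose shifts can be reduced. -/
lemma LDPC.RootedGraph.Equivalent.exists_isEmbedding {V C : Type} [Fintype V] [Fintype C]
    {G : RootedGraph} {H : SocketGraph V C} {v₀ : V} {t : ℕ}
    (h : RootedGraph.Equivalent G (H.nbhd v₀ t)) (hV : ∀ v, 0 < G.graph.degV v)
    (hC : ∀ c, 0 < G.graph.degC c) :
    ∃ φ ψ k l, IsEmbedding G H φ ψ k l ∧ φ G.root = v₀ ∧ (∀ v, k v < G.graph.degV v) ∧
      ∀ c, l c < G.graph.degC c := by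
  obtain ⟨φ, ψ, k, l, hr, hk, hdV, hdC, hE⟩ := h
  refine ⟨fun v => (φ v).1, fun c => (ψ c).1, fun v => k v % G.graph.degV v,
    fun c => l c % G.graph.degC c, ⟨Subtype.val_injective.comp φ.injective,
      Subtype.val_injective.comp ψ.injective, hdV, hdC, by simp [hk], fun {v i c j} e => ?_⟩,
    congrArg Subtype.val hr, fun v => Nat.mod_lt _ (hV v), fun c => Nat.mod_lt _ (hC c)⟩
  simp only [Nat.add_mod_mod]
  exact (hE v c i j (G.graph.lt_degV e) (G.graph.lt_degC e)).1 e

/-! ### Counting wirings -/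

/-- The number of bijections with prescribed values at some points. -/
lemma card_equiv_extending {α X Y : Type*} [Fintype α] [Fintype X] [Fintype Y]
    (hXY : Fintype.card X = Fintype.card Y) (s : α ↪ X) (u : α ↪ Y) :
    Nat.card {π : X ≃ Y // ∀ a, π (s a) = u a} = (Fintype.card X - Fintype.card α).factorial := by
  classical
  let e₀ : Set.range s ≃ Set.range u :=
    (Equiv.ofInjective s s.injective).symm.trans (Equiv.ofInjective u u.injective)
  have h0 : ∀ a, (e₀ ⟨s a, a, rfl⟩ : Y) = u a := fun a => by
    have : (Equiv.ofInjective s s.injective).symm ⟨s a, a, rfl⟩ = a :=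
      Equiv.ofInjective_symm_apply s.injective a
    simp [e₀, this]
  have e₁ : {π : X ≃ Y // ∀ a, π (s a) = u a} ≃ {π : X ≃ Y // ∀ x : Set.range s, π x = e₀ x} :=
    Equiv.subtypeEquivRight fun π => ⟨by
      rintro hπ ⟨_, a, rfl⟩
      rw [h0, hπ], fun hπ a => by rw [← h0]; exact hπ ⟨s a, a, rfl⟩⟩
  have hs : Fintype.card ((Set.range s)ᶜ : Set X) = Fintype.card X - Fintype.card α := by
    rw [Fintype.card_compl_set, Set.card_range_of_injective s.injective]
  have hu : Fintype.card ((Set.range u)ᶜ : Set Y) = Fintype.card X - Fintype.card α := by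
    rw [Fintype.card_compl_set, Set.card_range_of_injective u.injective, hXY]
  rw [Nat.card_congr (e₁.trans (Equiv.Set.compl e₀)), Nat.card_eq_fintype_card,
    Fintype.card_equiv (Fintype.equivOfCardEq (hs.trans hu.symm)), hs]

/-- The map into a disjoint union given by its restrictions to the fibers of `d`. -/
def sigmaMap {A I : Type*} {N : I → ℕ} (d : A → I) (f : ∀ i, {a // d a = i} ↪ Fin (N i)) (a : A) :
    (i : I) × Fin (N i) :=
  ⟨d a, f (d a) ⟨a, rfl⟩⟩

section SigmaMap

variable {A I : Type*} {N : I → ℕ} {d : A → I}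

lemma sigmaMap_eq (f : ∀ i, {a // d a = i} ↪ Fin (N i)) {a : A} {i : I} (h : d a = i) :
    sigmaMap d f a = ⟨i, f i ⟨a, h⟩⟩ := by
  subst h
  rfl

lemma sigmaMap_injective (f : ∀ i, {a // d a = i} ↪ Fin (N i)) :
    Function.Injective (sigmaMap d f) := by
  intro a b h
  have h1 : d a = d b := congrArg Sigma.fst h
  rw [sigmaMap_eq f h1, sigmaMap_eq f rfl] at h
  simpa using h

lemma sigmaMap_left_injective : Function.Injective (sigmaMap (N := N) d) := by
  intro f g h
  funext i
  ext ⟨a, ha⟩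
  have := congrFun h a
  rw [sigmaMap_eq f ha, sigmaMap_eq g ha] at this
  simpa using congrArg (fun x => (x.2 : ℕ)) this

lemma exists_sigmaMap_eq {φ : A → (i : I) × Fin (N i)} (hφ : Function.Injective φ)
    (h : ∀ a, (φ a).1 = d a) : ∃ f, sigmaMap d f = φ := by
  refine ⟨fun i => ⟨fun a => Fin.cast (by rw [h, a.2]) (φ a.1).2, fun a b hab => ?_⟩, ?_⟩
  · refine Subtype.ext (hφ (Sigma.ext (by rw [h, h, a.2, b.2]) ?_))
    rw [Fin.heq_ext_iff (by rw [h, h, a.2, b.2])]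
    simpa [Fin.ext_iff] using hab
  · funext a
    refine Sigma.ext (h a).symm ?_
    rw [Fin.heq_ext_iff (by rw [h]; rfl)]
    rfl

end SigmaMap

/-! ### Counting the embeddings into the ensemble -/

/-- The choices which determine an embedding of the graph `G` into a graph of the ensemble: an
injection of the nodes of each degree, and shifts of the sockets of all nodes except for the root.
Here `dV` and `dC` are the degrees. -/
abbrev EmbeddingData (L R : ℝ[X]) (n : ℕ) (G : RootedGraph) (dV : G.V → {i // i ∈ L.support})
    (dC : G.C → {j // j ∈ R.support}) : Type :=
  (∀ i, {v // dV v = i} ↪ Fin ⌊n * L.coeff i⌋₊) ×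
  (∀ j, {c // dC c = j} ↪ Fin ⌊numChecks L R n * R.coeff j⌋₊) ×
  (∀ v : {v // v ≠ G.root}, Fin (dV v)) × (∀ c, Fin (dC c))

namespace EmbeddingData

variable {L R : ℝ[X]} {n : ℕ} {G : RootedGraph} {dV : G.V → {i // i ∈ L.support}}
  {dC : G.C → {j // j ∈ R.support}} (d : EmbeddingData L R n G dV dC)

/-- The map of the variable nodes. -/
noncomputable def mapV : G.V → VNode L n := sigmaMap dV d.1

/-- The map of the check nodes. -/
noncomputable def mapC : G.C → CNode L R n := sigmaMap dC d.2.1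

open Classical in
/-- The shifts of the sockets of the variable nodes. -/
noncomputable def shiftV (v : G.V) : ℕ := if h : v = G.root then 0 else d.2.2.1 ⟨v, h⟩

/-- The shifts of the sockets of the check nodes. -/
def shiftC (c : G.C) : ℕ := d.2.2.2 c

lemma shiftV_lt (h0 : ∀ v, 0 < (dV v).1) (v : G.V) : d.shiftV v < dV v := by
  unfold shiftV
  split_ifs
  · exact h0 v
  · exact (d.2.2.1 ⟨v, _⟩).2

lemma shiftC_lt (c : G.C) : d.shiftC c < dC c := (d.2.2.2 c).2

lemma eq_of_maps {d d' : EmbeddingData L R n G dV dC} (h1 : d.mapV = d'.mapV)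
    (h2 : d.mapC = d'.mapC) (h3 : d.shiftV = d'.shiftV) (h4 : d.shiftC = d'.shiftC) : d = d' := by
  refine Prod.ext (sigmaMap_left_injective h1) (Prod.ext (sigmaMap_left_injective h2)
    (Prod.ext (funext fun v => Fin.ext ?_) (funext fun c => Fin.ext (congrFun h4 c))))
  have := congrFun h3 v.1
  simpa [shiftV, v.2] using this

lemma exists_of_maps {φ : G.V → VNode L n} {ψ : G.C → CNode L R n}
    {k : G.V → ℕ} {l : G.C → ℕ} (hφ : Function.Injective φ) (hψ : Function.Injective ψ)
    (hφd : ∀ v, (φ v).1 = dV v) (hψd : ∀ c, (ψ c).1 = dC c) (hk : ∀ v, k v < dV v)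
    (hl : ∀ c, l c < dC c) (hr : k G.root = 0) :
    ∃ d : EmbeddingData L R n G dV dC, d.mapV = φ ∧ d.mapC = ψ ∧ d.shiftV = k ∧ d.shiftC = l := by
  obtain ⟨f, rfl⟩ := exists_sigmaMap_eq
    (N := fun i : {i // i ∈ L.support} => ⌊n * L.coeff i⌋₊) hφ hφd
  obtain ⟨g, rfl⟩ := exists_sigmaMap_eq
    (N := fun j : {j // j ∈ R.support} => ⌊numChecks L R n * R.coeff j⌋₊) hψ hψd
  refine ⟨⟨f, g, fun v => ⟨k v, hk v⟩, fun c => ⟨l c, hl c⟩⟩, rfl, rfl, funext fun v => ?_, rfl⟩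
  by_cases h : v = G.root
  · simp [shiftV, h, hr]
  · simp [shiftV, h]

variable (hdV : ∀ v, (dV v).1 = G.graph.degV v) (hdC : ∀ c, (dC c).1 = G.graph.degC c)

/-- The variable-node socket of the image of an edge. -/
noncomputable def socketV (e : G.edgeSet) : VSocket L n :=
  ⟨d.mapV e.1.1, ⟨(e.1.2.1 + d.shiftV e.1.1) % G.graph.degV e.1.1, by
    change _ < (dV e.1.1).1
    rw [hdV]
    exact Nat.mod_lt _ ((Nat.zero_le _).trans_lt (G.graph.lt_degV e.2))⟩⟩

/-- The check-node socket of the image of an edge. -/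
noncomputable def socketC (e : G.edgeSet) : CSocket L R n :=
  ⟨d.mapC e.1.2.2.1, ⟨(e.1.2.2.2 + d.shiftC e.1.2.2.1) % G.graph.degC e.1.2.2.1, by
    change _ < (dC e.1.2.2.1).1
    rw [hdC]
    exact Nat.mod_lt _ ((Nat.zero_le _).trans_lt (G.graph.lt_degC e.2))⟩⟩

lemma socketV_injective : Function.Injective (d.socketV hdV) := by
  rintro ⟨⟨v, i, c, j⟩, e⟩ ⟨⟨v', i', c', j'⟩, e'⟩ h
  obtain ⟨h1, h2⟩ := Sigma.mk.inj_iff.1 h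
  obtain rfl : v = v' := sigmaMap_injective _ h1
  have h3 := add_mod_inj (G.graph.lt_degV e) (G.graph.lt_degV e') (Fin.val_eq_of_eq (eq_of_heq h2))
  dsimp only at h3
  subst h3
  obtain ⟨rfl, rfl⟩ := G.graph.unique_right e e'
  rfl

lemma socketC_injective : Function.Injective (d.socketC hdC) := by
  rintro ⟨⟨v, i, c, j⟩, e⟩ ⟨⟨v', i', c', j'⟩, e'⟩ h
  obtain ⟨h1, h2⟩ := Sigma.mk.inj_iff.1 h
  obtain rfl : c = c' := sigmaMap_injective _ h1
  have h3 := add_mod_inj (G.graph.lt_degC e) (G.graph.lt_degC e') (Fin.val_eq_of_eq (eq_of_heq h2))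
  dsimp only at h3
  subst h3
  obtain ⟨rfl, rfl⟩ := G.graph.unique_left e e'
  rfl

include hdV hdC in
lemma isEmbedding {π : Wiring L R n} (hπ : ∀ e, π (d.socketV hdV e) = d.socketC hdC e) :
    IsEmbedding G (tanner π) d.mapV d.mapC d.shiftV d.shiftC where
  injective_V := sigmaMap_injective _
  injective_C := sigmaMap_injective _
  degV := hdV
  degC := hdC
  shift_root := by simp [shiftV]
  map_edge {v i c j} e := ⟨(d.socketV hdV ⟨(v, i, c, j), e⟩).2.2,
    (d.socketC hdC ⟨(v, i, c, j), e⟩).2.2, hπ ⟨(v, i, c, j), e⟩⟩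

end EmbeddingData

section Count

variable {L R : ℝ[X]} {n t : ℕ} {V C : Type} [Fintype V] [Fintype C] {T : SocketGraph V C} {v₀ : V}
  {dV : (T.nbhd v₀ t).V → {i // i ∈ L.support}} {dC : (T.nbhd v₀ t).C → {j // j ∈ R.support}}

/-- A wiring with a node whose neighborhood graph is equivalent to a given one amounts to an
embedding of the latter together with a wiring that contains the image of its edges. -/
lemma card_nbhd_eq (hT : T.IsTanner) (hdV : ∀ v, (dV v).1 = (T.nbhd v₀ t).graph.degV v)
    (hdC : ∀ c, (dC c).1 = (T.nbhd v₀ t).graph.degC c)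
    (hE : Fintype.card (VSocket L n) = Fintype.card (CSocket L R n)) :
    Nat.card {x : Wiring L R n × VNode L n //
      (⟦(tanner x.1).nbhd x.2 t⟧ : GraphClass) = ⟦T.nbhd v₀ t⟧} =
    Nat.card (EmbeddingData L R n (T.nbhd v₀ t) dV dC) *
      (Fintype.card (VSocket L n) - (T.nbhd v₀ t).numEdges).factorial := by
  classical
  have hV0 : ∀ v, 0 < (T.nbhd v₀ t).graph.degV v := fun v => hT.1 v.1
  have hC0 : ∀ c, 0 < (T.nbhd v₀ t).graph.degC c := fun c => hT.2.1 c.1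
  have hd0 : ∀ v, 0 < (dV v).1 := fun v => (hV0 v).trans_eq (hdV v).symm
  let F : {x : EmbeddingData L R n (T.nbhd v₀ t) dV dC × Wiring L R n //
      ∀ e, x.2 (x.1.socketV hdV e) = x.1.socketC hdC e} →
      {x : Wiring L R n × VNode L n //
        (⟦(tanner x.1).nbhd x.2 t⟧ : GraphClass) = ⟦(T.nbhd v₀ t)⟧} :=
    fun x => ⟨(x.1.2, x.1.1.mapV (T.nbhd v₀ t).root),
      Quotient.sound (Setoid.symm ((x.1.1.isEmbedding hdV hdC x.2).equivalent hT))⟩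
  have hF : Function.Bijective F := by
    constructor
    · rintro ⟨⟨d, π⟩, hπ⟩ ⟨⟨d', π'⟩, hπ'⟩ h
      obtain ⟨h1, h2⟩ := Prod.mk.inj (Subtype.ext_iff.1 h)
      change π = π' at h1
      subst h1
      obtain ⟨h3, h4, h5, h6⟩ := (d.isEmbedding hdV hdC hπ).unique (d'.isEmbedding hdV hdC hπ') h2
        (fun v => (d.shiftV_lt hd0 v).trans_eq (hdV v))
        (fun v => (d'.shiftV_lt hd0 v).trans_eq (hdV v))
        (fun c => (d.shiftC_lt c).trans_eq (hdC c)) (fun c => (d'.shiftC_lt c).trans_eq (hdC c))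
      obtain rfl := EmbeddingData.eq_of_maps h3 h4 h5 h6
      rfl
    · rintro ⟨⟨π, v⟩, h⟩
      obtain ⟨φ, ψ, k, l, hemb, rfl, hk, hl⟩ :=
        RootedGraph.Equivalent.exists_isEmbedding (Quotient.exact h.symm) hV0 hC0
      obtain ⟨d, rfl, rfl, rfl, rfl⟩ := EmbeddingData.exists_of_maps (n := n)
        hemb.injective_V hemb.injective_C
        (fun v => Subtype.ext ((hemb.degV v).trans (hdV v).symm))
        (fun c => Subtype.ext ((hemb.degC c).trans (hdC c).symm))
        (fun v => (hk v).trans_eq (hdV v).symm) (fun c => (hl c).trans_eq (hdC c).symm)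
        hemb.shift_root
      refine ⟨⟨(d, π), ?_⟩, rfl⟩
      rintro ⟨⟨v, i, c, j⟩, e⟩
      obtain ⟨_, _, h'⟩ := hemb.map_edge e
      exact h'
  rw [← Nat.card_congr (Equiv.ofBijective F hF), Nat.card_congr (Equiv.subtypeProdEquivSigmaSubtype
    fun (d : EmbeddingData L R n (T.nbhd v₀ t) dV dC) (π : Wiring L R n) =>
      ∀ e, π (d.socketV hdV e) = d.socketC hdC e), Nat.card_sigma]
  have : Fintype (T.nbhd v₀ t).edgeSet := (T.nbhd v₀ t).edgeSet_finite.fintype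
  have hK : Fintype.card (T.nbhd v₀ t).edgeSet = (T.nbhd v₀ t).numEdges := by
    rw [← Nat.card_eq_fintype_card]
    rfl
  have hcount : ∀ d : EmbeddingData L R n (T.nbhd v₀ t) dV dC,
      Nat.card {π : Wiring L R n // ∀ e, π (d.socketV hdV e) = d.socketC hdC e} =
        (Fintype.card (VSocket L n) - (T.nbhd v₀ t).numEdges).factorial := fun d => by
    rw [← hK]
    exact card_equiv_extending hE ⟨_, d.socketV_injective hdV⟩ ⟨_, d.socketC_injective hdC⟩
  rw [Finset.sum_congr rfl fun d _ => hcount d, Finset.sum_const, Finset.card_univ,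
    Nat.card_eq_fintype_card, smul_eq_mul]

open Classical in
lemma card_embeddingData (G : RootedGraph) (dV : G.V → {i // i ∈ L.support})
    (dC : G.C → {j // j ∈ R.support}) (hdV : ∀ v, (dV v).1 = G.graph.degV v)
    (hdC : ∀ c, (dC c).1 = G.graph.degC c) :
    Nat.card (EmbeddingData L R n G dV dC) =
      (∏ i ∈ L.support, ⌊n * L.coeff i⌋₊.descFactorial (G.numV i)) *
      ((∏ j ∈ R.support, ⌊numChecks L R n * R.coeff j⌋₊.descFactorial (G.numC j)) *
      ((∏ v ∈ Finset.univ.erase G.root, G.graph.degV v) * ∏ c, G.graph.degC c)) := by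
  rw [Nat.card_eq_fintype_card, Fintype.card_prod, Fintype.card_prod, Fintype.card_prod,
    Fintype.card_pi, Fintype.card_pi, Fintype.card_pi, Fintype.card_pi]
  simp only [Fintype.card_embedding_eq, Fintype.card_fin, hdV, hdC]
  congr 1
  · rw [← Finset.prod_coe_sort L.support]
    refine Fintype.prod_congr _ _ fun i => ?_
    rw [RootedGraph.numV, ← Nat.card_eq_fintype_card, ← Nat.card_coe_set_eq]
    simp only [Subtype.ext_iff, hdV]
    rfl
  congr 1
  · rw [← Finset.prod_coe_sort R.support]
    refine Fintype.prod_congr _ _ fun j => ?_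
    rw [RootedGraph.numC, ← Nat.card_eq_fintype_card, ← Nat.card_coe_set_eq]
    simp only [Subtype.ext_iff, hdC]
    rfl
  congr 1
  rw [Finset.prod_subtype (Finset.univ.erase G.root) (p := (· ≠ G.root)) (by simp)]

end Count

/-! ### Ratios of falling factorials -/

/-- The ratio of the falling factorial of order `K` of `1 / (a * x)` and the `K`-th power of the
same number, as a polynomial in `x`. -/
noncomputable def fallingRatio (K : ℕ) (a x : ℝ) : ℝ := ∏ s ∈ Finset.range K, (1 - s * a * x)

lemma fallingRatio_zero (K : ℕ) (a : ℝ) : fallingRatio K a 0 = 1 := by simp [fallingRatio]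

lemma hasDerivAt_fallingRatio (K : ℕ) (a : ℝ) :
    HasDerivAt (fallingRatio K a) (-(K * (K - 1) / 2 * a)) 0 := by
  induction K with
  | zero =>
    have : fallingRatio 0 a = fun _ => 1 := by funext x; simp [fallingRatio]
    rw [this]
    simpa using hasDerivAt_const (0 : ℝ) (1 : ℝ)
  | succ K ih =>
    have h1 : fallingRatio (K + 1) a = fun x => fallingRatio K a x * (1 - K * a * x) := by
      funext x
      rw [fallingRatio, Finset.prod_range_succ]
      rfl
    have h2 : HasDerivAt (fun x : ℝ => 1 - K * a * x) (-(K * a * 1)) 0 :=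
      ((hasDerivAt_id (0 : ℝ)).const_mul (K * a)).const_sub 1
    rw [h1]
    refine (ih.mul h2).congr_deriv ?_
    rw [fallingRatio_zero]
    push_cast
    ring

lemma cast_descFactorial_eq {N K : ℕ} {a x : ℝ} (hx : (N : ℝ) * (a * x) = 1) :
    (N.descFactorial K : ℝ) = N ^ K * fallingRatio K a x := by
  rw [← descPochhammer_eval_eq_descFactorial, descPochhammer_eval_eq_prod_range, fallingRatio,
    ← Finset.card_range K, ← Finset.prod_const, Finset.card_range, ← Finset.prod_mul_distrib]
  refine Finset.prod_congr rfl fun s _ => ?_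
  rw [mul_sub, mul_one, show (N : ℝ) * (s * a * x) = s * (N * (a * x)) by ring, hx, mul_one]

lemma hasDerivAt_prod_one {ι : Type*} (s : Finset ι) {f : ι → ℝ → ℝ} {f' : ι → ℝ} {x : ℝ}
    (hf : ∀ i ∈ s, HasDerivAt (f i) (f' i) x) (h1 : ∀ i ∈ s, f i x = 1) :
    HasDerivAt (fun x => ∏ i ∈ s, f i x) (∑ i ∈ s, f' i) x := by
  classical
  refine (HasDerivAt.fun_finsetProd hf).congr_deriv (Finset.sum_congr rfl fun i hi => ?_)
  rw [Finset.prod_congr rfl fun j hj => h1 j (Finset.mem_of_mem_erase hj)]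
  simp

/-! ### The size of the ensemble -/

section Ensemble

variable {L R : ℝ[X]} {n : ℕ}

lemma LDPC.Admissible.floor_V (h : Admissible L R n) (i : ℕ) :
    ((⌊n * L.coeff i⌋₊ : ℕ) : ℝ) = n * L.coeff i := by
  obtain ⟨a, ha⟩ := h.1 i
  rw [ha, Nat.floor_natCast]

lemma LDPC.Admissible.floor_C (h : Admissible L R n) (j : ℕ) :
    ((⌊numChecks L R n * R.coeff j⌋₊ : ℕ) : ℝ) = numChecks L R n * R.coeff j := by
  obtain ⟨a, ha⟩ := h.2 j
  rw [ha, Nat.floor_natCast]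

lemma card_VNode (hL : IsDegreeDistribution L) (h : Admissible L R n) :
    Fintype.card (VNode L n) = n := by
  have : (Fintype.card (VNode L n) : ℝ) = n := by
    rw [Fintype.card_sigma]
    push_cast
    simp only [Fintype.card_fin, h.floor_V]
    rw [Finset.sum_coe_sort L.support (fun i => n * L.coeff i), ← Finset.mul_sum, hL.sum_coeff,
      mul_one]
  exact_mod_cast this

lemma card_VSocket (h : Admissible L R n) :
    (Fintype.card (VSocket L n) : ℝ) = n * evalD 1 L 1 := by
  rw [Fintype.card_sigma, Fintype.sum_sigma]
  simp only [Fintype.card_fin, Finset.sum_const, Finset.card_univ, smul_eq_mul]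
  push_cast
  simp only [h.floor_V]
  rw [Finset.sum_coe_sort L.support (fun i => n * L.coeff i * i), evalD_one_one, Finset.mul_sum]
  exact Finset.sum_congr rfl fun i _ => by ring

lemma card_CSocket (hR : IsDegreeDistribution R) (h : Admissible L R n) :
    (Fintype.card (CSocket L R n) : ℝ) = n * evalD 1 L 1 := by
  rw [Fintype.card_sigma, Fintype.sum_sigma]
  simp only [Fintype.card_fin, Finset.sum_const, Finset.card_univ, smul_eq_mul]
  push_cast
  simp only [h.floor_C]
  rw [Finset.sum_coe_sort R.support (fun i => numChecks L R n * R.coeff i * i)]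
  have h1 : ∑ i ∈ R.support, numChecks L R n * R.coeff i * i =
      numChecks L R n * evalD 1 R 1 := by
    rw [evalD_one_one, Finset.mul_sum]
    exact Finset.sum_congr rfl fun i _ => by ring
  rw [h1, numChecks, div_mul_cancel₀ _ hR.evalD_one_pos.ne']

lemma card_VSocket_eq_card_CSocket (hR : IsDegreeDistribution R) (h : Admissible L R n) :
    Fintype.card (VSocket L n) = Fintype.card (CSocket L R n) := by
  exact_mod_cast (card_VSocket h).trans (card_CSocket hR h).symm

lemma card_wiring (hR : IsDegreeDistribution R) (h : Admissible L R n) :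
    Nat.card (Wiring L R n) = (Fintype.card (VSocket L n)).factorial := by
  classical
  rw [Nat.card_eq_fintype_card,
    Fintype.card_equiv (Fintype.equivOfCardEq (card_VSocket_eq_card_CSocket hR h))]

lemma eventually_admissible (L R : ℝ[X]) :
    ∀ᶠ n in blocklengths L R, Admissible L R n :=
  Filter.mem_inf_of_right (Filter.mem_principal_self _)

lemma blocklengths_le (L R : ℝ[X]) : blocklengths L R ≤ atTop := inf_le_left

/-- All multiples of an admissible blocklength are admissible. -/
lemma blocklengths_neBot (h : ∃ n, 0 < n ∧ Admissible L R n) : (blocklengths L R).NeBot := by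
  obtain ⟨n, hn, h1, h2⟩ := h
  rw [blocklengths, Filter.inf_principal_neBot_iff]
  intro U hU
  obtain ⟨N, hN⟩ := Filter.mem_atTop_sets.1 hU
  refine ⟨N * n, hN _ (Nat.le_mul_of_pos_right N hn), fun i => ?_, fun j => ?_⟩
  · obtain ⟨a, ha⟩ := h1 i
    exact ⟨N * a, by push_cast; rw [← ha]; ring⟩
  · obtain ⟨b, hb⟩ := h2 j
    exact ⟨N * b, by push_cast; rw [← hb]; simp only [numChecks]; push_cast; ring⟩

end Ensemble

/-! ### The probability of a cycle-free neighborhood graph -/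

section NbhdProb

variable {L R : ℝ[X]} {n t : ℕ}

/-- The ratio of the probability of a cycle-free neighborhood graph in the ensemble to its
probability in the tree ensemble, as a function of the inverse blocklength `x`: there are
`L_i / x` variable nodes of degree `i`, `L'(1) R_j / (R'(1) x)` check nodes of degree `j` and
`L'(1) / x` edges, and all of these are drawn without replacement. -/
noncomputable def samplingRatio (L R : ℝ[X]) (G : RootedGraph) (x : ℝ) : ℝ :=
  (∏ i ∈ L.support, fallingRatio (G.numV i) (1 / L.coeff i) x) *
    (∏ j ∈ R.support, fallingRatio (G.numC j) (evalD 1 R 1 / (evalD 1 L 1 * R.coeff j)) x) /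
    fallingRatio G.numEdges (1 / evalD 1 L 1) x

/-- The first-order coefficient of `samplingRatio`. -/
noncomputable def samplingCoeff (L R : ℝ[X]) (G : RootedGraph) : ℝ :=
  1 / (2 * evalD 1 L 1) * ((G.numEdges : ℝ) * (G.numEdges - 1)
    - ∑ i ∈ L.support, i / edgeFrac L i * ((G.numV i : ℝ) * (G.numV i - 1))
    - ∑ j ∈ R.support, j / edgeFrac R j * ((G.numC j : ℝ) * (G.numC j - 1)))

lemma samplingRatio_zero (G : RootedGraph) : samplingRatio L R G 0 = 1 := by
  simp [samplingRatio, fallingRatio_zero]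

lemma hasDerivAt_samplingRatio (hL : IsDegreeDistribution L) (hR : IsDegreeDistribution R)
    (G : RootedGraph) : HasDerivAt (samplingRatio L R G) (samplingCoeff L R G) 0 := by
  have h1 := hasDerivAt_prod_one L.support
    (fun i _ => hasDerivAt_fallingRatio (G.numV i) (1 / L.coeff i))
    (fun i _ => fallingRatio_zero _ _)
  have h2 := hasDerivAt_prod_one R.support
    (fun j _ => hasDerivAt_fallingRatio (G.numC j) (evalD 1 R 1 / (evalD 1 L 1 * R.coeff j)))
    (fun i _ => fallingRatio_zero _ _)
  have h3 := hasDerivAt_fallingRatio G.numEdges (1 / evalD 1 L 1)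
  refine ((h1.mul h2).div h3 (by rw [fallingRatio_zero]; exact one_ne_zero)).congr_deriv ?_
  have hL1 := hL.evalD_one_pos.ne'
  have hR1 := hR.evalD_one_pos.ne'
  have e1 : ∑ i ∈ L.support, (i : ℝ) / edgeFrac L i * ((G.numV i : ℝ) * (G.numV i - 1)) =
      - (2 * evalD 1 L 1) *
        ∑ i ∈ L.support, -((G.numV i : ℝ) * (G.numV i - 1) / 2 * (1 / L.coeff i)) := by
    rw [Finset.mul_sum]
    refine Finset.sum_congr rfl fun i hi => ?_
    have hi1 := (hL.coeff_pos hi).ne'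
    have hi2 : (i : ℝ) ≠ 0 := by exact_mod_cast (hL.pos_of_mem_support hi).ne'
    rw [edgeFrac]
    field_simp
  have e2 : ∑ j ∈ R.support, (j : ℝ) / edgeFrac R j * ((G.numC j : ℝ) * (G.numC j - 1)) =
      - (2 * evalD 1 L 1) * ∑ j ∈ R.support, -((G.numC j : ℝ) * (G.numC j - 1) / 2 *
        (evalD 1 R 1 / (evalD 1 L 1 * R.coeff j))) := by
    rw [Finset.mul_sum]
    refine Finset.sum_congr rfl fun i hi => ?_
    have hi1 := (hR.coeff_pos hi).ne'
    have hi2 : (i : ℝ) ≠ 0 := by exact_mod_cast (hR.pos_of_mem_support hi).ne'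
    rw [edgeFrac]
    field_simp
  rw [samplingCoeff, e1, e2]
  simp only [Pi.mul_apply, fallingRatio_zero, Finset.prod_const_one]
  generalize ∑ i ∈ L.support, -((G.numV i : ℝ) * (G.numV i - 1) / 2 * (1 / L.coeff i)) = A
  generalize ∑ j ∈ R.support, -((G.numC j : ℝ) * (G.numC j - 1) / 2 *
    (evalD 1 R 1 / (evalD 1 L 1 * R.coeff j))) = A'
  field_simp
  ring

lemma prod_pow_ncard {A : Type*} [Fintype A] (s : Finset ℕ) (d : A → ℕ) (hd : ∀ a, d a ∈ s)
    (f : ℕ → ℝ) : ∏ i ∈ s, f i ^ {a | d a = i}.ncard = ∏ a, f (d a) := by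
  classical
  rw [← Finset.prod_fiberwise_of_maps_to (g := d) (t := s) fun a _ => hd a]
  refine Finset.prod_congr rfl fun i _ => ?_
  rw [Finset.prod_congr rfl fun a ha => by rw [(Finset.mem_filter.1 ha).2], Finset.prod_const,
    ← Set.ncard_coe_finset]
  congr 2
  ext a
  simp

variable {V C : Type} [Fintype V] [Fintype C] {T : SocketGraph V C} {v₀ : V}

/-- The probability of a cycle-free neighborhood graph at blocklength `n`. Cycle-freeness enters in
that the powers of `n` in the number of embeddings and in the number of wirings match. -/
lemma nbhdProb_eq (hL : IsDegreeDistribution L) (hR : IsDegreeDistribution R) (hT : T.IsTanner)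
    (hcf : (T.nbhd v₀ t).CycleFree) (hdV : ∀ v, (T.nbhd v₀ t).graph.degV v ∈ L.support)
    (hdC : ∀ c, (T.nbhd v₀ t).graph.degC c ∈ R.support) (hn : 0 < n) (h : Admissible L R n)
    (hK : (T.nbhd v₀ t).numEdges ≤ Fintype.card (VSocket L n)) :
    nbhdProb L R t n ⟦T.nbhd v₀ t⟧ =
      treeProb L R (T.nbhd v₀ t) * samplingRatio L R (T.nbhd v₀ t) (n : ℝ)⁻¹ := by
  classical
  have hn' : (n : ℝ) ≠ 0 := by exact_mod_cast hn.ne'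
  have hL1 := hL.evalD_one_pos.ne'
  have hR1 := hR.evalD_one_pos.ne'
  rw [nbhdProb, card_nbhd_eq (dV := fun v => ⟨_, hdV v⟩) (dC := fun c => ⟨_, hdC c⟩) hT
    (fun _ => rfl) (fun _ => rfl) (card_VSocket_eq_card_CSocket hR h), card_embeddingData _ _ _
    (fun _ => rfl) (fun _ => rfl), card_wiring hR h, Nat.card_eq_fintype_card, card_VNode hL h]
  generalize hG : T.nbhd v₀ t = G at *
  have hfac := Nat.factorial_mul_descFactorial hK
  have hdesc : ((Fintype.card (VSocket L n)).descFactorial G.numEdges : ℝ) =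
      (n * evalD 1 L 1) ^ G.numEdges * fallingRatio G.numEdges (1 / evalD 1 L 1) (n : ℝ)⁻¹ := by
    rw [cast_descFactorial_eq (a := 1 / evalD 1 L 1) (x := (n : ℝ)⁻¹), card_VSocket h]
    rw [card_VSocket h]
    field_simp
  have hV : ((∏ i ∈ L.support, ⌊n * L.coeff i⌋₊.descFactorial (G.numV i) : ℕ) : ℝ) =
      (∏ v, (n * L.coeff (G.graph.degV v))) *
        ∏ i ∈ L.support, fallingRatio (G.numV i) (1 / L.coeff i) (n : ℝ)⁻¹ := by
    rw [← prod_pow_ncard L.support G.graph.degV hdV (fun i => n * L.coeff i),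
      ← Finset.prod_mul_distrib]
    push_cast
    refine Finset.prod_congr rfl fun i hi => ?_
    have hi1 := (hL.coeff_pos hi).ne'
    rw [cast_descFactorial_eq (a := 1 / L.coeff i) (x := (n : ℝ)⁻¹), h.floor_V]
    · rfl
    · rw [h.floor_V]
      field_simp
  have hC : ((∏ j ∈ R.support, ⌊numChecks L R n * R.coeff j⌋₊.descFactorial (G.numC j) : ℕ) : ℝ) =
      (∏ c, (numChecks L R n * R.coeff (G.graph.degC c))) *
        ∏ j ∈ R.support, fallingRatio (G.numC j) (evalD 1 R 1 / (evalD 1 L 1 * R.coeff j))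
          (n : ℝ)⁻¹ := by
    rw [← prod_pow_ncard R.support G.graph.degC hdC (fun j => numChecks L R n * R.coeff j),
      ← Finset.prod_mul_distrib]
    push_cast
    refine Finset.prod_congr rfl fun j hj => ?_
    have hj1 := (hR.coeff_pos hj).ne'
    rw [cast_descFactorial_eq (a := evalD 1 R 1 / (evalD 1 L 1 * R.coeff j)) (x := (n : ℝ)⁻¹),
      h.floor_C]
    · rfl
    · rw [h.floor_C, numChecks]
      field_simp
  have hpow : (n * evalD 1 L 1) ^ G.numEdges =
      (∏ _v ∈ Finset.univ.erase G.root, (n * evalD 1 L 1)) * ∏ _c : G.C, (n * evalD 1 L 1) := by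
    rw [Finset.prod_const, Finset.prod_const, ← pow_add, Finset.card_erase_of_mem
      (Finset.mem_univ _), Finset.card_univ, Finset.card_univ]
    congr 1
    have : G.numEdges + 1 = Fintype.card G.V + Fintype.card G.C := hcf
    have : 0 < Fintype.card G.V := Fintype.card_pos_iff.2 ⟨G.root⟩
    omega
  have htree : treeProb L R G * ((n * evalD 1 L 1) ^ G.numEdges * n) =
      (∏ v, (n * L.coeff (G.graph.degV v))) * ((∏ c, (numChecks L R n * R.coeff (G.graph.degC c))) *
        ((∏ v ∈ Finset.univ.erase G.root, (G.graph.degV v : ℝ)) *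
          ∏ c, (G.graph.degC c : ℝ))) := by
    have h1 : (∏ v ∈ Finset.univ.erase G.root, edgeFrac L (G.graph.degV v)) *
        ∏ _v ∈ Finset.univ.erase G.root, (n * evalD 1 L 1) =
        (∏ v ∈ Finset.univ.erase G.root, n * L.coeff (G.graph.degV v)) *
          ∏ v ∈ Finset.univ.erase G.root, (G.graph.degV v : ℝ) := by
      rw [← Finset.prod_mul_distrib, ← Finset.prod_mul_distrib]
      exact Finset.prod_congr rfl fun v _ => by rw [edgeFrac]; field_simp
    have h2 : (∏ c, edgeFrac R (G.graph.degC c)) * ∏ _c : G.C, (n * evalD 1 L 1) =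
        (∏ c, numChecks L R n * R.coeff (G.graph.degC c)) * ∏ c, (G.graph.degC c : ℝ) := by
      rw [← Finset.prod_mul_distrib, ← Finset.prod_mul_distrib]
      exact Finset.prod_congr rfl fun v _ => by rw [edgeFrac, numChecks]; field_simp
    rw [hpow, treeProb_def, ← Finset.mul_prod_erase Finset.univ _ (Finset.mem_univ G.root)]
    calc _ = n * L.coeff (G.graph.degV G.root) * ((∏ v ∈ Finset.univ.erase G.root,
          edgeFrac L (G.graph.degV v)) * ∏ _v ∈ Finset.univ.erase G.root, (n * evalD 1 L 1)) *
          ((∏ c, edgeFrac R (G.graph.degC c)) * ∏ _c : G.C, (n * evalD 1 L 1)) := by ring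
      _ = _ := by rw [h1, h2]; ring
  have hdesc0 : ((Fintype.card (VSocket L n)).descFactorial G.numEdges : ℝ) ≠ 0 := by
    exact_mod_cast (Nat.descFactorial_pos.2 hK).ne'
  rw [hdesc] at hdesc0
  have hfr := right_ne_zero_of_mul hdesc0
  have hpw := left_ne_zero_of_mul hdesc0
  have hf0 : (((Fintype.card (VSocket L n) - G.numEdges).factorial : ℕ) : ℝ) ≠ 0 := by
    exact_mod_cast (Nat.factorial_pos _).ne'
  rw [← hfac]
  push_cast at hV hC ⊢
  rw [hV, hC, hdesc, samplingRatio, div_eq_iff (by positivity), mul_div_assoc', div_mul_eq_mul_div,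
    eq_div_iff hfr]
  linear_combination (norm := ring_nf) -(((Fintype.card (VSocket L n) - G.numEdges).factorial : ℝ) *
    (∏ i ∈ L.support, fallingRatio (G.numV i) (1 / L.coeff i) (n : ℝ)⁻¹) *
    (∏ j ∈ R.support, fallingRatio (G.numC j) (evalD 1 R 1 / (evalD 1 L 1 * R.coeff j)) (n : ℝ)⁻¹) *
    fallingRatio G.numEdges (1 / evalD 1 L 1) (n : ℝ)⁻¹) * htree

end NbhdProb

/-! ### The tree ensemble as the limit of the neighborhood graphs -/

lemma edgeFrac_ne_zero_iff {p : ℝ[X]} (hp : IsDegreeDistribution p) {i : ℕ} :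
    edgeFrac p i ≠ 0 ↔ i ∈ p.support := by
  rw [edgeFrac, mem_support_iff]
  constructor
  · intro h h'
    simp [h'] at h
  · intro h
    have := (hp.pos_of_mem_support (mem_support_iff.2 h)).ne'
    have := hp.evalD_one_pos.ne'
    positivity

lemma edgeFrac_nonneg {p : ℝ[X]} (hp : IsDegreeDistribution p) (i : ℕ) : 0 ≤ edgeFrac p i :=
  div_nonneg (mul_nonneg (Nat.cast_nonneg _) (hp.nonneg i)) hp.evalD_one_pos.le

section

variable {L R : ℝ[X]} (hL : IsDegreeDistribution L) (hR : IsDegreeDistribution R)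
include hL hR

lemma treeProb_nonneg (G : RootedGraph) : 0 ≤ treeProb L R G :=
  mul_nonneg (mul_nonneg (hL.nonneg _) (Finset.prod_nonneg fun _ _ => edgeFrac_nonneg hL _))
    (Finset.prod_nonneg fun _ _ => edgeFrac_nonneg hR _)

lemma treeProb_ne_zero_iff (G : RootedGraph) : treeProb L R G ≠ 0 ↔
    (∀ v, G.graph.degV v ∈ L.support) ∧ ∀ c, G.graph.degC c ∈ R.support := by
  classical
  rw [treeProb_def, mul_ne_zero_iff, mul_ne_zero_iff, Finset.prod_ne_zero_iff,
    Finset.prod_ne_zero_iff]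
  simp only [edgeFrac_ne_zero_iff hL, edgeFrac_ne_zero_iff hR, Finset.mem_univ, true_imp_iff,
    ← mem_support_iff]
  refine and_congr_left fun _ => ⟨fun h v => ?_, fun h => ⟨h _, fun v _ => h v⟩⟩
  by_cases hv : v = G.root
  · rw [hv]
    exact h.1
  · exact h.2 v (by simp [hv])

/-- A class of probability zero in the tree ensemble has a node of a degree that does not occur. -/
lemma nbhdProb_eq_zero {t n : ℕ} {G : RootedGraph} (h : treeProb L R G = 0) :
    nbhdProb L R t n ⟦G⟧ = 0 := by
  by_contra h0
  have h1 : Nat.card {x : Wiring L R n × VNode L n //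
      (⟦(tanner x.1).nbhd x.2 t⟧ : GraphClass) = ⟦G⟧} ≠ 0 := fun h' => h0 (by simp [nbhdProb, h'])
  obtain ⟨⟨⟨π, v⟩, hx⟩, -⟩ := Nat.card_ne_zero.1 h1
  refine (treeProb_ne_zero_iff hL hR ((tanner π).nbhd v t)).2
    ⟨fun v => v.1.1.2, fun c => c.1.1.2⟩ ?_
  rw [RootedGraph.treeProb_eq (Quotient.exact hx), h]

lemma tendsto_nbhdProb_aux {t : ℕ} {V C : Type} [Fintype V] [Fintype C] {T : SocketGraph V C}
    {v₀ : V} (hT : T.IsTanner) (hcf : (T.nbhd v₀ t).CycleFree) :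
    Tendsto (fun n : ℕ => (n : ℝ) * (nbhdProb L R t n ⟦T.nbhd v₀ t⟧ - treeProb L R (T.nbhd v₀ t)))
      (blocklengths L R) (𝓝 (treeProb L R (T.nbhd v₀ t) * samplingCoeff L R (T.nbhd v₀ t))) := by
  set G := T.nbhd v₀ t
  by_cases h0 : treeProb L R G = 0
  · simp only [nbhdProb_eq_zero hL hR h0, h0, sub_zero, mul_zero, zero_mul]
    exact tendsto_const_nhds
  obtain ⟨hdV, hdC⟩ := (treeProb_ne_zero_iff hL hR G).1 h0
  have hslope := (hasDerivAt_samplingRatio hL hR G).tendsto_slope_zero_right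
  have hinv : Tendsto (fun n : ℕ => (n : ℝ)⁻¹) atTop (𝓝[>] 0) :=
    tendsto_inv_atTop_nhdsGT_zero.comp tendsto_natCast_atTop_atTop
  have h1 := ((hslope.comp hinv).const_mul (treeProb L R G)).mono_left (blocklengths_le L R)
  refine h1.congr' ?_
  have hsize : ∀ᶠ n : ℕ in atTop, (G.numEdges : ℝ) ≤ n * evalD 1 L 1 :=
    (tendsto_natCast_atTop_atTop.atTop_mul_const hL.evalD_one_pos).eventually_ge_atTop _
  filter_upwards [eventually_admissible L R, (blocklengths_le L R) hsize,
    (blocklengths_le L R) (eventually_gt_atTop 0)] with n hn hK hpos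
  have hK' : G.numEdges ≤ Fintype.card (VSocket L n) := by
    have : (G.numEdges : ℝ) ≤ Fintype.card (VSocket L n) := by rwa [card_VSocket hn]
    exact_mod_cast this
  rw [nbhdProb_eq hL hR hT hcf hdV hdC hpos hn hK']
  simp only [Function.comp, zero_add, inv_inv, samplingRatio_zero, smul_eq_mul]
  ring

lemma tendsto_nbhdProb_sub {t : ℕ} {q : GraphClass} (hq : q ∈ cycleFreeClasses t) :
    Tendsto (fun n : ℕ => (n : ℝ) * (nbhdProb L R t n q - treeProb L R q.out))
      (blocklengths L R) (𝓝 (treeProb L R q.out * samplingCoeff L R q.out)) := by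
  obtain ⟨V, C, _, _, T, v₀, hT, hcf, rfl⟩ := hq
  have h := Quotient.mk_out (s := RootedGraph.setoid) (T.nbhd v₀ t)
  have := tendsto_nbhdProb_aux hL hR hT hcf
  rw [samplingCoeff] at this ⊢
  simp only [RootedGraph.treeProb_eq h, RootedGraph.numEdges_eq h, RootedGraph.numV_eq h,
    RootedGraph.numC_eq h]
  exact this

lemma tendsto_nbhdProb {t : ℕ} {q : GraphClass} (hq : q ∈ cycleFreeClasses t) :
    Tendsto (fun n : ℕ => nbhdProb L R t n q) (blocklengths L R) (𝓝 (treeProb L R q.out)) := by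
  have h1 := (tendsto_inv_atTop_zero.comp (tendsto_natCast_atTop_atTop (R := ℝ))).mono_left
    (blocklengths_le L R)
  have h2 := (h1.mul (tendsto_nbhdProb_sub hL hR hq)).add_const (treeProb L R q.out)
  rw [zero_mul, zero_add] at h2
  refine h2.congr' ?_
  filter_upwards [(blocklengths_le L R) (eventually_gt_atTop 0)] with n hn
  have : (n : ℝ) ≠ 0 := by exact_mod_cast hn.ne'
  simp only [Function.comp]
  field_simp
  ring

end

open Classical in
lemma nbhdProb_eq_sum (L R : ℝ[X]) (t n : ℕ) (q : GraphClass) :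
    nbhdProb L R t n q = (∑ x : Wiring L R n × VNode L n,
      if (⟦(tanner x.1).nbhd x.2 t⟧ : GraphClass) = q then (1 : ℝ) else 0) /
        (Nat.card (Wiring L R n) * Nat.card (VNode L n)) := by
  rw [nbhdProb, Finset.sum_boole, Nat.card_eq_fintype_card, Fintype.card_subtype]

open Classical in
lemma sum_nbhdProb_mul (L R : ℝ[X]) (t n : ℕ) (s : Finset GraphClass) (X : GraphClass → ℝ) :
    ∑ q ∈ s, nbhdProb L R t n q * X q = (∑ x : Wiring L R n × VNode L n,
      if (⟦(tanner x.1).nbhd x.2 t⟧ : GraphClass) ∈ s then X ⟦(tanner x.1).nbhd x.2 t⟧ else 0) /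
        (Nat.card (Wiring L R n) * Nat.card (VNode L n)) := by
  simp only [nbhdProb_eq_sum, div_mul_eq_mul_div, ← Finset.sum_div, Finset.sum_mul]
  rw [Finset.sum_comm]
  congr 1
  refine Finset.sum_congr rfl fun x _ => ?_
  simp only [ite_mul, one_mul, zero_mul, Finset.sum_ite_eq]

lemma sum_nbhdProb_le_one (L R : ℝ[X]) (t n : ℕ) (s : Finset GraphClass) :
    ∑ q ∈ s, nbhdProb L R t n q ≤ 1 := by
  classical
  have h := sum_nbhdProb_mul L R t n s fun _ => 1
  simp only [mul_one] at h
  rw [h]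
  refine div_le_one_of_le₀ ?_ (by positivity)
  rw [Finset.sum_boole, ← Nat.cast_mul, ← Nat.card_prod, Nat.card_eq_fintype_card]
  exact_mod_cast Finset.card_filter_le _ _

/-- A strict bound for the numbers of children in the trees that occur in the tree ensemble. -/
noncomputable def degreeBound (L R : ℝ[X]) : ℕ := L.natDegree + R.natDegree + 1

lemma sum_treeProb_rooted {L R : ℝ[X]} (hL : IsDegreeDistribution L) (hR : IsDegreeDistribution R)
    (t : ℕ) : ∑ τ : PlaneTree (degreeBound L R) (2 * t), treeProb L R τ.rooted = 1 := by
  simp only [PlaneTree.treeProb_rooted]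
  rw [PlaneTree.sum_rootWeight _ _ (by unfold degreeBound; omega) (by unfold degreeBound; omega),
    augf_one hL hR, ← eval_eq_augNode, hL.sum_eq_one]

open Classical in
/-- The classes of the plane trees of positive probability. -/
noncomputable def treeClasses (L R : ℝ[X]) (t : ℕ) : Finset GraphClass :=
  (Finset.univ.filter fun τ : PlaneTree (degreeBound L R) (2 * t) =>
    treeProb L R τ.rooted ≠ 0).image fun τ => ⟦τ.rooted⟧

lemma sum_treeClasses (L R : ℝ[X]) (t : ℕ) (X : GraphClass → ℝ) :
    ∑ q ∈ treeClasses L R t, treeProb L R q.out * X q =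
      ∑ τ : PlaneTree (degreeBound L R) (2 * t), treeProb L R τ.rooted * X ⟦τ.rooted⟧ := by
  classical
  have h : ∀ G : RootedGraph, treeProb L R (⟦G⟧ : GraphClass).out = treeProb L R G := fun G =>
    RootedGraph.treeProb_eq (Quotient.mk_out (s := RootedGraph.setoid) G) L R
  rw [treeClasses, Finset.sum_image fun τ _ τ' _ hh =>
    PlaneTree.eq_of_equivalent (Quotient.exact hh)]
  simp only [h]
  refine Finset.sum_subset (Finset.filter_subset _ _) fun τ _ hτ => ?_
  have : treeProb L R τ.rooted = 0 := by simpa using hτ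
  rw [this, zero_mul]

lemma treeClasses_subset {L R : ℝ[X]} (hL : IsDegreeDistribution L) {t : ℕ}
    {q : GraphClass} (hq : q ∈ treeClasses L R t) :
    q ∈ cycleFreeClasses t ∧ treeProb L R q.out ≠ 0 := by
  classical
  obtain ⟨τ, hτ, rfl⟩ := Finset.mem_image.1 hq
  have hτ' := (Finset.mem_filter.1 hτ).2
  refine ⟨PlaneTree.rooted_mem_cycleFreeClasses τ (PlaneTree.kids_nil_pos hL.coeff_zero hτ'), ?_⟩
  rwa [RootedGraph.treeProb_eq (Quotient.mk_out (s := RootedGraph.setoid) τ.rooted)]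

section

variable {L R : ℝ[X]} (hL : IsDegreeDistribution L) (hR : IsDegreeDistribution R)
include hL hR

lemma sum_treeProb_treeClasses (t : ℕ) : ∑ q ∈ treeClasses L R t, treeProb L R q.out = 1 := by
  have := sum_treeClasses L R t fun _ => 1
  simp only [mul_one] at this
  rw [this, sum_treeProb_rooted hL hR]

/-- Every class of positive probability is that of a plane tree: the probabilities of the plane
trees add up to one already, and those of all classes are limits of probabilities in the ensemble,
so no room is left for another class. -/
lemma mem_treeClasses_iff (hLR : ∃ n, 0 < n ∧ Admissible L R n) {t : ℕ} {q : GraphClass} :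
    q ∈ treeClasses L R t ↔ q ∈ cycleFreeClasses t ∧ treeProb L R q.out ≠ 0 := by
  classical
  refine ⟨treeClasses_subset hL, fun ⟨hq, hq0⟩ => ?_⟩
  by_contra hmem
  have : (blocklengths L R).NeBot := blocklengths_neBot hLR
  have h1 : Tendsto (fun n => ∑ q ∈ insert q (treeClasses L R t), nbhdProb L R t n q)
      (blocklengths L R) (𝓝 (∑ q ∈ insert q (treeClasses L R t), treeProb L R q.out)) := by
    refine tendsto_finsetSum _ fun q' hq' => tendsto_nbhdProb hL hR ?_
    rcases Finset.mem_insert.1 hq' with rfl | h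
    · exact hq
    · exact (treeClasses_subset hL h).1
  have h2 := le_of_tendsto h1 (Filter.Eventually.of_forall fun n => sum_nbhdProb_le_one L R t n _)
  rw [Finset.sum_insert hmem, sum_treeProb_treeClasses hL hR] at h2
  exact hq0 ((treeProb_nonneg hL hR q.out).antisymm' (by linarith))

lemma treeExp_eq_sum (hLR : ∃ n, 0 < n ∧ Admissible L R n) (t : ℕ) (X : RootedGraph → ℝ) :
    treeExp L R t X = ∑ q ∈ treeClasses L R t, treeProb L R q.out * X q.out := by
  refine finsum_mem_eq_sum_of_inter_support_eq _ (Set.ext fun q => ?_)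
  simp only [Set.mem_inter_iff, Function.mem_support, Finset.mem_coe, mem_treeClasses_iff hL hR hLR]
  refine and_congr_left fun h => ⟨fun h' => ⟨h', left_ne_zero_of_mul h⟩, fun h' => h'.1⟩

/-- The expectation of an invariant of rooted graphs on the tree ensemble. -/
lemma treeExp_eq_sum_planeTree (hLR : ∃ n, 0 < n ∧ Admissible L R n) (t : ℕ)
    {X : RootedGraph → ℝ} (hX : ∀ G H, RootedGraph.Equivalent G H → X G = X H) :
    treeExp L R t X =
      ∑ τ : PlaneTree (degreeBound L R) (2 * t), treeProb L R τ.rooted * X τ.rooted := by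
  rw [treeExp_eq_sum hL hR hLR, sum_treeClasses L R t fun q => X q.out]
  exact Finset.sum_congr rfl fun τ _ => by
    rw [hX _ _ (Quotient.mk_out (s := RootedGraph.setoid) τ.rooted)]

lemma cycleFreePart_eq (hLR : ∃ n, 0 < n ∧ Admissible L R n) (ε : ℝ) (t n : ℕ) :
    cycleFreePart L R ε t n =
      ∑ q ∈ treeClasses L R t, nbhdProb L R t n q * q.out.rootErasure ε t := by
  refine finsum_mem_eq_sum_of_inter_support_eq _ (Set.ext fun q => ?_)
  simp only [Set.mem_inter_iff, Function.mem_support, Finset.mem_coe, mem_treeClasses_iff hL hR hLR]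
  refine and_congr_left fun h =>
    ⟨fun h' => ⟨h', fun h0 => left_ne_zero_of_mul h ?_⟩, fun h' => h'.1⟩
  rw [← Quotient.out_eq q]
  exact nbhdProb_eq_zero hL hR h0

lemma tendsto_cycleFreePart (hLR : ∃ n, 0 < n ∧ Admissible L R n) (ε : ℝ) (t : ℕ) :
    Tendsto (fun n : ℕ => (n : ℝ) * (cycleFreePart L R ε t n -
      treeExp L R t fun T => T.rootErasure ε t)) (blocklengths L R)
      (𝓝 (treeExp L R t fun T => samplingCoeff L R T * T.rootErasure ε t)) := by
  rw [treeExp_eq_sum hL hR hLR, treeExp_eq_sum hL hR hLR]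
  have h : Tendsto (fun n : ℕ => ∑ q ∈ treeClasses L R t,
      (n : ℝ) * (nbhdProb L R t n q - treeProb L R q.out) * q.out.rootErasure ε t)
      (blocklengths L R) (𝓝 (∑ q ∈ treeClasses L R t,
        treeProb L R q.out * samplingCoeff L R q.out * q.out.rootErasure ε t)) :=
    tendsto_finsetSum _ fun q hq =>
      (tendsto_nbhdProb_sub hL hR (treeClasses_subset hL hq).1).mul_const _
  simp only [cycleFreePart_eq hL hR hLR, ← Finset.sum_sub_distrib, Finset.mul_sum]
  refine (h.congr fun n => Finset.sum_congr rfl fun q _ => by ring).trans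
    (le_of_eq (congrArg _ (Finset.sum_congr rfl fun q _ => by ring)))

/-- Neighborhood graphs that are not among the finitely many trees of the tree ensemble have a
probability that tends to zero. -/
lemma tendsto_bitErrorProb (hLR : ∃ n, 0 < n ∧ Admissible L R n) {ε : ℝ} (hε0 : 0 ≤ ε) (hε1 : ε ≤ 1)
    (t : ℕ) : Tendsto (fun n => bitErrorProb L R ε t n) (blocklengths L R)
      (𝓝 (treeExp L R t fun T => T.rootErasure ε t)) := by
  classical
  set S := treeClasses L R t with hS
  have hsum : Tendsto (fun n => ∑ q ∈ S, nbhdProb L R t n q) (blocklengths L R) (𝓝 1) := by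
    rw [← sum_treeProb_treeClasses hL hR t]
    exact tendsto_finsetSum _ fun q hq => tendsto_nbhdProb hL hR (treeClasses_subset hL hq).1
  have hpart : Tendsto (fun n => ∑ q ∈ S, nbhdProb L R t n q * q.out.rootErasure ε t)
      (blocklengths L R) (𝓝 (treeExp L R t fun T => T.rootErasure ε t)) := by
    rw [treeExp_eq_sum hL hR hLR]
    exact tendsto_finsetSum _ fun q hq =>
      (tendsto_nbhdProb hL hR (treeClasses_subset hL hq).1).mul_const _
  -- the upper bound counts all other neighborhood graphs as errors
  have hup := hpart.add (hsum.const_sub 1)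
  rw [sub_self, add_zero] at hup
  have herase : ∀ n (x : Wiring L R n × VNode L n),
      (⟦(tanner x.1).nbhd x.2 t⟧ : GraphClass).out.rootErasure ε t =
        (tanner x.1).erasureProb ε t x.2 := fun n x => by
    rw [RootedGraph.rootErasure_eq (Quotient.mk_out (s := RootedGraph.setoid) _),
      SocketGraph.rootErasure_nbhd]
  have hbit : ∀ n, bitErrorProb L R ε t n = (∑ x : Wiring L R n × VNode L n,
      (tanner x.1).erasureProb ε t x.2) / (Nat.card (Wiring L R n) * Nat.card (VNode L n)) :=
    fun n => by
      rw [bitErrorProb, Fintype.sum_prod_type, Nat.card_eq_fintype_card, Nat.card_eq_fintype_card]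
  have hA : ∀ n, ∑ q ∈ S, nbhdProb L R t n q * q.out.rootErasure ε t =
      (∑ x : Wiring L R n × VNode L n, if (⟦(tanner x.1).nbhd x.2 t⟧ : GraphClass) ∈ S
        then (tanner x.1).erasureProb ε t x.2 else 0) /
          (Nat.card (Wiring L R n) * Nat.card (VNode L n)) := fun n => by
    rw [sum_nbhdProb_mul L R t n S fun q => q.out.rootErasure ε t]
    simp only [herase]
  have hB : ∀ n, ∑ q ∈ S, nbhdProb L R t n q =
      (∑ x : Wiring L R n × VNode L n, if (⟦(tanner x.1).nbhd x.2 t⟧ : GraphClass) ∈ S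
        then 1 else 0) / (Nat.card (Wiring L R n) * Nat.card (VNode L n)) := fun n => by
    have := sum_nbhdProb_mul L R t n S fun _ => 1
    simpa only [mul_one] using this
  refine tendsto_of_tendsto_of_tendsto_of_le_of_le' hpart hup
    (Filter.Eventually.of_forall fun n => ?_) ?_
  · rw [hA, hbit]
    gcongr with x
    split_ifs
    · exact le_rfl
    · exact (SocketGraph.erasureProb_mem_Icc _ hε0 hε1 _ _).1
  · filter_upwards [eventually_admissible L R,
      (blocklengths_le L R) (eventually_gt_atTop 0)] with n hn hpos
    have hcard : ((Nat.card (Wiring L R n) : ℝ) * Nat.card (VNode L n)) ≠ 0 := by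
      rw [card_wiring hR hn, Nat.card_eq_fintype_card, card_VNode hL hn]
      have := Nat.factorial_ne_zero (Fintype.card (VSocket L n))
      have := hpos.ne'
      positivity
    have h1 : (1 : ℝ) = (∑ x : Wiring L R n × VNode L n, (1 : ℝ)) /
        (Nat.card (Wiring L R n) * Nat.card (VNode L n)) := by
      rw [Finset.sum_const, Finset.card_univ, nsmul_one, ← Nat.card_eq_fintype_card, Nat.card_prod,
        Nat.cast_mul, div_self hcard]
    have h2 : ∑ q ∈ S, nbhdProb L R t n q * q.out.rootErasure ε t +
        (1 - ∑ q ∈ S, nbhdProb L R t n q) = (∑ x : Wiring L R n × VNode L n,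
        ((if (⟦(tanner x.1).nbhd x.2 t⟧ : GraphClass) ∈ S then (tanner x.1).erasureProb ε t x.2
          else 0) + (1 - if (⟦(tanner x.1).nbhd x.2 t⟧ : GraphClass) ∈ S then 1 else 0))) /
        (Nat.card (Wiring L R n) * Nat.card (VNode L n)) := by
      rw [Finset.sum_add_distrib, Finset.sum_sub_distrib, add_div, sub_div, ← h1, hA, hB]
    rw [h2, hbit]
    gcongr with x
    split_ifs
    · simp
    · simpa using (SocketGraph.erasureProb_mem_Icc _ hε0 hε1 _ _).2

end

/-! ### Factorial moments of the tree ensemble -/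

lemma prod_update_one_eq_pow {ι : Type*} [Fintype ι] (d : ι → ℕ) (i : ℕ) (x : ℝ) :
    ∏ v, Function.update (fun _ => (1 : ℝ)) i x (d v) = x ^ {v | d v = i}.ncard := by
  classical
  simp only [Function.update_apply, Finset.prod_ite, Finset.prod_const, one_pow, mul_one]
  rw [← Set.ncard_coe_finset]
  simp

section

variable {L R : ℝ[X]} (hL : IsDegreeDistribution L) (hR : IsDegreeDistribution R)
  (hLR : ∃ n, 0 < n ∧ Admissible L R n) (ε : ℝ) (t : ℕ)
include hL hR hLR

/-- The canonical generating function of the tree ensemble. -/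
lemma treeExp_prod_mul_rootErasure (y z : ℕ → ℝ) :
    treeExp L R t (fun T => (∏ v, y (T.graph.degV v)) * (∏ c, z (T.graph.degC c)) *
      T.rootErasure ε t) = ε * augNode L y (augF L R ε t y z) := by
  rw [treeExp_eq_sum_planeTree hL hR hLR]
  · rw [← PlaneTree.sum_rootWeight_mul_erased y z (B := degreeBound L R)
      (by unfold degreeBound; omega) (by unfold degreeBound; omega)]
    refine Finset.sum_congr rfl fun τ _ => ?_
    rw [← PlaneTree.treeProb_rooted_mul, PlaneTree.rootErasure_rooted]
    ring
  · intro G H h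
    rw [RootedGraph.prod_degV_eq h, RootedGraph.prod_degC_eq h, RootedGraph.rootErasure_eq h]

lemma treeExp_rootErasure :
    treeExp L R t (fun T => T.rootErasure ε t) = ε * L.eval (densP L R ε t) := by
  have := treeExp_prod_mul_rootErasure hL hR hLR ε t (fun _ => 1) (fun _ => 1)
  simpa only [Finset.prod_const_one, one_mul, augF_one hL hR, ← eval_eq_augNode] using this

lemma treeExp_samplingCoeff_mul (W : RootedGraph → ℝ) :
    treeExp L R t (fun T => samplingCoeff L R T * W T) = 1 / (2 * evalD 1 L 1) *
      (treeExp L R t (fun T => T.numEdges * (T.numEdges - 1) * W T)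
        - ∑ i ∈ L.support, i / edgeFrac L i *
            treeExp L R t (fun T => T.numV i * (T.numV i - 1) * W T)
        - ∑ j ∈ R.support, j / edgeFrac R j *
            treeExp L R t (fun T => T.numC j * (T.numC j - 1) * W T)) := by
  simp only [treeExp_eq_sum hL hR hLR, Finset.mul_sum]
  rw [Finset.sum_comm (s := L.support), Finset.sum_comm (s := R.support),
    ← Finset.sum_sub_distrib, ← Finset.sum_sub_distrib, Finset.mul_sum]
  refine Finset.sum_congr rfl fun q _ => ?_
  simp only [samplingCoeff, mul_sub, sub_mul, Finset.mul_sum, Finset.sum_mul]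
  congr 1
  · congr 1
    · ring
    · exact Finset.sum_congr rfl fun i _ => by ring
  · exact Finset.sum_congr rfl fun i _ => by ring

/-- A second factorial moment is the second derivative at `1` of its generating function. -/
lemma treeExp_factorial_moment (N : RootedGraph → ℕ) (W : RootedGraph → ℝ) {k : ℝ → ℝ} {a b c : ℝ}
    (hk : ∀ᶠ x in 𝓝 (1 : ℝ), treeExp L R t (fun T => x ^ N T * W T) = k x) (H : HasJet k a b c) :
    treeExp L R t (fun T => N T * (N T - 1) * W T) = c := by
  simp only [treeExp_eq_sum hL hR hLR] at hk ⊢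
  have h1 := HasJet.sum (treeClasses L R t) fun q _ =>
    (HasJet.pow (N q.out)).const_mul (treeProb L R q.out * W q.out)
  rw [← H.iteratedDeriv_two, HasJet.congr_of_eventuallyEq h1]
  · exact Finset.sum_congr rfl fun q _ => by ring
  · filter_upwards [hk] with x hx
    rw [← hx]
    exact Finset.sum_congr rfl fun q _ => by ring

lemma treeExp_numEdges_mul :
    treeExp L R t (fun T => T.numEdges * (T.numEdges - 1) * T.rootErasure ε t) =
      ε * evalD 2 L (densP L R ε t) * dAll 1 (augF L R ε t) ^ 2
        + ε * evalD 1 L (densP L R ε t) * dAll 2 (augF L R ε t) := by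
  have hF := curveJet_augF hL hR (isAugCurve_all L R) ε t
  rw [treeExp_factorial_moment hL hR hLR t RootedGraph.numEdges _ ?_
    ((HasJet.perturb hF L 0).const_mul ε)]
  · simp only [evalD_zero_poly]
    change ε * (_ * dAll 1 (augF L R ε t) ^ 2 + _ * dAll 2 (augF L R ε t) + _) = _
    ring
  -- the generating function counts nodes; near `1` the surplus factor `x` can be cancelled
  filter_upwards [eventually_ne_nhds one_ne_zero] with x hx
  refine mul_left_cancel₀ hx ?_
  have h := treeExp_prod_mul_rootErasure hL hR hLR ε t (fun _ => x) (fun _ => x)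
  rw [augNode_const] at h
  -- a tree has one node more than it has edges
  have h1 : treeExp L R t (fun T => (∏ _v : T.V, x) * (∏ _c : T.C, x) * T.rootErasure ε t) =
      x * treeExp L R t (fun T => x ^ T.numEdges * T.rootErasure ε t) := by
    simp only [treeExp_eq_sum hL hR hLR, Finset.mul_sum]
    refine Finset.sum_congr rfl fun q hq => ?_
    have hcf : q.out.CycleFree := by
      obtain ⟨V, C, _, _, T, v₀, -, hcf, rfl⟩ := (treeClasses_subset hL hq).1
      exact (RootedGraph.cycleFree_iff (Quotient.mk_out (s := RootedGraph.setoid) _)).2 hcf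
    rw [Finset.prod_const, Finset.prod_const, ← pow_add, Finset.card_univ, Finset.card_univ,
      ← hcf]
    ring
  rw [← h1, h]
  simp only [eval_zero, mul_zero, add_zero]
  ring

lemma treeExp_numV_mul (i : ℕ) :
    treeExp L R t (fun T => T.numV i * (T.numV i - 1) * T.rootErasure ε t) =
      ε * evalD 2 L (densP L R ε t) * dV 1 (augF L R ε t) i ^ 2
        + ε * evalD 1 L (densP L R ε t) * dV 2 (augF L R ε t) i
        + 2 * ε * L.coeff i * i * densP L R ε t ^ (i - 1) * dV 1 (augF L R ε t) i := by
  have hF := curveJet_augF hL hR (isAugCurve_var L R i) ε t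
  rw [treeExp_factorial_moment hL hR hLR t (fun T => T.numV i) _ ?_
    ((HasJet.perturb hF L (Polynomial.C (L.coeff i) * X ^ i)).const_mul ε)]
  · rw [evalD_C_mul_X_pow]
    change ε * (_ * dV 1 (augF L R ε t) i ^ 2 + _ * dV 2 (augF L R ε t) i
      + _ * dV 1 (augF L R ε t) i) = _
    ring
  refine Filter.Eventually.of_forall fun x => ?_
  have h := treeExp_prod_mul_rootErasure hL hR hLR ε t (Function.update (fun _ => 1) i x)
    (fun _ => 1)
  simpa only [RootedGraph.numV, prod_update_one_eq_pow, Finset.prod_const_one, mul_one,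
    augNode_update] using h

lemma treeExp_numC_mul (j : ℕ) :
    treeExp L R t (fun T => T.numC j * (T.numC j - 1) * T.rootErasure ε t) =
      ε * evalD 2 L (densP L R ε t) * dC 1 (augF L R ε t) j ^ 2
        + ε * evalD 1 L (densP L R ε t) * dC 2 (augF L R ε t) j := by
  have hF := curveJet_augF hL hR (isAugCurve_check L R j) ε t
  rw [treeExp_factorial_moment hL hR hLR t (fun T => T.numC j) _ ?_
    ((HasJet.perturb hF L 0).const_mul ε)]
  · simp only [evalD_zero_poly]
    change ε * (_ * dC 1 (augF L R ε t) j ^ 2 + _ * dC 2 (augF L R ε t) j + _) = _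
    ring
  refine Filter.Eventually.of_forall fun x => ?_
  have h := treeExp_prod_mul_rootErasure hL hR hLR ε t (fun _ => 1)
    (Function.update (fun _ => 1) j x)
  simpa only [RootedGraph.numC, prod_update_one_eq_pow, Finset.prod_const_one, one_mul,
    eval_zero, mul_zero, add_zero, eval_eq_augNode] using h

end

/-! ### The expansion of the bit error probability -/

theorem theorem1 (L R : ℝ[X]) (hL : IsDegreeDistribution L) (hR : IsDegreeDistribution R)
    (hLR : ∃ n, 0 < n ∧ Admissible L R n) (ε : ℝ) (hε0 : 0 ≤ ε) (hε1 : ε ≤ 1)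
    (lam rho : ℝ[X]) (hlam : lam = edgePoly L) (hrho : rho = edgePoly R)
    (P Q : ℕ → ℝ) (hP : P = densP L R ε) (hQ : Q = densQ L R ε)
    (f g F G : ℕ → (ℕ → ℝ) → (ℕ → ℝ) → ℝ) (hf : f = augf L R) (hg : g = augg L R)
    (hF : F = augF L R ε) (hG : G = augG L R ε) (t : ℕ) :
    -- the limits which define the bit error probability at infinity and the coefficient `β`
    (∃ PbInf β : ℝ,
      Tendsto (fun n => bitErrorProb L R ε t n) (blocklengths L R) (𝓝 PbInf) ∧
      Tendsto (fun n : ℕ => (n : ℝ) * (cycleFreePart L R ε t n - PbInf)) (blocklengths L R)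
        (𝓝 β) ∧
      PbInf = ε * L.eval (P t) ∧
      β = 1 / (2 * evalD 1 L 1) *
        (treeExp L R t (fun T => T.numEdges * (T.numEdges - 1) * T.rootErasure ε t)
          - ∑ i ∈ L.support, i / edgeFrac L i *
              treeExp L R t (fun T => T.numV i * (T.numV i - 1) * T.rootErasure ε t)
          - ∑ j ∈ R.support, j / edgeFrac R j *
              treeExp L R t (fun T => T.numC j * (T.numC j - 1) * T.rootErasure ε t))) ∧
    -- the tree ensemble is finitely supported
    {q ∈ cycleFreeClasses t | treeProb L R q.out ≠ 0}.Finite ∧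
    -- the canonical generating function
    (∀ y z : ℕ → ℝ,
      treeExp L R t (fun T => (∏ v, y (T.graph.degV v)) * (∏ c, z (T.graph.degC c)) *
        T.rootErasure ε t) = ε * augNode L y (F t y z)) ∧
    -- the three second factorial moments
    treeExp L R t (fun T => T.numEdges * (T.numEdges - 1) * T.rootErasure ε t) =
      ε * evalD 2 L (P t) * dAll 1 (F t) ^ 2 + ε * evalD 1 L (P t) * dAll 2 (F t) ∧
    (∀ i, treeExp L R t (fun T => T.numV i * (T.numV i - 1) * T.rootErasure ε t) =
      ε * evalD 2 L (P t) * dV 1 (F t) i ^ 2 + ε * evalD 1 L (P t) * dV 2 (F t) i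
        + 2 * ε * L.coeff i * i * P t ^ (i - 1) * dV 1 (F t) i) ∧
    (∀ j, treeExp L R t (fun T => T.numC j * (T.numC j - 1) * T.rootErasure ε t) =
      ε * evalD 2 L (P t) * dC 1 (F t) j ^ 2 + ε * evalD 1 L (P t) * dC 2 (F t) j) ∧
    -- recursions, all auxiliary variables equal
    (dAll 1 (f 0) = 0 ∧ dAll 1 (F 0) = 0 ∧ dAll 2 (f 0) = 0 ∧ dAll 2 (F 0) = 0) ∧
    (∀ s,
      dAll 1 (f (s + 1)) = 1 + evalD 1 rho 1 * dAll 1 (g (s + 1)) ∧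
      dAll 1 (g (s + 1)) = 1 + evalD 1 lam 1 * dAll 1 (f s) ∧
      dAll 1 (F (s + 1)) = dAll 1 (f (s + 1)) - rho.eval (1 - Q (s + 1))
        - evalD 1 rho (1 - Q (s + 1)) * dAll 1 (G (s + 1)) ∧
      dAll 1 (G (s + 1)) = dAll 1 (g (s + 1)) - ε * lam.eval (P s)
        - ε * evalD 1 lam (P s) * dAll 1 (F s) ∧
      dAll 2 (f (s + 1)) = 2 * evalD 1 rho 1 * dAll 1 (g (s + 1))
        + evalD 2 rho 1 * dAll 1 (g (s + 1)) ^ 2 + evalD 1 rho 1 * dAll 2 (g (s + 1)) ∧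
      dAll 2 (g (s + 1)) = 2 * evalD 1 lam 1 * dAll 1 (f s)
        + evalD 2 lam 1 * dAll 1 (f s) ^ 2 + evalD 1 lam 1 * dAll 2 (f s) ∧
      dAll 2 (F (s + 1)) = dAll 2 (f (s + 1))
        - 2 * evalD 1 rho (1 - Q (s + 1)) * dAll 1 (G (s + 1))
        - evalD 2 rho (1 - Q (s + 1)) * dAll 1 (G (s + 1)) ^ 2
        - evalD 1 rho (1 - Q (s + 1)) * dAll 2 (G (s + 1)) ∧
      dAll 2 (G (s + 1)) = dAll 2 (g (s + 1)) - 2 * ε * evalD 1 lam (P s) * dAll 1 (F s)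
        - ε * evalD 2 lam (P s) * dAll 1 (F s) ^ 2 - ε * evalD 1 lam (P s) * dAll 2 (F s)) ∧
    -- recursions, variable nodes of degree `i`
    (∀ i, dV 1 (f 0) i = 0 ∧ dV 1 (F 0) i = 0 ∧ dV 2 (f 0) i = 0 ∧ dV 2 (F 0) i = 0) ∧
    (∀ s i,
      dV 1 (f (s + 1)) i = evalD 1 rho 1 * dV 1 (g (s + 1)) i ∧
      dV 1 (g (s + 1)) i = evalD 1 lam 1 * dV 1 (f s) i + edgeFrac L i ∧
      dV 1 (F (s + 1)) i = dV 1 (f (s + 1)) i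
        - evalD 1 rho (1 - Q (s + 1)) * dV 1 (G (s + 1)) i ∧
      dV 1 (G (s + 1)) i = dV 1 (g (s + 1)) i - ε * evalD 1 lam (P s) * dV 1 (F s) i
        - ε * edgeFrac L i * P s ^ (i - 1) ∧
      dV 2 (f (s + 1)) i = evalD 2 rho 1 * dV 1 (g (s + 1)) i ^ 2
        + evalD 1 rho 1 * dV 2 (g (s + 1)) i ∧
      dV 2 (g (s + 1)) i = evalD 2 lam 1 * dV 1 (f s) i ^ 2 + evalD 1 lam 1 * dV 2 (f s) i
        + 2 * edgeFrac L i * ((i : ℝ) - 1) * dV 1 (f s) i ∧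
      dV 2 (F (s + 1)) i = dV 2 (f (s + 1)) i
        - evalD 2 rho (1 - Q (s + 1)) * dV 1 (G (s + 1)) i ^ 2
        - evalD 1 rho (1 - Q (s + 1)) * dV 2 (G (s + 1)) i ∧
      dV 2 (G (s + 1)) i = dV 2 (g (s + 1)) i - ε * evalD 2 lam (P s) * dV 1 (F s) i ^ 2
        - ε * evalD 1 lam (P s) * dV 2 (F s) i
        - 2 * ε * edgeFrac L i * ((i : ℝ) - 1) * P s ^ (i - 2) * dV 1 (F s) i) ∧
    -- recursions, check nodes of degree `j`
    (∀ j, dC 1 (f 0) j = 0 ∧ dC 1 (F 0) j = 0 ∧ dC 2 (f 0) j = 0 ∧ dC 2 (F 0) j = 0) ∧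
    (∀ s j,
      dC 1 (f (s + 1)) j = evalD 1 rho 1 * dC 1 (g (s + 1)) j + edgeFrac R j ∧
      dC 1 (g (s + 1)) j = evalD 1 lam 1 * dC 1 (f s) j ∧
      dC 1 (F (s + 1)) j = dC 1 (f (s + 1)) j
        - evalD 1 rho (1 - Q (s + 1)) * dC 1 (G (s + 1)) j
        - edgeFrac R j * (1 - Q (s + 1)) ^ (j - 1) ∧
      dC 1 (G (s + 1)) j = dC 1 (g (s + 1)) j - ε * evalD 1 lam (P s) * dC 1 (F s) j ∧
      dC 2 (f (s + 1)) j = evalD 2 rho 1 * dC 1 (g (s + 1)) j ^ 2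
        + evalD 1 rho 1 * dC 2 (g (s + 1)) j
        + 2 * edgeFrac R j * ((j : ℝ) - 1) * dC 1 (g (s + 1)) j ∧
      dC 2 (g (s + 1)) j = evalD 2 lam 1 * dC 1 (f s) j ^ 2 + evalD 1 lam 1 * dC 2 (f s) j ∧
      dC 2 (F (s + 1)) j = dC 2 (f (s + 1)) j
        - evalD 2 rho (1 - Q (s + 1)) * dC 1 (G (s + 1)) j ^ 2
        - evalD 1 rho (1 - Q (s + 1)) * dC 2 (G (s + 1)) j
        - 2 * edgeFrac R j * ((j : ℝ) - 1) * (1 - Q (s + 1)) ^ (j - 2)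
          * dC 1 (G (s + 1)) j ∧
      dC 2 (G (s + 1)) j = dC 2 (g (s + 1)) j - ε * evalD 2 lam (P s) * dC 1 (F s) j ^ 2
        - ε * evalD 1 lam (P s) * dC 2 (F s) j) := by
  subst hlam hrho hP hQ hf hg hF hG
  refine ⟨⟨_, _, tendsto_bitErrorProb hL hR hLR hε0 hε1 t, tendsto_cycleFreePart hL hR hLR ε t,
    treeExp_rootErasure hL hR hLR ε t, treeExp_samplingCoeff_mul hL hR hLR t _⟩,
    (treeClasses L R t).finite_toSet.subset fun q hq => (mem_treeClasses_iff hL hR hLR).2 hq,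
    treeExp_prod_mul_rootErasure hL hR hLR ε t, treeExp_numEdges_mul hL hR hLR ε t,
    treeExp_numV_mul hL hR hLR ε t, treeExp_numC_mul hL hR hLR ε t, ?_, fun s => ?_, fun i => ?_,
    fun s i => ?_, fun j => ?_, fun s j => ?_⟩
  · have h := HasJet.const 1
    exact ⟨h.iteratedDeriv_one, h.iteratedDeriv_one, h.iteratedDeriv_two, h.iteratedDeriv_two⟩
  · have hc := isAugCurve_all L R
    obtain ⟨jg, g1, g2⟩ := curveJet_augg hL hc (curveJet_augf hL hR hc s)
    obtain ⟨-, f1, f2⟩ := curveJet_augf_succ hR hc jg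
    obtain ⟨jG, G1, G2⟩ := curveJet_augG hL hR hc (curveJet_augF hL hR hc ε s)
    obtain ⟨-, F1, F2⟩ := curveJet_augF_succ hL hR hc jG
    rw [hL.eval_edgePoly_one] at g1
    rw [hR.eval_edgePoly_one] at f1
    refine ⟨f1.trans ?_, g1.trans ?_, F1.trans ?_, G1.trans ?_, f2.trans ?_, g2.trans ?_,
      F2.trans ?_, G2.trans ?_⟩ <;> unfold dAll curveDeriv <;> ring
  · have h := HasJet.const 1
    exact ⟨h.iteratedDeriv_one, h.iteratedDeriv_one, h.iteratedDeriv_two, h.iteratedDeriv_two⟩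
  · have hc := isAugCurve_var L R i
    obtain ⟨jg, g1, g2⟩ := curveJet_augg hL hc (curveJet_augf hL hR hc s)
    obtain ⟨-, f1, f2⟩ := curveJet_augf_succ hR hc jg
    obtain ⟨jG, G1, G2⟩ := curveJet_augG hL hR hc (curveJet_augF hL hR hc ε s)
    obtain ⟨-, F1, F2⟩ := curveJet_augF_succ hL hR hc jG
    simp only [evalD_C_mul_X_pow, evalD_zero_poly, edgeFrac_mul_pred, Nat.sub_sub, one_pow,
      eval_mul, eval_pow, eval_C, eval_X, eval_zero] at f1 f2 g1 g2 F1 F2 G1 G2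
    refine ⟨f1.trans ?_, g1.trans ?_, F1.trans ?_, G1.trans ?_, f2.trans ?_, g2.trans ?_,
      F2.trans ?_, G2.trans ?_⟩ <;> unfold dV curveDeriv <;> ring
  · have h := HasJet.const 1
    exact ⟨h.iteratedDeriv_one, h.iteratedDeriv_one, h.iteratedDeriv_two, h.iteratedDeriv_two⟩
  · have hc := isAugCurve_check L R j
    obtain ⟨jg, g1, g2⟩ := curveJet_augg hL hc (curveJet_augf hL hR hc s)
    obtain ⟨-, f1, f2⟩ := curveJet_augf_succ hR hc jg
    obtain ⟨jG, G1, G2⟩ := curveJet_augG hL hR hc (curveJet_augF hL hR hc ε s)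
    obtain ⟨-, F1, F2⟩ := curveJet_augF_succ hL hR hc jG
    simp only [evalD_C_mul_X_pow, evalD_zero_poly, edgeFrac_mul_pred, Nat.sub_sub, one_pow,
      eval_mul, eval_pow, eval_C, eval_X, eval_zero] at f1 f2 g1 g2 F1 F2 G1 G2
    refine ⟨f1.trans ?_, g1.trans ?_, F1.trans ?_, G1.trans ?_, f2.trans ?_, g2.trans ?_,
      F2.trans ?_, G2.trans ?_⟩ <;> unfold dC curveDeriv <;> ring
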